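/- Let $S$ be a complete separable metric space, let $h_1,h_2,\dots$ be bounded continuous functions on $S$ with $0\le h_k\le 1$ and $\bigcup_k\{x: h_k(x)>0\}=S$. Let $\mathcal M_{\{h_k\}}(S)$ be the set of Borel measures $\nu$ on $S$ with $\int_S h_k\,d\nu<\infty$ for all $k$, with the topology in which $\nu_n\to\nu$ iff $\int_S f h_k\,d\nu_n\to\int_S f h_k\,d\nu$ for all $k$ and all bounded continuous $f$ on $S$. Let $\mathcal M_{\{h_k\}}(S\times[0,\infty))$ be the set of Borel measures $\mu$ on $S\times[0,\infty)$ with $\int_{S\times[0,K]}h_k(x)\,\mu(dx\times du)<\infty$ for all $k$ and $K>0$, with the topology in which $\mu_n\to\mu$ iff $\int f h_k\,d\mu_n\to\int f h_k\,d\mu$ for all $k$ and all bounded continuous $f$ on $S\times[0,\infty)$ whose support is contained in $S\times[0,K]$ for some $K>0$. Let $\Rightarrow$ denote convergence in distribution of random elements of these spaces. For each $n$ let $r_n>0$, let $\xi^n$ be a point process on $S\times[0,r_n]$ (a random counting measure with values in $\mathcal M_{\{h_k\}}(S\times[0,\infty))$ that almost surely has no mass outside $S\times[0,r_n]$), and define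 $$\Xi^n(dx)=\frac1{r_n}\,\xi^n(dx\times[0,r_n]).$$ Suppose that for every Borel measurable $f:S\times[0,\infty)\to[0,\infty)$, $$E\Big[e^{-\int f(x,u)\,\xi^n(dx\times du)}\Big]=E\Big[e^{-\int F^n_f(x)\,\Xi^n(dx)}\Big],\qquad F^n_f(x)=-r_n\log\frac1{r_n}\int_0^{r_n}e^{-f(x,u)}\,du,$$ that is, the $[0,r_n]$ components of the points are independent, uniformly distributed on $[0,r_n]$, and independent of $\Xi^n$. Assume $r_n\to\infty$. Then: (i) $\xi^n\Rightarrow\xi$ in $\mathcal M_{\{h_k\}}(S\times[0,\infty))$ for some $\xi$ if and only if $\Xi^n\Rightarrow\Xi$ in $\mathcal M_{\{h_k\}}(S)$ for some $\Xi$; (ii) if $\xi^n\Rightarrow\xi$ and $\Xi^n\Rightarrow\Xi$, then $\xi$ is conditionally Poisson with Cox measure $\Xi\times\Lambda$, where $\Lambda$ is Lebesgue measure on $[0,\infty)$; that is, the law of $\xi$ is the mixture, over the law of $\Xi$, of the laws of Poisson random measures with mean measure $\Xi\times\Lambda$; (iii) if $\xi$ is conditionally Poisson with Cox measure $\Xi\times\Lambda$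 in this sense, then $\xi^n\Rightarrow\xi$ if and only if $\Xi^n\Rightarrow\Xi$. -/

import Mathlib

open MeasureTheory ProbabilityTheory Filter Topology
open scoped NNReal ENNReal BoundedContinuousFunction

noncomputable section

/-- Lebesgue measure on the half-line `[0, ∞)`. -/
def halfLineLebesgue : Measure ℝ≥0 :=
  ((volume : Measure ℝ).restrict (Set.Ici 0)).map Real.toNNReal

/-- `exp (-x)` for `x ∈ [0, ∞]`, with `exp (-∞) = 0`. -/
def expNeg (x : ℝ≥0∞) : ℝ :=
  if x = ∞ then 0 else Real.exp (-x.toReal)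

/-- A counting measure: it takes values in `{0, 1, 2, …, ∞}` on measurable sets. -/
def IsCountingMeasure {E : Type*} [MeasurableSpace E] (μ : Measure E) : Prop :=
  ∀ A : Set E, MeasurableSet A → ∃ m : ℕ∞, μ A = (m : ℝ≥0∞)

section Spaces

variable {S : Type*} [TopologicalSpace S] [MeasurableSpace S]

/-- The space `M_{h_k}(S)` of Borel measures `ν` on `S` with `∫ h_k dν < ∞` for all `k`. -/
def LocationMeasures (h : ℕ → S →ᵇ ℝ) : Type _ :=
  {ν : Measure S // ∀ k, ∫⁻ x, ENNReal.ofReal (h k x) ∂ν < ∞}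

/-- The space `M_{h_k}(S × [0, ∞))` of Borel measures `μ` on `S × [0, ∞)` with
`∫_{S × [0, K]} h_k dμ < ∞` for all `k` and `K`. -/
def LevelMeasures (h : ℕ → S →ᵇ ℝ) : Type _ :=
  {μ : Measure (S × ℝ≥0) //
    ∀ (k : ℕ) (K : ℝ≥0), ∫⁻ z in {z : S × ℝ≥0 | z.2 ≤ K}, ENNReal.ofReal (h k z.1) ∂μ < ∞}

/-- The coarsest topology making `ν ↦ ∫ f h_k dν` continuous for all bounded continuous `f` and
all `k`. -/
instance LocationMeasures.instTopologicalSpace (h : ℕ → S →ᵇ ℝ) :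
    TopologicalSpace (LocationMeasures h) :=
  ⨅ (k : ℕ) (f : S →ᵇ ℝ),
    TopologicalSpace.induced (fun ν : LocationMeasures h => ∫ x, f x * h k x ∂ν.1) inferInstance

/-- The coarsest topology making `μ ↦ ∫ f h_k dμ` continuous for all `k` and all bounded
continuous `f` on `S × [0, ∞)` supported in some `S × [0, K]`. -/
instance LevelMeasures.instTopologicalSpace (h : ℕ → S →ᵇ ℝ) :
    TopologicalSpace (LevelMeasures h) :=
  ⨅ (k : ℕ) (f : {f : (S × ℝ≥0) →ᵇ ℝ // ∃ K : ℝ≥0, ∀ x u, K < u → f (x, u) = 0}),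
    TopologicalSpace.induced (fun μ : LevelMeasures h => ∫ z, f.1 z * h k z.1 ∂μ.1) inferInstance

instance LocationMeasures.instMeasurableSpace (h : ℕ → S →ᵇ ℝ) :
    MeasurableSpace (LocationMeasures h) := borel _

instance LocationMeasures.instBorelSpace (h : ℕ → S →ᵇ ℝ) :
    BorelSpace (LocationMeasures h) := ⟨rfl⟩

instance LevelMeasures.instMeasurableSpace (h : ℕ → S →ᵇ ℝ) :
    MeasurableSpace (LevelMeasures h) := borel _

instance LevelMeasures.instBorelSpace (h : ℕ → S →ᵇ ℝ) :
    BorelSpace (LevelMeasures h) := ⟨rfl⟩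

/-- The measure `A ↦ r⁻¹ μ(A × [0, r])` on `S` (it is `0` for the irrelevant value `r = 0`). -/
def LevelMeasures.normalizedMarginal [BorelSpace S] {h : ℕ → S →ᵇ ℝ} (r : ℝ≥0)
    (μ : LevelMeasures h) : LocationMeasures h :=
  ⟨r⁻¹ • (μ.1.restrict {z : S × ℝ≥0 | z.2 ≤ r}).map Prod.fst, fun k => by
    have hm : Measurable fun x => ENNReal.ofReal (h k x) :=
      ENNReal.measurable_ofReal.comp (h k).continuous.measurable
    rw [lintegral_smul_measure, lintegral_map hm measurable_fst]
    exact ENNReal.mul_lt_top ENNReal.coe_lt_top (μ.2 k r)⟩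

/-- `F_f^r(x) = -r log (r⁻¹ ∫_0^r exp (-f(x, u)) du)`. -/
def levelTransform (r : ℝ≥0) (f : S × ℝ≥0 → ℝ) (x : S) : ℝ :=
  -(r : ℝ) * Real.log ((r : ℝ)⁻¹ * ∫ u in Set.Iic r, Real.exp (-f (x, u)) ∂halfLineLebesgue)

/-- `ρ` is the law of a Poisson random measure on `S × [0, ∞)` with mean measure `m`. -/
structure IsPoissonLaw {h : ℕ → S →ᵇ ℝ} (ρ : Measure (LevelMeasures h))
    (m : Measure (S × ℝ≥0)) : Prop where
  isProbabilityMeasure : IsProbabilityMeasure ρ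
  counting : ∀ᵐ μ ∂ρ, IsCountingMeasure μ.1
  poisson : ∀ A : Set (S × ℝ≥0), MeasurableSet A → m A < ∞ →
    ρ.map (fun μ => μ.1 A) = (poissonMeasure (m A).toNNReal).map (fun j : ℕ => (j : ℝ≥0∞))
  indep : ∀ A : ℕ → Set (S × ℝ≥0), (∀ i, MeasurableSet (A i)) →
    Pairwise (fun i j => Disjoint (A i) (A j)) → iIndepFun (fun i μ => μ.1 (A i)) ρ

/-- A random measure on `S × [0, ∞)` with law `Q` is conditionally Poisson with Cox measure
`Ξ × Λ`, where `Ξ` has law `P` and `Λ` is Lebesgue measure: there is a conditional distribution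
`κ` given `Ξ` under which it is Poisson with mean measure `Ξ × Λ`, and mixing `κ` over the law of
`Ξ` gives `Q`. -/
def IsConditionallyPoisson {h : ℕ → S →ᵇ ℝ} (Q : Measure (LevelMeasures h))
    (P : Measure (LocationMeasures h)) : Prop :=
  ∃ κ : Kernel (LocationMeasures h) (LevelMeasures h), IsMarkovKernel κ ∧
    (∀ᵐ ν ∂P, IsPoissonLaw (κ ν) (ν.1.prod halfLineLebesgue)) ∧ Q = P.bind κ

end Spaces

end

/-!
The law of a random measure is determined by its Laplace functional `f ↦ E[exp (-∫ f dX)]`, and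
convergence of the Laplace functionals of nonnegative test functions implies convergence in
distribution. As `r → ∞`, the function `levelTransform r f` converges to
`x ↦ ∫ (1 - exp (-f(x, u))) du`, the exponent that turns the Laplace functional of `Ξ` into that of
the Poisson mixture with mean `Ξ × Λ`. Hence convergence of `Ξⁿ` forces `ξⁿ` to converge to this
mixture.

Conversely, spreading a test function `G` on `S` over the levels `[0, K + 1]` with a triangular
density gives a test function of height `O(1 / K)` whose exponent differs from `G` by `O(1 / K)`.
Therefore a limit of `ξⁿ` determines the limiting Laplace functional of `Ξⁿ`. That this limit
comes from a random measure follows by tightness: the triangular averages of the limit of `ξⁿ` have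
Laplace functionals bounded below by those of a single average, and every limit point of their laws
along an ultrafilter is the limit law of `Ξⁿ`.
-/

/-! ### The exponential on `[0, ∞]` -/

lemma expNeg_zero : expNeg 0 = 1 := by simp [expNeg]

lemma expNeg_top : expNeg ∞ = 0 := by simp [expNeg]

lemma expNeg_of_ne_top {x : ℝ≥0∞} (hx : x ≠ ∞) : expNeg x = Real.exp (-x.toReal) := by
  simp [expNeg, hx]

lemma expNeg_ofReal {t : ℝ} (ht : 0 ≤ t) : expNeg (ENNReal.ofReal t) = Real.exp (-t) := by
  simp [expNeg, ENNReal.toReal_ofReal ht]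

lemma expNeg_nonneg (x : ℝ≥0∞) : 0 ≤ expNeg x := by
  unfold expNeg; split_ifs <;> positivity

lemma expNeg_le_one (x : ℝ≥0∞) : expNeg x ≤ 1 := by
  unfold expNeg; split_ifs
  · exact zero_le_one
  · simp

lemma norm_expNeg_le_one (x : ℝ≥0∞) : ‖expNeg x‖ ≤ 1 := by
  rw [Real.norm_of_nonneg (expNeg_nonneg x)]; exact expNeg_le_one x

lemma expNeg_add (x y : ℝ≥0∞) : expNeg (x + y) = expNeg x * expNeg y := by
  by_cases hx : x = ∞
  · simp [hx, expNeg_top]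
  by_cases hy : y = ∞
  · simp [hy, expNeg_top]
  rw [expNeg_of_ne_top hx, expNeg_of_ne_top hy, expNeg_of_ne_top (by simp [hx, hy]),
    ENNReal.toReal_add hx hy, neg_add, Real.exp_add]

lemma expNeg_sum {ι : Type*} (s : Finset ι) (x : ι → ℝ≥0∞) :
    expNeg (∑ i ∈ s, x i) = ∏ i ∈ s, expNeg (x i) := by
  classical
  induction s using Finset.induction_on with
  | empty => simp [expNeg_zero]
  | insert a s ha ih => rw [Finset.sum_insert ha, Finset.prod_insert ha, expNeg_add, ih]

lemma expNeg_antitone : Antitone expNeg := by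
  intro x y hxy
  by_cases hy : y = ∞
  · simpa only [hy, expNeg_top] using expNeg_nonneg x
  rw [expNeg_of_ne_top (ne_top_of_le_ne_top hy hxy), expNeg_of_ne_top hy, Real.exp_le_exp,
    neg_le_neg_iff]
  exact ENNReal.toReal_mono hy hxy

lemma expNeg_injective : Function.Injective expNeg := by
  intro x y h
  by_cases hx : x = ∞ <;> by_cases hy : y = ∞
  · rw [hx, hy]
  · rw [hx, expNeg_top, expNeg_of_ne_top hy] at h
    exact absurd h.symm (Real.exp_ne_zero _)
  · rw [hy, expNeg_top, expNeg_of_ne_top hx] at h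
    exact absurd h (Real.exp_ne_zero _)
  · rw [expNeg_of_ne_top hx, expNeg_of_ne_top hy, Real.exp_eq_exp, neg_inj] at h
    exact (ENNReal.toReal_eq_toReal_iff' hx hy).1 h

lemma expNeg_eq_toReal_exp (x : ℝ≥0∞) : expNeg x = (EReal.exp (-(x : EReal))).toReal := by
  unfold expNeg
  induction x with
  | top => simp
  | coe x =>
    have hcoe : (-(((x : ℝ≥0) : ℝ≥0∞) : EReal)) = ((-(x : ℝ) : ℝ) : EReal) := by
      rw [EReal.coe_neg]; rfl
    rw [hcoe, EReal.exp_coe]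
    simp [Real.exp_nonneg]

lemma continuous_expNeg : Continuous expNeg := by
  rw [funext expNeg_eq_toReal_exp]
  have hexp : Continuous fun x : ℝ≥0∞ => EReal.exp (-(x : EReal)) :=
    ENNReal.continuous_exp.comp (continuous_neg.comp continuous_coe_ennreal_ereal)
  refine continuous_iff_continuousAt.2 fun x => ?_
  refine (ENNReal.continuousAt_toReal ?_).comp hexp.continuousAt
  refine ne_top_of_le_ne_top ENNReal.one_ne_top ?_
  rw [← EReal.exp_zero]
  exact EReal.exp_monotone (EReal.neg_le_zero.2 (EReal.coe_ennreal_nonneg x))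

lemma measurable_expNeg : Measurable expNeg := continuous_expNeg.measurable

lemma mul_exp_neg_le_one (t : ℝ) : t * Real.exp (-t) ≤ 1 := by
  rw [Real.exp_neg, ← div_eq_mul_inv, div_le_one (Real.exp_pos _)]
  linarith [Real.add_one_le_exp t]

lemma expNeg_sub_expNeg_le {a b : ℝ≥0∞} {ε : ℝ} (hε : 0 ≤ ε)
    (hb : b ≤ ENNReal.ofReal (1 + ε) * a) : expNeg a - expNeg b ≤ ε := by
  by_cases ha : a = ∞
  · rw [ha, expNeg_top]; linarith [expNeg_nonneg b]
  have hmul : ENNReal.ofReal (1 + ε) * a ≠ ∞ := ENNReal.mul_ne_top ENNReal.ofReal_ne_top ha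
  have hanti := expNeg_antitone hb
  rw [expNeg_of_ne_top hmul, ENNReal.toReal_mul, ENNReal.toReal_ofReal (by linarith)] at hanti
  rw [expNeg_of_ne_top ha]
  set t := a.toReal
  calc Real.exp (-t) - expNeg b ≤ Real.exp (-t) - Real.exp (-t) * Real.exp (-(ε * t)) := by
        rw [← Real.exp_add, show -t + -(ε * t) = -((1 + ε) * t) by ring]; linarith
    _ = Real.exp (-t) * (1 - Real.exp (-(ε * t))) := by ring
    _ ≤ Real.exp (-t) * (ε * t) := by
        gcongr; linarith [Real.add_one_le_exp (-(ε * t))]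
    _ = ε * (t * Real.exp (-t)) := by ring
    _ ≤ ε := mul_le_of_le_one_right hε (mul_exp_neg_le_one t)

lemma abs_expNeg_sub_expNeg_le {a b : ℝ≥0∞} {ε : ℝ} (hε : 0 ≤ ε) (hab : a ≤ b)
    (hb : b ≤ ENNReal.ofReal (1 + ε) * a) : |expNeg a - expNeg b| ≤ ε := by
  rw [abs_of_nonneg (sub_nonneg.2 (expNeg_antitone hab))]
  exact expNeg_sub_expNeg_le hε hb

lemma integrable_expNeg {Ω : Type*} [MeasurableSpace Ω] {P : Measure Ω} [IsFiniteMeasure P]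
    {X : Ω → ℝ≥0∞} (hX : AEMeasurable X P) : Integrable (fun ω => expNeg (X ω)) P :=
  .of_bound (measurable_expNeg.comp_aemeasurable hX).aestronglyMeasurable 1
    (.of_forall fun _ => norm_expNeg_le_one _)

/-- The Laplace functional `f ↦ E[exp (-∫ f dX)]` of a random measure `X`. A law `P` on one of the
spaces of measures has Laplace functional `laplaceFunctional P Subtype.val`. -/
noncomputable def laplaceFunctional {Ω E : Type*} [MeasurableSpace Ω] [MeasurableSpace E]
    (P : Measure Ω) (X : Ω → Measure E) (f : E → ℝ≥0∞) : ℝ :=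
  ∫ ω, expNeg (∫⁻ x, f x ∂(X ω)) ∂P

lemma integrable_expNeg_lintegral {Ω E : Type*} [MeasurableSpace Ω] [MeasurableSpace E]
    {P : Measure Ω} [IsFiniteMeasure P] {X : Ω → Measure E} (hX : Measurable X) {f : E → ℝ≥0∞}
    (hf : Measurable f) : Integrable (fun ω => expNeg (∫⁻ x, f x ∂(X ω))) P :=
  integrable_expNeg ((Measure.measurable_lintegral hf).comp hX).aemeasurable

/-! ### Laws on spaces whose topology is induced from a compact space -/

section DenseSpan

variable {X : Type*} [TopologicalSpace X] {D : Set C(X, ℝ)}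

lemma induction_of_dense_span (hD : Dense (Submodule.span ℝ D : Set C(X, ℝ)))
    {p : C(X, ℝ) → Prop} (mem : ∀ f ∈ D, p f) (zero : p 0) (add : ∀ f g, p f → p g → p (f + g))
    (smul : ∀ (c : ℝ) f, p f → p (c • f)) (closed : IsClosed {f | p f}) (f : C(X, ℝ)) : p f :=
  closed.closure_subset_iff.2 (fun _ hg => Submodule.span_induction mem zero
    (fun f g _ _ => add f g) (fun c f _ => smul c f) hg) (hD f)

variable [CompactSpace X] [MeasurableSpace X]

lemma lipschitzWith_integral_continuousMap [OpensMeasurableSpace X] (P : Measure X)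
    [IsProbabilityMeasure P] : LipschitzWith 1 fun f : C(X, ℝ) => ∫ x, f x ∂P := by
  have hint : ∀ f : C(X, ℝ), Integrable f P := fun f =>
    f.continuous.integrable_of_hasCompactSupport (.of_compactSpace f)
  refine LipschitzWith.of_dist_le_mul fun f g => ?_
  rw [NNReal.coe_one, one_mul, Real.dist_eq, dist_eq_norm, ← integral_sub (hint f) (hint g),
    ← Real.norm_eq_abs]
  simpa using norm_integral_le_of_norm_le_const (μ := P) (.of_forall (f - g).norm_coe_le_norm)

variable [BorelSpace X]

lemma tendsto_of_dense_span (hD : Dense (Submodule.span ℝ D : Set C(X, ℝ))) {α : Type*}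
    {L : Filter α} {P : α → ProbabilityMeasure X} {P₀ : ProbabilityMeasure X}
    (h : ∀ f ∈ D, Tendsto (fun a => ∫ x, f x ∂(P a : Measure X)) L
      (𝓝 (∫ x, f x ∂(P₀ : Measure X)))) : Tendsto P L (𝓝 P₀) := by
  have hint : ∀ (Q : ProbabilityMeasure X) (f : C(X, ℝ)), Integrable f (Q : Measure X) :=
    fun Q f => f.continuous.integrable_of_hasCompactSupport (.of_compactSpace f)
  refine ProbabilityMeasure.tendsto_iff_forall_integral_tendsto.2 fun f => ?_
  refine induction_of_dense_span hD
    (p := fun f => Tendsto (fun a => ∫ x, f x ∂(P a : Measure X)) L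
      (𝓝 (∫ x, f x ∂(P₀ : Measure X)))) h ?_ ?_ ?_ ?_ f.toContinuousMap
  · simpa using tendsto_const_nhds
  · intro f g hf hg
    simpa only [ContinuousMap.add_apply, integral_add (hint _ f) (hint _ g)] using hf.add hg
  · intro c f hf
    simpa only [ContinuousMap.smul_apply, integral_smul] using hf.const_smul c
  · have hequi := (LipschitzWith.uniformEquicontinuous _ 1 fun a =>
      lipschitzWith_integral_continuousMap (P a : Measure X)).equicontinuous
    exact hequi.isClosed_setOfPred_tendsto
      (lipschitzWith_integral_continuousMap (P₀ : Measure X)).continuous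

lemma measure_ext_of_dense_span [HasOuterApproxClosed X]
    (hD : Dense (Submodule.span ℝ D : Set C(X, ℝ))) {P Q : Measure X} [IsProbabilityMeasure P]
    [IsProbabilityMeasure Q] (h : ∀ f ∈ D, ∫ x, f x ∂P = ∫ x, f x ∂Q) : P = Q := by
  let P' : ProbabilityMeasure X := ⟨P, inferInstance⟩
  let Q' : ProbabilityMeasure X := ⟨Q, inferInstance⟩
  have hconst : Tendsto (fun _ : ℕ => P') atTop (𝓝 Q') :=
    tendsto_of_dense_span hD fun f hf => (tendsto_congr fun _ => h f hf).2 tendsto_const_nhds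
  have heq : P' = Q' := tendsto_nhds_unique tendsto_const_nhds hconst
  exact congrArg Subtype.val heq

lemma measurable_of_dense_span [HasOuterApproxClosed X]
    (hD : Dense (Submodule.span ℝ D : Set C(X, ℝ))) {α : Type*} [MeasurableSpace α]
    {P : α → Measure X} [∀ a, IsProbabilityMeasure (P a)]
    (h : ∀ f ∈ D, Measurable fun a => ∫ x, f x ∂(P a)) : Measurable P := by
  have hint : ∀ a (f : C(X, ℝ)), Integrable f (P a) := fun a f =>
    f.continuous.integrable_of_hasCompactSupport (.of_compactSpace f)
  have hcont : ∀ f : C(X, ℝ), Measurable fun a => ∫ x, f x ∂(P a) := by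
    refine induction_of_dense_span hD (p := fun f => Measurable fun a => ∫ x, f x ∂(P a))
      h (by simp) ?_ ?_ (IsSeqClosed.isClosed fun u f hu huf => ?_)
    · intro f g hf hg
      simp only [ContinuousMap.add_apply, integral_add (hint _ f) (hint _ g)]
      exact hf.add hg
    · intro c f hf
      simp only [ContinuousMap.smul_apply, integral_smul]
      exact hf.const_smul c
    · exact measurable_of_tendsto_metrizable hu (tendsto_pi_nhds.2 fun a =>
        ((lipschitzWith_integral_continuousMap (P a)).continuous.tendsto f).comp huf)
  refine Measurable.measure_of_isPiSystem_of_isProbabilityMeasure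
    (borel_eq_generateFrom_isClosed (α := X) ▸ BorelSpace.measurable_eq)
    isPiSystem_isClosed fun F hF => ?_
  refine measurable_of_tendsto_metrizable (f := fun n a => ∫⁻ x, hF.apprSeq n x ∂(P a))
    (fun n => ?_) (tendsto_pi_nhds.2 fun a =>
      HasOuterApproxClosed.tendsto_lintegral_apprSeq hF (P a))
  let g : C(X, ℝ) := ⟨fun x => (hF.apprSeq n x : ℝ), by fun_prop⟩
  have hg : ∀ a, ∫⁻ x, hF.apprSeq n x ∂(P a) = ENNReal.ofReal (∫ x, g x ∂(P a)) := fun a => by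
    rw [ofReal_integral_eq_lintegral_ofReal (hint a g) (.of_forall fun x => NNReal.coe_nonneg _)]
    simp [g]
  simpa only [hg] using (hcont g).ennreal_ofReal

end DenseSpan

section Inducing

lemma integral_map_continuousMap {X M : Type*} [TopologicalSpace X] [MeasurableSpace X]
    [OpensMeasurableSpace X] [MeasurableSpace M] {y : M → X} (hy : Measurable y) (P : Measure M)
    (f : C(X, ℝ)) : ∫ x, f x ∂(P.map y) = ∫ μ, f (y μ) ∂P :=
  integral_map hy.aemeasurable f.continuous.measurable.aestronglyMeasurable

variable {X M : Type*} [TopologicalSpace X] [MeasurableSpace X] [BorelSpace X]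
  [TopologicalSpace M] [MeasurableSpace M] [BorelSpace M] {y : M → X}

lemma measurableSpace_eq_comap_of_isInducing (hy : IsInducing y) :
    (inferInstance : MeasurableSpace M) = MeasurableSpace.comap y inferInstance := by
  rw [BorelSpace.measurable_eq (α := M), BorelSpace.measurable_eq (α := X), hy.eq_induced,
    borel_comap]

lemma exists_measurableSet_preimage_eq_of_isInducing (hy : IsInducing y) {A : Set M}
    (hA : MeasurableSet A) : ∃ B, MeasurableSet B ∧ y ⁻¹' B = A := by
  have hA' : MeasurableSet[MeasurableSpace.comap y inferInstance] A :=
    measurableSpace_eq_comap_of_isInducing hy ▸ hA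
  exact hA'

lemma measurable_of_measurable_comp_of_isInducing (hy : IsInducing y) {Ω : Type*}
    [MeasurableSpace Ω] {X : Ω → M} (hX : Measurable fun ω => y (X ω)) : Measurable X := by
  intro A hA
  obtain ⟨B, hB, rfl⟩ := exists_measurableSet_preimage_eq_of_isInducing hy hA
  exact hX hB

lemma measure_eq_of_map_eq_of_isInducing (hy : IsInducing y) {P Q : Measure M}
    (h : P.map y = Q.map y) : P = Q := by
  ext A hA
  obtain ⟨B, hB, rfl⟩ := exists_measurableSet_preimage_eq_of_isInducing hy hA
  have hm : Measurable y := hy.continuous.measurable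
  rw [← Measure.map_apply hm hB, h, Measure.map_apply hm hB]

lemma measurable_of_measurable_map_of_isInducing (hy : IsInducing y) {α : Type*}
    [MeasurableSpace α] {P : α → Measure M} (h : Measurable fun a => (P a).map y) :
    Measurable P := by
  refine Measure.measurable_of_measurable_coe _ fun A hA => ?_
  obtain ⟨B, hB, rfl⟩ := exists_measurableSet_preimage_eq_of_isInducing hy hA
  simpa only [Function.comp_def, Measure.map_apply hy.continuous.measurable hB] using
    (Measure.measurable_coe hB).comp h

lemma tendsto_of_tendsto_map_of_isInducing [HasOuterApproxClosed X] (hy : IsInducing y)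
    {α : Type*} {L : Filter α} [L.IsCountablyGenerated] {P : α → ProbabilityMeasure M}
    {P₀ : ProbabilityMeasure M}
    (h : Tendsto (fun a => (P a).map hy.continuous.measurable.aemeasurable) L
      (𝓝 (P₀.map hy.continuous.measurable.aemeasurable))) : Tendsto P L (𝓝 P₀) := by
  refine tendsto_of_forall_isOpen_le_liminf' fun G hG => ?_
  obtain ⟨V, hV, rfl⟩ := hy.isOpen_iff.1 hG
  simpa only [ProbabilityMeasure.toMeasure_map,
    Measure.map_apply hy.continuous.measurable hV.measurableSet] using
    ProbabilityMeasure.le_liminf_measure_open_of_tendsto h hV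

variable [CompactSpace X] [HasOuterApproxClosed X] {D : Set C(X, ℝ)}

lemma tendsto_of_isInducing (hy : IsInducing y)
    (hD : Dense (Submodule.span ℝ D : Set C(X, ℝ))) {α : Type*} {L : Filter α}
    [L.IsCountablyGenerated] {P : α → ProbabilityMeasure M} {P₀ : ProbabilityMeasure M}
    (h : ∀ f ∈ D, Tendsto (fun a => ∫ μ, f (y μ) ∂(P a : Measure M)) L
      (𝓝 (∫ μ, f (y μ) ∂(P₀ : Measure M)))) : Tendsto P L (𝓝 P₀) := by
  refine tendsto_of_tendsto_map_of_isInducing hy (tendsto_of_dense_span hD fun f hf => ?_)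
  simpa only [ProbabilityMeasure.toMeasure_map,
    integral_map_continuousMap hy.continuous.measurable] using h f hf

lemma measure_ext_of_isInducing (hy : IsInducing y)
    (hD : Dense (Submodule.span ℝ D : Set C(X, ℝ))) {P Q : Measure M}
    [IsProbabilityMeasure P] [IsProbabilityMeasure Q]
    (h : ∀ f ∈ D, ∫ μ, f (y μ) ∂P = ∫ μ, f (y μ) ∂Q) : P = Q := by
  have hm : Measurable y := hy.continuous.measurable
  have := Measure.isProbabilityMeasure_map (μ := P) hm.aemeasurable
  have := Measure.isProbabilityMeasure_map (μ := Q) hm.aemeasurable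
  refine measure_eq_of_map_eq_of_isInducing hy (measure_ext_of_dense_span hD fun f hf => ?_)
  simpa only [integral_map_continuousMap hm] using h f hf

lemma measurable_of_isInducing (hy : IsInducing y)
    (hD : Dense (Submodule.span ℝ D : Set C(X, ℝ))) {α : Type*} [MeasurableSpace α]
    {P : α → Measure M} [∀ a, IsProbabilityMeasure (P a)]
    (h : ∀ f ∈ D, Measurable fun a => ∫ μ, f (y μ) ∂(P a)) : Measurable P := by
  have hm : Measurable y := hy.continuous.measurable
  have := fun a => Measure.isProbabilityMeasure_map (μ := P a) hm.aemeasurable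
  refine measurable_of_measurable_map_of_isInducing hy (measurable_of_dense_span hD fun f hf => ?_)
  simpa only [integral_map_continuousMap hm] using h f hf

end Inducing

/-! ### Laplace transforms on products of `[0, ∞]` -/

section Cube

variable {ι : Type*}

/-- The exponential monomial `x ↦ exp (-∑ x i)` on the cube `[0, ∞]^ι`, the sum being over the
entries `i` of a list; its integrals are the values of the Laplace transform of a law on the cube
at integer points. -/
noncomputable def expMonomial (l : List ι) : C(ι → ℝ≥0∞, ℝ) where
  toFun x := expNeg (l.map x).sum
  continuous_toFun := continuous_expNeg.comp (continuous_list_sum l fun i _ => continuous_apply i)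

lemma expMonomial_apply (l : List ι) (x : ι → ℝ≥0∞) :
    expMonomial l x = expNeg (l.map x).sum := rfl

lemma closure_range_expMonomial : (Submonoid.closure (Set.range (expMonomial (ι := ι))) :
    Set C(ι → ℝ≥0∞, ℝ)) = Set.range expMonomial := by
  refine Set.Subset.antisymm (fun f hf => ?_) Submonoid.subset_closure
  induction hf using Submonoid.closure_induction with
  | mem _ hf => exact hf
  | one => exact ⟨[], by ext x; simp [expMonomial_apply, expNeg_zero]⟩
  | mul f g _ _ hf hg =>
    obtain ⟨l, rfl⟩ := hf
    obtain ⟨l', rfl⟩ := hg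
    exact ⟨l ++ l', by ext x; simp [expMonomial_apply, expNeg_add]⟩

lemma dense_span_expMonomial :
    Dense (Submodule.span ℝ (Set.range (expMonomial (ι := ι))) : Set C(ι → ℝ≥0∞, ℝ)) := by
  have hsep : (Algebra.adjoin ℝ (Set.range (expMonomial (ι := ι)))).SeparatesPoints := by
    intro x y hxy
    obtain ⟨i, hi⟩ := Function.ne_iff.1 hxy
    refine ⟨expMonomial [i], ⟨expMonomial [i], Algebra.subset_adjoin ⟨[i], rfl⟩, rfl⟩, ?_⟩
    simpa [expMonomial_apply] using fun h => hi (expNeg_injective h)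
  have htop := ContinuousMap.subalgebra_topologicalClosure_eq_top_of_separatesPoints _ hsep
  rw [← closure_range_expMonomial, ← Algebra.adjoin_eq_span, dense_iff_closure_eq]
  exact (Subalgebra.topologicalClosure_coe _).symm.trans (congrArg SetLike.coe htop)

end Cube

/-! ### The topology of weak convergence is induced by countably many integrals -/

section CountableApproximation

lemma countable_supClosure {α : Type*} [SemilatticeSup α] {s : Set α} (hs : s.Countable) :
    (supClosure s).Countable := by
  have hfin : {t : Finset α | (t : Set α) ⊆ s}.Countable :=
    Set.MapsTo.countable_of_injOn (f := fun t : Finset α => (t : Set α))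
      (t := {u | u.Finite ∧ u ⊆ s}) (fun t ht => ⟨t.finite_toSet, ht⟩) Finset.coe_injective.injOn
      (Set.countable_ofPred_finite_subset hs)
  have := hfin.to_subtype
  refine (Set.countable_range fun t : {t : {t : Finset α | (t : Set α) ⊆ s} //
    (t : Finset α).Nonempty} => t.1.1.sup' t.2 id).mono ?_
  rintro _ ⟨t, ht, hts, rfl⟩
  exact ⟨⟨⟨t, hts⟩, ht⟩, rfl⟩

/-- The bump of height `q` and slope `m` around `p`. -/
noncomputable def lipschitzBump {E : Type*} [PseudoMetricSpace E] (p : E) (q : ℚ) (m : ℕ) :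
    E →ᵇ ℝ :=
  .ofNormedAddCommGroup (fun x => max 0 (q - m * dist x p)) (by fun_prop) |(q : ℝ)| fun x => by
    have hdist : 0 ≤ m * dist x p := by positivity
    rw [Real.norm_of_nonneg (le_max_left _ _)]
    exact max_le (abs_nonneg _) (by linarith [le_abs_self (q : ℝ)])

lemma exists_lipschitzBump_le_lt {E : Type*} [PseudoMetricSpace E] {s : Set E} (hs : Dense s)
    {f : E → ℝ} (hf : Continuous f) (hf0 : ∀ x, 0 ≤ f x) {x : E} {a : ℝ} (ha : a < f x) :
    ∃ p ∈ s, ∃ q m, (∀ z, lipschitzBump p q m z ≤ f z) ∧ a < lipschitzBump p q m x := by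
  obtain ⟨q, haq, hqf⟩ := exists_rat_btwn ha
  obtain ⟨δ, hδ, hball⟩ := Metric.isOpen_iff.1 (isOpen_Ioi.preimage hf) x hqf
  obtain ⟨m, hm⟩ := exists_nat_gt (q / (δ / 2))
  have hgap : 0 < (q - a) / (m + 1) := div_pos (by linarith) (by positivity)
  obtain ⟨p, hps, hp⟩ := hs.exists_dist_lt x (lt_min (half_pos hδ) hgap)
  obtain ⟨hpδ, hpgap⟩ := lt_min_iff.1 hp
  refine ⟨p, hps, q, m, fun z => max_le (hf0 z) ?_, lt_max_of_lt_right ?_⟩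
  · rcases lt_or_ge (dist z x) δ with hz | hz
    · have hqz : (q : ℝ) < f z := hball hz
      linarith [show 0 ≤ m * dist z p by positivity]
    · have hzp : δ / 2 ≤ dist z p := by linarith [dist_triangle z p x, dist_comm p x]
      rw [div_lt_iff₀ (half_pos hδ)] at hm
      linarith [hf0 z, mul_le_mul_of_nonneg_left hzp (Nat.cast_nonneg (α := ℝ) m)]
  · rw [lt_div_iff₀ (by positivity)] at hpgap
    linarith [dist_nonneg (x := x) (y := p)]

lemma tendsto_finiteMeasure_of_eventually_lt_integral {E : Type*} [TopologicalSpace E]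
    [MeasurableSpace E] [OpensMeasurableSpace E] {α : Type*} {l : Filter α}
    {ν : α → FiniteMeasure E} {μ : FiniteMeasure E}
    (hmass : Tendsto (fun i => (ν i : Measure E).real Set.univ) l
      (𝓝 ((μ : Measure E).real Set.univ)))
    (hlower : ∀ f : E →ᵇ ℝ, 0 ≤ f → ∀ a < ∫ x, f x ∂(μ : Measure E),
      ∀ᶠ i in l, a < ∫ x, f x ∂(ν i : Measure E)) : Tendsto ν l (𝓝 μ) := by
  have hadd : ∀ (ρ : FiniteMeasure E) (f : E →ᵇ ℝ),
      ∫ x, (f + .const E ‖f‖) x ∂(ρ : Measure E) =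
        ∫ x, f x ∂(ρ : Measure E) + (ρ : Measure E).real Set.univ * ‖f‖ := fun ρ f => by
    simp [integral_add (f.integrable _) (integrable_const _)]
  have hlower' : ∀ f : E →ᵇ ℝ, ∀ a < ∫ x, f x ∂(μ : Measure E),
      ∀ᶠ i in l, a < ∫ x, f x ∂(ν i : Measure E) := by
    intro f a ha
    have hnonneg : 0 ≤ f + .const E ‖f‖ := f.add_norm_nonneg
    obtain ⟨b, hab, hb⟩ := exists_between ha
    have hmass' := (hmass.mul_const ‖f‖).eventually_lt_const
      (lt_add_of_pos_right _ (sub_pos.2 hab))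
    filter_upwards [hmass', hlower _ hnonneg (b + (μ : Measure E).real Set.univ * ‖f‖)
      (by rw [hadd]; linarith)] with i hi₁ hi₂
    rw [hadd] at hi₂
    linarith
  refine FiniteMeasure.tendsto_of_forall_integral_tendsto fun f =>
    tendsto_order.2 ⟨hlower' f, fun a ha => ?_⟩
  filter_upwards [hlower' (-f) (-a) (by simpa [integral_neg] using ha)] with i hi
  simpa [integral_neg] using hi

variable (E : Type*) [TopologicalSpace E] [SecondCountableTopology E]
  [TopologicalSpace.MetrizableSpace E]

lemma exists_countable_supClosed_approx_from_below : ∃ D : Set (E →ᵇ ℝ), D.Countable ∧ SupClosed D ∧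
    0 ∈ D ∧ 1 ∈ D ∧ (∀ g ∈ D, 0 ≤ g) ∧
    ∀ f : E →ᵇ ℝ, 0 ≤ f → ∀ x, ∀ a < f x, ∃ g ∈ D, g ≤ f ∧ a < g x := by
  let := TopologicalSpace.metrizableSpaceMetric E
  obtain ⟨s, hs, hsd⟩ := TopologicalSpace.exists_countable_dense E
  have := hs.to_subtype
  let B : Set (E →ᵇ ℝ) :=
    {0, 1} ∪ Set.range fun p : s × ℚ × ℕ => lipschitzBump p.1.1 p.2.1 p.2.2
  have hB : B.Countable := (Set.toFinite {0, 1}).countable.union (Set.countable_range _)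
  have hB0 : ∀ g ∈ B, 0 ≤ g := by
    rintro _ ((rfl | rfl) | ⟨p, rfl⟩)
    · exact le_rfl
    · exact fun _ => zero_le_one
    · exact fun x => le_max_left _ _
  refine ⟨supClosure B, countable_supClosure hB, supClosed_supClosure,
    subset_supClosure (by simp [B]), subset_supClosure (by simp [B]), ?_,
    fun f hf x a ha => ?_⟩
  · rintro _ ⟨t, ⟨g, hg⟩, htB, rfl⟩
    exact (hB0 g (htB hg)).trans (Finset.le_sup' id hg)
  · obtain ⟨p, hp, q, m, hle, hlt⟩ := exists_lipschitzBump_le_lt hsd f.continuous hf ha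
    exact ⟨_, subset_supClosure (Or.inr ⟨(⟨p, hp⟩, q, m), rfl⟩), hle, hlt⟩

variable [MeasurableSpace E] [OpensMeasurableSpace E]

lemma exists_seq_approx_lintegral_from_below : ∃ g : ℕ → E →ᵇ ℝ, (∀ n, 0 ≤ g n) ∧
    (∃ n, g n = 1) ∧ ∀ (μ : Measure E) (f : E →ᵇ ℝ), 0 ≤ f → ∀ a < ∫⁻ x, ENNReal.ofReal (f x) ∂μ,
      ∃ n, g n ≤ f ∧ a < ∫⁻ x, ENNReal.ofReal (g n x) ∂μ := by
  obtain ⟨D, hD, hsup, h0, h1, hnonneg, happrox⟩ := exists_countable_supClosed_approx_from_below E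
  obtain ⟨g, rfl⟩ := hD.exists_eq_range ⟨1, h1⟩
  refine ⟨g, fun n => hnonneg _ ⟨n, rfl⟩, h1, fun μ f hf a ha => ?_⟩
  have hpointwise : ∀ x, ENNReal.ofReal (f x) = ⨆ n : {n // g n ≤ f}, ENNReal.ofReal (g n x) := by
    refine fun x => le_antisymm (le_of_forall_lt fun b hb => ?_)
      (iSup_le fun n => ENNReal.ofReal_le_ofReal (n.2 x))
    obtain ⟨_, ⟨n, rfl⟩, hn, hbn⟩ := happrox f hf x b.toReal
      ((ENNReal.lt_ofReal_iff_toReal_lt hb.ne_top).1 hb)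
    exact ((ENNReal.lt_ofReal_iff_toReal_lt hb.ne_top).2 hbn).trans_le
      (le_iSup (fun n : {n // g n ≤ f} => ENNReal.ofReal (g n x)) ⟨n, hn⟩)
  have hdirected : Directed (· ≤ ·) fun (n : {n // g n ≤ f}) x => ENNReal.ofReal (g n x) := by
    rintro ⟨m, hm⟩ ⟨n, hn⟩
    obtain ⟨k, hk⟩ := hsup ⟨m, rfl⟩ ⟨n, rfl⟩
    refine ⟨⟨k, hk ▸ sup_le hm hn⟩, fun x => ?_, fun x => ?_⟩ <;> refine ENNReal.ofReal_le_ofReal ?_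
    · exact (le_sup_left.trans_eq hk.symm : g m ≤ g k) x
    · exact (le_sup_right.trans_eq hk.symm : g n ≤ g k) x
  rw [lintegral_congr hpointwise, lintegral_iSup_directed (fun n : {n // g n ≤ f} =>
    (g n).continuous.measurable.ennreal_ofReal.aemeasurable) hdirected, lt_iSup_iff] at ha
  obtain ⟨n, hn⟩ := ha
  exact ⟨n, n.2, hn⟩

lemma exists_seq_isInducing_lintegral : ∃ g : ℕ → E →ᵇ ℝ, (∀ n, 0 ≤ g n) ∧
    IsInducing fun (μ : FiniteMeasure E) n => ∫⁻ x, ENNReal.ofReal (g n x) ∂(μ : Measure E) := by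
  obtain ⟨g, hg, ⟨n₁, hn₁⟩, happrox⟩ := exists_seq_approx_lintegral_from_below E
  have hofReal : ∀ (μ : FiniteMeasure E) (f : E →ᵇ ℝ), 0 ≤ f →
      ∫⁻ x, ENNReal.ofReal (f x) ∂(μ : Measure E) = ENNReal.ofReal (∫ x, f x ∂(μ : Measure E)) :=
    fun μ f hf => (ofReal_integral_eq_lintegral_ofReal (f.integrable _) (ae_of_all _ hf)).symm
  let Y (μ : FiniteMeasure E) (n : ℕ) : ℝ≥0∞ := ∫⁻ x, ENNReal.ofReal (g n x) ∂(μ : Measure E)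
  have hY : ∀ μ n, Y μ n = ENNReal.ofReal (∫ x, g n x ∂(μ : Measure E)) :=
    fun μ n => hofReal μ (g n) (hg n)
  have hcont : Continuous Y := continuous_pi fun n => by
    simp only [hY]
    exact ENNReal.continuous_ofReal.comp
      (FiniteMeasure.continuous_integral_boundedContinuousFunction (g n))
  refine ⟨g, hg, isInducing_iff_nhds.2 fun μ => le_antisymm
    (Filter.map_le_iff_le_comap.1 hcont.continuousAt) ?_⟩
  have htendsto : ∀ n, Tendsto (fun ν => Y ν n) (comap Y (𝓝 (Y μ))) (𝓝 (Y μ n)) :=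
    tendsto_pi_nhds.1 tendsto_comap
  refine tendsto_id'.1 (tendsto_finiteMeasure_of_eventually_lt_integral ?_ fun f hf a ha => ?_)
  · have hmass := (ENNReal.tendsto_toReal (by simp [Y, hn₁])).comp (htendsto n₁)
    simpa [Y, hn₁, Function.comp_def, Measure.real] using hmass
  · rcases lt_or_ge a 0 with ha0 | ha0
    · exact .of_forall fun ν => ha0.trans_le (integral_nonneg hf)
    obtain ⟨n, hnf, hn⟩ := happrox μ f hf (ENNReal.ofReal a) (by
      rwa [hofReal μ f hf, ENNReal.ofReal_lt_ofReal_iff_of_nonneg ha0])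
    filter_upwards [(htendsto n).eventually_const_lt hn] with ν hν
    rw [hY, ENNReal.ofReal_lt_ofReal_iff_of_nonneg ha0] at hν
    exact hν.trans_le (integral_mono ((g n).integrable _) (f.integrable _) hnf)

end CountableApproximation

/-! ### Spaces of measures with finite weighted integrals -/

section TestClass

variable {E : Type*} [TopologicalSpace E]

/-- The finite sums of products of a nonnegative bounded continuous function and a weight `w k`.
Their integrals are continuous on the spaces of measures considered here, and determine them. -/
def testClass (w : ℕ → E →ᵇ ℝ) : AddSubmonoid (E → ℝ) :=
  AddSubmonoid.closure {F | ∃ (f : E →ᵇ ℝ) (k : ℕ), (∀ x, 0 ≤ f x) ∧ F = fun x => f x * w k x}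

variable {w : ℕ → E →ᵇ ℝ}

lemma mul_mem_testClass {f : E →ᵇ ℝ} (hf : ∀ x, 0 ≤ f x) (k : ℕ) :
    (fun x => f x * w k x) ∈ testClass w :=
  AddSubmonoid.subset_closure ⟨f, k, hf, rfl⟩

lemma weight_mem_testClass (k : ℕ) : (fun x => w k x) ∈ testClass w := by
  simpa using mul_mem_testClass (w := w) (f := 1) (fun _ => zero_le_one) k

lemma continuous_of_mem_testClass {F : E → ℝ} (hF : F ∈ testClass w) : Continuous F := by
  induction hF using AddSubmonoid.closure_induction with
  | mem F hF => obtain ⟨f, k, -, rfl⟩ := hF; exact f.continuous.mul (w k).continuous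
  | zero => exact continuous_const
  | add F G _ _ hF hG => exact hF.add hG

lemma mul_mem_testClass_of_mem {F : E → ℝ} (hF : F ∈ testClass w) {g : E →ᵇ ℝ}
    (hg : ∀ x, 0 ≤ g x) : (fun x => g x * F x) ∈ testClass w := by
  induction hF using AddSubmonoid.closure_induction with
  | mem F hF =>
    obtain ⟨f, k, hf, rfl⟩ := hF
    simpa [mul_assoc] using
      mul_mem_testClass (w := w) (f := g * f) (fun x => mul_nonneg (hg x) (hf x)) k
  | zero => simp only [Pi.zero_apply, mul_zero]; exact (testClass w).zero_mem
  | add F G _ _ hF hG =>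
    simp only [Pi.add_apply, mul_add]
    exact (testClass w).add_mem hF hG

lemma const_mul_mem_testClass {F : E → ℝ} (hF : F ∈ testClass w) {c : ℝ} (hc : 0 ≤ c) :
    (fun x => c * F x) ∈ testClass w :=
  mul_mem_testClass_of_mem hF (g := .const E c) fun _ => hc

lemma list_sum_mem_testClass {ι : Type*} {F : ι → E → ℝ} (hF : ∀ i, F i ∈ testClass w)
    (l : List ι) : (l.map F).sum ∈ testClass w :=
  AddSubmonoid.list_sum_mem _ fun G hG => by
    obtain ⟨i, -, rfl⟩ := List.mem_map.1 hG
    exact hF i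

lemma exists_bound_of_mem_testClass (w_nonneg : ∀ k x, 0 ≤ w k x) {F : E → ℝ}
    (hF : F ∈ testClass w) : ∃ C : ℝ, 0 ≤ C ∧ ∀ x, 0 ≤ F x ∧ F x ≤ C := by
  induction hF using AddSubmonoid.closure_induction with
  | mem F hF =>
    obtain ⟨f, k, hf, rfl⟩ := hF
    refine ⟨‖f‖ * ‖w k‖, by positivity, fun x => ⟨mul_nonneg (hf x) (w_nonneg k x), ?_⟩⟩
    exact mul_le_mul ((le_abs_self _).trans (f.norm_coe_le_norm x))
      ((le_abs_self _).trans ((w k).norm_coe_le_norm x)) (w_nonneg k x) (norm_nonneg _)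
  | zero => exact ⟨0, le_rfl, fun x => ⟨le_rfl, le_rfl⟩⟩
  | add F G _ _ hF hG =>
    obtain ⟨C, hC, hF⟩ := hF
    obtain ⟨D, hD, hG⟩ := hG
    exact ⟨C + D, by positivity, fun x => ⟨add_nonneg (hF x).1 (hG x).1,
      add_le_add (hF x).2 (hG x).2⟩⟩

lemma nonneg_of_mem_testClass (w_nonneg : ∀ k x, 0 ≤ w k x) {F : E → ℝ}
    (hF : F ∈ testClass w) (x : E) : 0 ≤ F x := by
  obtain ⟨C, -, h⟩ := exists_bound_of_mem_testClass w_nonneg hF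
  exact (h x).1

variable [MeasurableSpace E] [OpensMeasurableSpace E]

lemma lintegral_ofReal_add_of_mem_testClass (w_nonneg : ∀ k x, 0 ≤ w k x) {F G : E → ℝ}
    (hF : F ∈ testClass w) (hG : G ∈ testClass w) (μ : Measure E) :
    ∫⁻ x, ENNReal.ofReal ((F + G) x) ∂μ =
      ∫⁻ x, ENNReal.ofReal (F x) ∂μ + ∫⁻ x, ENNReal.ofReal (G x) ∂μ := by
  rw [← lintegral_add_left (continuous_of_mem_testClass hF).measurable.ennreal_ofReal]
  exact lintegral_congr fun x => ENNReal.ofReal_add (nonneg_of_mem_testClass w_nonneg hF x)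
    (nonneg_of_mem_testClass w_nonneg hG x)

lemma list_sum_lintegral_of_mem_testClass (w_nonneg : ∀ k x, 0 ≤ w k x) {ι : Type*}
    {F : ι → E → ℝ} (hF : ∀ i, F i ∈ testClass w) (μ : Measure E) (l : List ι) :
    (l.map fun i => ∫⁻ x, ENNReal.ofReal (F i x) ∂μ).sum =
      ∫⁻ x, ENNReal.ofReal ((l.map F).sum x) ∂μ := by
  induction l with
  | nil => simp
  | cons i l ih =>
    rw [List.map_cons, List.sum_cons, ih, List.map_cons, List.sum_cons,
      lintegral_ofReal_add_of_mem_testClass w_nonneg (hF i) (list_sum_mem_testClass hF l)]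

end TestClass

section LocationMeasures

variable {E : Type*} [TopologicalSpace E] [MeasurableSpace E] [OpensMeasurableSpace E]
  {w : ℕ → E →ᵇ ℝ}

lemma measurable_weight (w : ℕ → E →ᵇ ℝ) (k : ℕ) : Measurable fun x => ENNReal.ofReal (w k x) :=
  (w k).continuous.measurable.ennreal_ofReal

lemma integrable_mul_weight (w_nonneg : ∀ k x, 0 ≤ w k x) (ν : LocationMeasures w) (f : E →ᵇ ℝ)
    (k : ℕ) : Integrable (fun x => f x * w k x) ν.1 := by
  have hw : Integrable (fun x => w k x) ν.1 := by
    refine ⟨(w k).continuous.measurable.aestronglyMeasurable, ?_⟩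
    rw [hasFiniteIntegral_iff_ofReal (.of_forall (w_nonneg k))]
    exact ν.2 k
  exact hw.bdd_mul (c := ‖f‖) f.continuous.measurable.aestronglyMeasurable
    (.of_forall f.norm_coe_le_norm)

omit [OpensMeasurableSpace E] in
lemma continuous_integral_mul_weight (f : E →ᵇ ℝ) (k : ℕ) :
    Continuous fun ν : LocationMeasures w => ∫ x, f x * w k x ∂ν.1 :=
  continuous_iInf_dom (i := k) (continuous_iInf_dom (i := f) continuous_induced_dom)

lemma continuous_lintegral_of_mem_testClass (w_nonneg : ∀ k x, 0 ≤ w k x) {F : E → ℝ}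
    (hF : F ∈ testClass w) :
    Continuous fun ν : LocationMeasures w => ∫⁻ x, ENNReal.ofReal (F x) ∂ν.1 := by
  induction hF using AddSubmonoid.closure_induction with
  | mem F hF =>
    obtain ⟨f, k, hf, rfl⟩ := hF
    have hofReal : ∀ ν : LocationMeasures w, ∫⁻ x, ENNReal.ofReal (f x * w k x) ∂ν.1 =
        ENNReal.ofReal (∫ x, f x * w k x ∂ν.1) := fun ν =>
      (ofReal_integral_eq_lintegral_ofReal (integrable_mul_weight w_nonneg ν f k)
        (.of_forall fun x => mul_nonneg (hf x) (w_nonneg k x))).symm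
    simp only [hofReal]
    exact ENNReal.continuous_ofReal.comp (continuous_integral_mul_weight f k)
  | zero => simpa using continuous_const
  | add F G hF' hG' hF hG =>
    simp only [lintegral_ofReal_add_of_mem_testClass w_nonneg hF' hG']
    exact hF.add hG

lemma integral_withDensity_weight (w_nonneg : ∀ k x, 0 ≤ w k x) (ν : Measure E) (f : E →ᵇ ℝ)
    (k : ℕ) : ∫ x, f x ∂(ν.withDensity fun x => ENNReal.ofReal (w k x)) =
      ∫ x, f x * w k x ∂ν := by
  rw [integral_withDensity_eq_integral_toReal_smul (measurable_weight w k)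
    (.of_forall fun _ => ENNReal.ofReal_lt_top)]
  simp only [ENNReal.toReal_ofReal (w_nonneg k _), smul_eq_mul, mul_comm]

namespace LocationMeasures

instance isFiniteMeasure_withDensity (ν : LocationMeasures w) (k : ℕ) :
    IsFiniteMeasure (ν.1.withDensity fun x => ENNReal.ofReal (w k x)) :=
  MeasureTheory.isFiniteMeasure_withDensity (ν.2 k).ne

/-- The finite measures with densities `w k` with respect to `ν`; they embed the space of location
measures into a product of spaces of finite measures. -/
noncomputable def toFiniteMeasures (ν : LocationMeasures w) (k : ℕ) : FiniteMeasure E :=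
  ⟨ν.1.withDensity fun x => ENNReal.ofReal (w k x), inferInstance⟩

lemma integral_toFiniteMeasures (w_nonneg : ∀ k x, 0 ≤ w k x) (ν : LocationMeasures w)
    (f : E →ᵇ ℝ) (k : ℕ) :
    ∫ x, f x ∂(ν.toFiniteMeasures k : Measure E) = ∫ x, f x * w k x ∂ν.1 :=
  integral_withDensity_weight w_nonneg ν.1 f k

lemma lintegral_toFiniteMeasures (ν : LocationMeasures w) {f : E → ℝ} (hf : Measurable f)
    (hf0 : ∀ x, 0 ≤ f x) (k : ℕ) :
    ∫⁻ x, ENNReal.ofReal (f x) ∂(ν.toFiniteMeasures k : Measure E) =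
      ∫⁻ x, ENNReal.ofReal (f x * w k x) ∂ν.1 := by
  refine (lintegral_withDensity_eq_lintegral_mul _ (measurable_weight w k)
    hf.ennreal_ofReal).trans (lintegral_congr fun x => ?_)
  rw [ENNReal.ofReal_mul (hf0 x), mul_comm]
  rfl

lemma isInducing_toFiniteMeasures (w_nonneg : ∀ k x, 0 ≤ w k x) :
    IsInducing (toFiniteMeasures (w := w)) := by
  refine ⟨le_antisymm ?_ (le_iInf fun k => le_iInf fun f => ?_)⟩
  · rw [← continuous_iff_le_induced]
    refine continuous_pi fun k => continuous_iff_continuousAt.2 fun ν => ?_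
    refine FiniteMeasure.tendsto_iff_forall_integral_tendsto.2 fun f => ?_
    simp only [integral_toFiniteMeasures w_nonneg]
    exact (continuous_integral_mul_weight f k).tendsto ν
  · have hf : Continuous fun μ : ℕ → FiniteMeasure E => ∫ x, f x ∂(μ k : Measure E) :=
      (FiniteMeasure.continuous_integral_boundedContinuousFunction f).comp (continuous_apply k)
    simp only [← integral_toFiniteMeasures w_nonneg]
    exact (induced_mono (continuous_iff_le_induced.1 hf)).trans_eq induced_compose

end LocationMeasures

end LocationMeasures

section TestInduced

variable {E : Type*} [TopologicalSpace E] [MeasurableSpace E] {w : ℕ → E →ᵇ ℝ}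

/-- The topology of a space `M` of measures on `E` is induced by countably many functionals
`μ ↦ ∫ F dμ` with `F` in the test class. -/
def IsTestInduced (w : ℕ → E →ᵇ ℝ) {M : Type*} [TopologicalSpace M] (toMeas : M → Measure E) :
    Prop :=
  ∃ F : ℕ → E → ℝ, (∀ n, F n ∈ testClass w) ∧
    IsInducing fun (μ : M) n => ∫⁻ x, ENNReal.ofReal (F n x) ∂(toMeas μ)

namespace IsTestInduced

variable [OpensMeasurableSpace E] {M : Type*} [TopologicalSpace M] [MeasurableSpace M]
  [BorelSpace M] {toMeas : M → Measure E}

lemma measurable (hM : IsTestInduced w toMeas) {Ω : Type*} [MeasurableSpace Ω] {X : Ω → M}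
    (hX : Measurable fun ω => toMeas (X ω)) : Measurable X := by
  obtain ⟨F, hF, hy⟩ := hM
  refine measurable_of_measurable_comp_of_isInducing hy (measurable_pi_lambda _ fun n => ?_)
  exact (Measure.measurable_lintegral
    (continuous_of_mem_testClass (hF n)).measurable.ennreal_ofReal).comp hX

lemma tendsto (hM : IsTestInduced w toMeas) (w_nonneg : ∀ k x, 0 ≤ w k x) {α : Type*}
    {L : Filter α} [L.IsCountablyGenerated] {P : α → ProbabilityMeasure M}
    {P₀ : ProbabilityMeasure M}
    (h : ∀ F ∈ testClass w, Tendsto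
      (fun a => laplaceFunctional (P a : Measure M) toMeas fun x => ENNReal.ofReal (F x)) L
      (𝓝 (laplaceFunctional (P₀ : Measure M) toMeas fun x => ENNReal.ofReal (F x)))) :
    Tendsto P L (𝓝 P₀) := by
  obtain ⟨F, hF, hy⟩ := hM
  refine tendsto_of_isInducing hy dense_span_expMonomial ?_
  rintro _ ⟨l, rfl⟩
  simp only [expMonomial_apply, list_sum_lintegral_of_mem_testClass w_nonneg hF]
  exact h _ (list_sum_mem_testClass hF l)

lemma measure_ext (hM : IsTestInduced w toMeas) (w_nonneg : ∀ k x, 0 ≤ w k x)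
    {P Q : Measure M} [IsProbabilityMeasure P] [IsProbabilityMeasure Q]
    (h : ∀ F ∈ testClass w, laplaceFunctional P toMeas (fun x => ENNReal.ofReal (F x)) =
      laplaceFunctional Q toMeas fun x => ENNReal.ofReal (F x)) : P = Q := by
  obtain ⟨F, hF, hy⟩ := hM
  refine measure_ext_of_isInducing hy dense_span_expMonomial ?_
  rintro _ ⟨l, rfl⟩
  simp only [expMonomial_apply, list_sum_lintegral_of_mem_testClass w_nonneg hF]
  exact h _ (list_sum_mem_testClass hF l)

lemma measurable_kernel (hM : IsTestInduced w toMeas) (w_nonneg : ∀ k x, 0 ≤ w k x) {α : Type*}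
    [MeasurableSpace α] {P : α → Measure M} [∀ a, IsProbabilityMeasure (P a)]
    (h : ∀ F ∈ testClass w,
      Measurable fun a => laplaceFunctional (P a) toMeas fun x => ENNReal.ofReal (F x)) :
    Measurable P := by
  obtain ⟨F, hF, hy⟩ := hM
  refine measurable_of_isInducing hy dense_span_expMonomial ?_
  rintro _ ⟨l, rfl⟩
  simp only [expMonomial_apply, list_sum_lintegral_of_mem_testClass w_nonneg hF]
  exact h _ (list_sum_mem_testClass hF l)

end IsTestInduced

lemma LocationMeasures.isTestInduced [BorelSpace E] [SecondCountableTopology E]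
    [TopologicalSpace.MetrizableSpace E] (w_nonneg : ∀ k x, 0 ≤ w k x) :
    IsTestInduced w fun ν : LocationMeasures w => ν.1 := by
  obtain ⟨g, hg, hgind⟩ := exists_seq_isInducing_lintegral E
  have hproduct : IsInducing fun (μ : ℕ → FiniteMeasure E) (n : ℕ) =>
      ∫⁻ x, ENNReal.ofReal (g n.unpair.2 x) ∂(μ n.unpair.1 : Measure E) := by
    refine isInducing_iff_nhds.2 fun μ => ?_
    simp only [nhds_pi, Filter.pi, hgind.nhds_eq_comap, Filter.comap_iInf, Filter.comap_comap,
      Function.comp_def]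
    exact (iInf_unpair fun k n => comap (fun μ : ℕ → FiniteMeasure E =>
      ∫⁻ x, ENNReal.ofReal (g n x) ∂(μ k : Measure E)) _).symm
  refine ⟨fun n x => g n.unpair.2 x * w n.unpair.1 x, fun n => mul_mem_testClass (hg _) _, ?_⟩
  have hcomp := hproduct.comp (isInducing_toFiniteMeasures w_nonneg)
  simpa only [Function.comp_def, lintegral_toFiniteMeasures _ (g _).continuous.measurable (hg _)]
    using hcomp

end TestInduced

/-! ### Recovering a measure from its weighted versions -/

section Glue

variable {E : Type*} [MeasurableSpace E]

lemma measurable_withDensity {Ω : Type*} [MeasurableSpace Ω] {X : Ω → Measure E}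
    (hX : Measurable X) {f : E → ℝ≥0∞} (hf : Measurable f) :
    Measurable fun ω => (X ω).withDensity f := by
  refine Measure.measurable_of_measurable_coe _ fun A hA => ?_
  simp only [withDensity_apply _ hA, ← lintegral_indicator hA]
  exact (Measure.measurable_lintegral (hf.indicator hA)).comp hX

variable [TopologicalSpace E]

lemma measurable_finiteMeasure_of_measurable_lintegral [BorelSpace E] [HasOuterApproxClosed E]
    {Ω : Type*} [MeasurableSpace Ω] {X : Ω → FiniteMeasure E}
    (hX : ∀ f : E →ᵇ ℝ≥0, Measurable fun ω => ∫⁻ x, f x ∂(X ω : Measure E)) :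
    Measurable fun ω => (X ω : Measure E) := by
  refine Measurable.measure_of_isPiSystem
    (borel_eq_generateFrom_isClosed (α := E) ▸ BorelSpace.measurable_eq)
    isPiSystem_isClosed (fun F hF => ?_) ?_
  · exact measurable_of_tendsto_metrizable (fun n => hX (hF.apprSeq n)) (tendsto_pi_nhds.2
      fun ω => HasOuterApproxClosed.tendsto_lintegral_apprSeq hF (X ω : Measure E))
  · simpa using hX 1

variable {w : ℕ → E →ᵇ ℝ}

/-- A partition subordinate to the sets `{w k > 0}`. -/
def weightPartition (w : ℕ → E →ᵇ ℝ) (k : ℕ) : Set E := disjointed (fun k => {x | 0 < w k x}) k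

/-- The density `1 / w k` on the `k`-th set of the partition; it recovers the restriction of a
measure to this set from the version weighted by `w k`. -/
noncomputable def invWeight (w : ℕ → E →ᵇ ℝ) (k : ℕ) : E → ℝ≥0∞ :=
  (weightPartition w k).indicator fun x => (ENNReal.ofReal (w k x))⁻¹

/-- The measure with prescribed weighted versions `μ k`. -/
noncomputable def glueMeasure (w : ℕ → E →ᵇ ℝ) (μ : ℕ → Measure E) : Measure E :=
  Measure.sum fun k => (μ k).withDensity (invWeight w k)

variable [OpensMeasurableSpace E]

lemma measurableSet_weightPartition (w : ℕ → E →ᵇ ℝ) (k : ℕ) :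
    MeasurableSet (weightPartition w k) :=
  MeasurableSet.disjointed
    (fun k => measurableSet_lt measurable_const (w k).continuous.measurable) k

lemma sum_restrict_weightPartition (w_cover : ∀ x, ∃ k, 0 < w k x) (ν : Measure E) :
    Measure.sum (fun k => ν.restrict (weightPartition w k)) = ν := by
  have hunion : ⋃ k, weightPartition w k = Set.univ :=
    (iUnion_disjointed (f := fun k => {x | 0 < w k x})).trans
      (Set.eq_univ_of_forall fun x => Set.mem_iUnion.2 (w_cover x))
  have hdisjoint : Pairwise (Function.onFun Disjoint (weightPartition w)) := disjoint_disjointed _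
  rw [← Measure.restrict_iUnion hdisjoint (measurableSet_weightPartition w), hunion,
    Measure.restrict_univ]

lemma measurable_invWeight (w : ℕ → E →ᵇ ℝ) (k : ℕ) : Measurable (invWeight w k) :=
  (measurable_weight w k).inv.indicator (measurableSet_weightPartition w k)

lemma withDensity_weight_withDensity_invWeight (ν : Measure E) (k : ℕ) :
    (ν.withDensity fun x => ENNReal.ofReal (w k x)).withDensity (invWeight w k) =
      ν.restrict (weightPartition w k) := by
  rw [← withDensity_mul ν (measurable_weight w k) (measurable_invWeight w k),
    ← withDensity_indicator_one (measurableSet_weightPartition w k)]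
  congr 1
  funext x
  by_cases hx : x ∈ weightPartition w k
  · have hpos : 0 < w k x := disjointed_subset _ k hx
    simp only [Pi.mul_apply, invWeight, Set.indicator_of_mem hx, Pi.one_apply]
    exact ENNReal.mul_inv_cancel (by simpa using hpos) ENNReal.ofReal_ne_top
  · simp [invWeight, Set.indicator_of_notMem hx]

lemma glueMeasure_withDensity (w_cover : ∀ x, ∃ k, 0 < w k x) (ν : Measure E) :
    glueMeasure w (fun k => ν.withDensity fun x => ENNReal.ofReal (w k x)) = ν := by
  simp only [glueMeasure, withDensity_weight_withDensity_invWeight]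
  exact sum_restrict_weightPartition w_cover ν

lemma withDensity_glueMeasure (w_cover : ∀ x, ∃ k, 0 < w k x) {μ : ℕ → Measure E}
    (hμ : ∀ j k, (μ k).withDensity (fun x => ENNReal.ofReal (w j x)) =
      (μ j).withDensity fun x => ENNReal.ofReal (w k x)) (j : ℕ) :
    (glueMeasure w μ).withDensity (fun x => ENNReal.ofReal (w j x)) = μ j := by
  have hrestrict : ∀ k, ((μ k).withDensity (invWeight w k)).withDensity
      (fun x => ENNReal.ofReal (w j x)) = (μ j).restrict (weightPartition w k) := fun k => by
    rw [← withDensity_weight_withDensity_invWeight, ← hμ j k,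
      ← withDensity_mul _ (measurable_weight w j) (measurable_invWeight w k),
      ← withDensity_mul _ (measurable_invWeight w k) (measurable_weight w j), mul_comm]
  simp only [glueMeasure, withDensity_sum, hrestrict]
  exact sum_restrict_weightPartition w_cover (μ j)

lemma measurable_glueMeasure {Ω : Type*} [MeasurableSpace Ω] {X : ℕ → Ω → Measure E}
    (hX : ∀ k, Measurable (X k)) : Measurable fun ω => glueMeasure w fun k => X k ω := by
  refine Measure.measurable_of_measurable_coe _ fun A hA => ?_
  simp only [glueMeasure, Measure.sum_apply _ hA]
  exact Measurable.tsum fun k =>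
    (Measure.measurable_coe hA).comp (measurable_withDensity (hX k) (measurable_invWeight w k))

lemma exists_measurable_partition_finite (w_cover : ∀ x, ∃ k, 0 < w k x) :
    ∃ D : ℕ → Set E, (∀ n, MeasurableSet (D n)) ∧ Pairwise (Function.onFun Disjoint D) ∧
      ⋃ n, D n = Set.univ ∧ ∀ (ν : LocationMeasures w) n, ν.1 (D n) < ∞ := by
  let B : ℕ → Set E := fun n => {x | ENNReal.ofReal (1 / ((n.unpair.2 : ℝ) + 1)) ≤
    ENNReal.ofReal (w n.unpair.1 x)}
  have hB : ∀ n, MeasurableSet (B n) := fun n =>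
    measurableSet_le measurable_const (measurable_weight w _)
  refine ⟨disjointed B, fun n => MeasurableSet.disjointed hB n, disjoint_disjointed B, ?_,
    fun ν n => ?_⟩
  · rw [iUnion_disjointed]
    refine Set.eq_univ_of_forall fun x => ?_
    obtain ⟨k, hk⟩ := w_cover x
    obtain ⟨m, hm⟩ := exists_nat_one_div_lt hk
    exact Set.mem_iUnion.2 ⟨Nat.pair k m, by simpa [B] using ENNReal.ofReal_le_ofReal hm.le⟩
  · have hlevel : ENNReal.ofReal (1 / ((n.unpair.2 : ℝ) + 1)) ≠ 0 :=
      (ENNReal.ofReal_pos.2 Nat.one_div_pos_of_nat).ne'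
    exact (measure_mono (disjointed_subset B n)).trans_lt
      ((meas_ge_le_lintegral_div (measurable_weight w _).aemeasurable hlevel
        ENNReal.ofReal_ne_top).trans_lt (ENNReal.div_lt_top (ν.2 _).ne hlevel))

namespace LocationMeasures

lemma sigmaFinite (w_cover : ∀ x, ∃ k, 0 < w k x) (ν : LocationMeasures w) :
    SigmaFinite ν.1 := by
  obtain ⟨D, -, -, hD_cover, hD_finite⟩ := exists_measurable_partition_finite w_cover
  exact ⟨⟨⟨D, fun _ => trivial, hD_finite ν, hD_cover⟩⟩⟩

lemma injective_toFiniteMeasures (w_cover : ∀ x, ∃ k, 0 < w k x) :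
    Function.Injective (toFiniteMeasures (w := w)) := by
  refine fun ν ν' hν => Subtype.ext ?_
  rw [← glueMeasure_withDensity w_cover ν.1, ← glueMeasure_withDensity w_cover ν'.1]
  exact congrArg (glueMeasure w)
    (funext fun k => congrArg (fun μ => (μ k : Measure E)) hν)

lemma measurable_val [BorelSpace E] [HasOuterApproxClosed E] (w_nonneg : ∀ k x, 0 ≤ w k x)
    (w_cover : ∀ x, ∃ k, 0 < w k x) : Measurable fun ν : LocationMeasures w => ν.1 := by
  have hweighted : ∀ k, Measurable fun ν : LocationMeasures w =>
      (ν.toFiniteMeasures k : Measure E) := fun k =>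
    measurable_finiteMeasure_of_measurable_lintegral fun f =>
      (continuous_iff_continuousAt.2 fun ν => FiniteMeasure.tendsto_iff_forall_lintegral_tendsto.1
        (((continuous_apply k).comp (isInducing_toFiniteMeasures w_nonneg).continuous).tendsto ν)
        f).measurable
  simpa only [toFiniteMeasures, FiniteMeasure.toMeasure_mk, glueMeasure_withDensity w_cover]
    using measurable_glueMeasure (w := w) hweighted

end LocationMeasures

end Glue

/-! ### Measures on `S × [0, ∞)` -/

section LevelMeasures

/-- A continuous function equal to `1` on `[0, K]` and to `0` on `[K + 1, ∞)`. -/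
noncomputable def levelCutoff (K : ℕ) : ℝ≥0 →ᵇ ℝ :=
  .ofNormedAddCommGroup (fun u => ((min 1 (K + 1 - u) : ℝ≥0) : ℝ)) (by fun_prop) 1
    fun u => by rw [NNReal.norm_eq]; exact_mod_cast min_le_left _ _

lemma levelCutoff_nonneg (K : ℕ) (u : ℝ≥0) : 0 ≤ levelCutoff K u := NNReal.coe_nonneg _

lemma levelCutoff_le_one (K : ℕ) (u : ℝ≥0) : levelCutoff K u ≤ 1 :=
  NNReal.coe_le_one.2 (min_le_left _ _)

lemma levelCutoff_of_le {K : ℕ} {u : ℝ≥0} (hu : u ≤ K) : levelCutoff K u = 1 := by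
  refine NNReal.coe_eq_one.2 (min_eq_left (le_tsub_of_add_le_left ?_))
  gcongr

lemma levelCutoff_of_lt {K : ℕ} {u : ℝ≥0} (hu : (K : ℝ≥0) + 1 < u) : levelCutoff K u = 0 := by
  refine NNReal.coe_eq_zero.2 ?_
  rw [tsub_eq_zero_of_le hu.le, min_zero]

variable {S : Type*} [TopologicalSpace S]

/-- The weights `(x, u) ↦ h k x * levelCutoff K u` on `S × [0, ∞)`, enumerated by the pairs
`(k, K)`; they turn `LevelMeasures h` into a space of location measures on `S × [0, ∞)`. -/
noncomputable def levelWeights (h : ℕ → S →ᵇ ℝ) (j : ℕ) : (S × ℝ≥0) →ᵇ ℝ :=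
  (h j.unpair.1).compContinuous ⟨Prod.fst, continuous_fst⟩ *
    (levelCutoff j.unpair.2).compContinuous ⟨Prod.snd, continuous_snd⟩

lemma levelWeights_apply (h : ℕ → S →ᵇ ℝ) (j : ℕ) (z : S × ℝ≥0) :
    levelWeights h j z = h j.unpair.1 z.1 * levelCutoff j.unpair.2 z.2 := rfl

variable {h : ℕ → S →ᵇ ℝ}

lemma levelWeights_nonneg (h_nonneg : ∀ k x, 0 ≤ h k x) (j : ℕ) (z : S × ℝ≥0) :
    0 ≤ levelWeights h j z :=
  mul_nonneg (h_nonneg _ _) (levelCutoff_nonneg _ _)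

lemma levelWeights_pair {k K : ℕ} {z : S × ℝ≥0} (hz : z.2 ≤ K) :
    levelWeights h (Nat.pair k K) z = h k z.1 := by
  simp [levelWeights_apply, levelCutoff_of_le hz]

lemma levelWeights_cover (h_cover : ∀ x, ∃ k, 0 < h k x) (z : S × ℝ≥0) :
    ∃ j, 0 < levelWeights h j z := by
  obtain ⟨k, hk⟩ := h_cover z.1
  obtain ⟨K, hK⟩ := exists_nat_ge z.2
  exact ⟨Nat.pair k K, by rwa [levelWeights_pair hK]⟩

variable [MeasurableSpace S]

namespace LevelMeasures

lemma continuous_integral_mul_weight (f : (S × ℝ≥0) →ᵇ ℝ) {K : ℝ≥0}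
    (hf : ∀ x u, K < u → f (x, u) = 0) (k : ℕ) :
    Continuous fun μ : LevelMeasures h => ∫ z, f z * h k z.1 ∂μ.1 :=
  continuous_iInf_dom (i := k) (continuous_iInf_dom (i := ⟨f, K, hf⟩) continuous_induced_dom)

lemma lintegral_levelWeights_lt_top (h_nonneg : ∀ k x, 0 ≤ h k x) (μ : LevelMeasures h) (j : ℕ) :
    ∫⁻ z, ENNReal.ofReal (levelWeights h j z) ∂μ.1 < ∞ := by
  refine lt_of_le_of_lt ?_ (μ.2 j.unpair.1 (j.unpair.2 + 1))
  rw [← lintegral_indicator (measurableSet_le measurable_snd measurable_const)]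
  refine lintegral_mono fun z => ?_
  by_cases hz : z.2 ≤ (j.unpair.2 : ℝ≥0) + 1
  · rw [Set.indicator_of_mem (by exact hz), levelWeights_apply]
    exact ENNReal.ofReal_le_ofReal (mul_le_of_le_one_right (h_nonneg _ _) (levelCutoff_le_one _ _))
  · simp [levelWeights_apply, levelCutoff_of_lt (not_le.1 hz)]

/-- A measure in `LevelMeasures h` as a location measure on `S × [0, ∞)` for the weights
`levelWeights h`. -/
def toWeighted (h_nonneg : ∀ k x, 0 ≤ h k x) (μ : LevelMeasures h) :
    LocationMeasures (levelWeights h) :=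
  ⟨μ.1, μ.lintegral_levelWeights_lt_top h_nonneg⟩

lemma continuous_toWeighted (h_nonneg : ∀ k x, 0 ≤ h k x) : Continuous (toWeighted h_nonneg) := by
  refine continuous_iInf_rng.2 fun j => continuous_iInf_rng.2 fun f => continuous_induced_rng.2 ?_
  let g : (S × ℝ≥0) →ᵇ ℝ :=
    f * (levelCutoff j.unpair.2).compContinuous ⟨Prod.snd, continuous_snd⟩
  have hg : ∀ z, g z * h j.unpair.1 z.1 = f z * levelWeights h j z := fun z => by
    rw [levelWeights_apply, mul_comm (h _ _), ← mul_assoc]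
    rfl
  have hsupp : ∀ x u, (j.unpair.2 : ℝ≥0) + 1 < u → g (x, u) = 0 := fun x u hu => by
    simp [g, levelCutoff_of_lt hu]
  have hcont := continuous_integral_mul_weight (h := h) g hsupp j.unpair.1
  simp only [hg] at hcont
  exact hcont

lemma isInducing_toWeighted (h_nonneg : ∀ k x, 0 ≤ h k x) : IsInducing (toWeighted h_nonneg) := by
  refine ⟨le_antisymm (continuous_toWeighted h_nonneg).le_induced ?_⟩
  refine le_iInf fun k => le_iInf fun ⟨f, K, hK⟩ => ?_
  obtain ⟨N, hN⟩ := exists_nat_ge K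
  have heq : ∀ μ : LevelMeasures h, ∫ z, f z * h k z.1 ∂μ.1 =
      ∫ z, f z * levelWeights h (Nat.pair k N) z ∂(μ.toWeighted h_nonneg).1 := fun μ => by
    refine integral_congr_ae (.of_forall fun z => ?_)
    rcases le_or_gt z.2 K with hz | hz
    · simp only [levelWeights_pair (hz.trans hN)]
    · simp only [hK z.1 z.2 hz, zero_mul]
  simp only [heq]
  exact (induced_mono (continuous_iff_le_induced.1
    (_root_.continuous_integral_mul_weight f _))).trans_eq induced_compose

variable [BorelSpace S]

lemma isTestInduced [SecondCountableTopology S] [TopologicalSpace.MetrizableSpace S]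
    (h_nonneg : ∀ k x, 0 ≤ h k x) :
    IsTestInduced (levelWeights h) fun μ : LevelMeasures h => μ.1 := by
  obtain ⟨F, hF, hy⟩ := LocationMeasures.isTestInduced (levelWeights_nonneg h_nonneg)
  exact ⟨F, hF, hy.comp (isInducing_toWeighted h_nonneg)⟩

lemma measurable_val [TopologicalSpace.MetrizableSpace S]
    (h_nonneg : ∀ k x, 0 ≤ h k x) (h_cover : ∀ x, ∃ k, 0 < h k x) :
    Measurable fun μ : LevelMeasures h => μ.1 :=
  (LocationMeasures.measurable_val (levelWeights_nonneg h_nonneg)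
    (levelWeights_cover h_cover)).comp (continuous_toWeighted h_nonneg).measurable

lemma continuous_lintegral (h_nonneg : ∀ k x, 0 ≤ h k x) {F : S × ℝ≥0 → ℝ}
    (hF : F ∈ testClass (levelWeights h)) :
    Continuous fun μ : LevelMeasures h => ∫⁻ z, ENNReal.ofReal (F z) ∂μ.1 :=
  (continuous_lintegral_of_mem_testClass (levelWeights_nonneg h_nonneg) hF).comp
    (continuous_toWeighted h_nonneg)

end LevelMeasures

end LevelMeasures

/-! ### Lebesgue measure on the half-line -/

section HalfLine

lemma lintegral_halfLineLebesgue {f : ℝ≥0 → ℝ≥0∞} (hf : Measurable f) :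
    ∫⁻ u, f u ∂halfLineLebesgue = ∫⁻ t in Set.Ici (0 : ℝ), f t.toNNReal :=
  lintegral_map hf measurable_real_toNNReal

lemma lintegral_halfLineLebesgue_eq_setLIntegral_Icc {f : ℝ≥0 → ℝ≥0∞} (hf : Measurable f)
    {c : ℝ≥0} (hc : ∀ u, c < u → f u = 0) :
    ∫⁻ u, f u ∂halfLineLebesgue = ∫⁻ t in Set.Icc (0 : ℝ) c, f t.toNNReal := by
  rw [lintegral_halfLineLebesgue hf, ← lintegral_indicator measurableSet_Ici,
    ← lintegral_indicator measurableSet_Icc]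
  refine lintegral_congr fun t => ?_
  rcases le_or_gt t c with htc | htc
  · simp only [Set.indicator_apply, Set.mem_Ici, Set.mem_Icc, htc, and_true]
  · rw [Set.indicator_of_notMem (s := Set.Icc _ _) fun ht => htc.not_ge ht.2]
    exact Set.indicator_apply_eq_zero.2 fun _ => hc _ (Real.lt_toNNReal_iff_coe_lt.2 htc)

lemma halfLineLebesgue_Iic (K : ℝ≥0) : halfLineLebesgue (Set.Iic K) = K := by
  have hpreimage : Real.toNNReal ⁻¹' Set.Iic K ∩ Set.Ici 0 = Set.Icc 0 (K : ℝ) := by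
    ext t
    simp only [Set.mem_inter_iff, Set.mem_preimage, Set.mem_Iic, Set.mem_Ici, Set.mem_Icc,
      Real.toNNReal_le_iff_le_coe, and_comm]
  rw [halfLineLebesgue, Measure.map_apply measurable_real_toNNReal measurableSet_Iic,
    Measure.restrict_apply (measurable_real_toNNReal measurableSet_Iic), hpreimage,
    Real.volume_Icc, sub_zero, ENNReal.ofReal_coe_nnreal]

instance sigmaFinite_halfLineLebesgue : SigmaFinite halfLineLebesgue := by
  refine ⟨⟨⟨fun n => Set.Iic (n : ℝ≥0), fun _ => trivial, fun n => ?_, ?_⟩⟩⟩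
  · rw [halfLineLebesgue_Iic]
    exact ENNReal.coe_lt_top
  · exact Set.eq_univ_of_forall fun u => Set.mem_iUnion.2 (exists_nat_ge u)

lemma integrable_halfLineLebesgue_of_bounded {f : ℝ≥0 → ℝ} (hf : Measurable f) {C : ℝ} {K : ℝ≥0}
    (hC : ∀ u, |f u| ≤ C) (hK : ∀ u, K < u → f u = 0) : Integrable f halfLineLebesgue := by
  have hIic : IntegrableOn f (Set.Iic K) halfLineLebesgue :=
    Measure.integrableOn_of_bounded (by rw [halfLineLebesgue_Iic]; exact ENNReal.coe_ne_top)
      hf.aestronglyMeasurable (.of_forall hC)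
  exact hIic.integrable_of_forall_notMem_eq_zero fun u hu => hK u (not_le.1 hu)

/-- The triangular probability density on `[0, K + 1]`, which vanishes beyond `K + 1` because the
subtraction in `ℝ≥0` truncates. It spreads a function on `S` over the levels with a small height,
so that its level exponent is nearly the function itself. -/
noncomputable def triangleDensity (K : ℕ) (u : ℝ≥0) : ℝ≥0 := 2 / (K + 1) * (1 - u / (K + 1))

lemma continuous_triangleDensity (K : ℕ) : Continuous (triangleDensity K) := by
  unfold triangleDensity; fun_prop

lemma triangleDensity_le (K : ℕ) (u : ℝ≥0) : triangleDensity K u ≤ 2 / (K + 1) :=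
  mul_le_of_le_one_right' tsub_le_self

lemma triangleDensity_of_lt {K : ℕ} {u : ℝ≥0} (hu : (K : ℝ≥0) + 1 < u) :
    triangleDensity K u = 0 := by
  rw [triangleDensity, tsub_eq_zero_of_le ((one_le_div (by positivity)).2 hu.le), mul_zero]

lemma coe_triangleDensity_of_le {K : ℕ} {u : ℝ≥0} (hu : u ≤ K + 1) :
    (triangleDensity K u : ℝ) = 2 / (K + 1) * (1 - u / (K + 1)) := by
  have hle : u / ((K : ℝ≥0) + 1) ≤ 1 := (div_le_one (by positivity)).2 hu
  simp [triangleDensity, NNReal.coe_sub hle]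

lemma integral_two_div_mul_one_sub_div {c : ℝ} (hc : c ≠ 0) :
    ∫ t in (0 : ℝ)..c, 2 / c * (1 - t / c) = 1 := by
  rw [intervalIntegral.integral_const_mul, intervalIntegral.integral_sub (by simp)
    (by apply Continuous.intervalIntegrable; fun_prop), intervalIntegral.integral_div, integral_id,
    intervalIntegral.integral_const, smul_eq_mul]
  field_simp
  ring

lemma lintegral_triangleDensity (K : ℕ) :
    ∫⁻ u, (triangleDensity K u : ℝ≥0∞) ∂halfLineLebesgue = 1 := by
  have hc : (0 : ℝ) < K + 1 := by positivity
  have hreal : ∀ t ∈ Set.Icc (0 : ℝ) ((K + 1 : ℝ≥0) : ℝ), (triangleDensity K t.toNNReal : ℝ≥0∞) =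
      ENNReal.ofReal (2 / (K + 1) * (1 - t / (K + 1))) := fun t ht => by
    rw [← ENNReal.ofReal_coe_nnreal,
      coe_triangleDensity_of_le (Real.toNNReal_le_iff_le_coe.2 ht.2), Real.coe_toNNReal _ ht.1]
  rw [lintegral_halfLineLebesgue_eq_setLIntegral_Icc
      (continuous_triangleDensity K).measurable.coe_nnreal_ennreal
      fun u hu => by rw [triangleDensity_of_lt hu, ENNReal.coe_zero],
    setLIntegral_congr_fun measurableSet_Icc hreal, ← ofReal_integral_eq_lintegral_ofReal]
  · rw [integral_Icc_eq_integral_Ioc, ← intervalIntegral.integral_of_le (NNReal.coe_nonneg _)]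
    push_cast
    rw [integral_two_div_mul_one_sub_div hc.ne', ENNReal.ofReal_one]
  · exact Continuous.integrableOn_Icc (by fun_prop)
  · refine (ae_restrict_iff' measurableSet_Icc).2 (.of_forall fun t ht => ?_)
    exact mul_nonneg (by positivity) (sub_nonneg.2 ((div_le_one hc).2 (mod_cast ht.2)))

end HalfLine

/-! ### Elementary inequalities -/

section Inequalities

lemma one_sub_exp_neg_nonneg {t : ℝ} (ht : 0 ≤ t) : 0 ≤ 1 - Real.exp (-t) :=
  sub_nonneg.2 (Real.exp_le_one_iff.2 (neg_nonpos.2 ht))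

lemma one_sub_exp_neg_le_one (t : ℝ) : 1 - Real.exp (-t) ≤ 1 := sub_le_self _ (Real.exp_nonneg _)

lemma one_sub_exp_neg_le (t : ℝ) : 1 - Real.exp (-t) ≤ t := by
  linarith [Real.one_sub_le_exp_neg t]

lemma le_one_add_mul_one_sub_exp_neg {t s : ℝ} (ht : 0 ≤ t) (hts : t ≤ s) :
    t ≤ (1 + s) * (1 - Real.exp (-t)) := by
  have hmul : (1 + t) * Real.exp (-t) ≤ Real.exp t * Real.exp (-t) :=
    mul_le_mul_of_nonneg_right (by linarith [Real.add_one_le_exp t]) (Real.exp_nonneg _)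
  rw [← Real.exp_add, add_neg_cancel, Real.exp_zero] at hmul
  calc t ≤ (1 + t) * (1 - Real.exp (-t)) := by linarith
    _ ≤ (1 + s) * (1 - Real.exp (-t)) :=
      mul_le_mul_of_nonneg_right (by linarith) (one_sub_exp_neg_nonneg ht)

lemma le_neg_log_one_sub {t : ℝ} (ht : t < 1) : t ≤ -Real.log (1 - t) := by
  linarith [Real.log_le_sub_one_of_pos (sub_pos.2 ht)]

lemma neg_log_one_sub_le {t : ℝ} (ht_nonneg : 0 ≤ t) (ht : t ≤ 1 / 2) :
    -Real.log (1 - t) ≤ (1 + 2 * t) * t := by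
  have hpos : 0 < 1 - t := by linarith
  have hinv : (1 - t)⁻¹ ≤ 1 + (1 + 2 * t) * t := by
    rw [inv_le_iff_one_le_mul₀ hpos]
    nlinarith [mul_nonneg (mul_nonneg ht_nonneg ht_nonneg) (by linarith : 0 ≤ 1 - 2 * t)]
  linarith [Real.one_sub_inv_le_log_of_pos hpos]

/-- The continuous extension of `t ↦ (1 - exp (-t)) / t`. It is the bounded continuous
factor in `1 - exp (-F) = expQuotient F * F` for a test function `F`. -/
noncomputable def expQuotient (t : ℝ) : ℝ := dslope (fun t : ℝ => 1 - Real.exp (-t)) 0 t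

lemma mul_expQuotient (t : ℝ) : t * expQuotient t = 1 - Real.exp (-t) := by
  simpa [expQuotient] using sub_smul_dslope (fun t : ℝ => 1 - Real.exp (-t)) 0 t

lemma continuous_expQuotient : Continuous expQuotient := by
  rw [← continuousOn_univ]
  exact (continuousOn_dslope univ_mem).2 ⟨by fun_prop, by fun_prop⟩

lemma expQuotient_zero : expQuotient 0 = 1 := by
  have hderiv : HasDerivAt (fun t : ℝ => 1 - Real.exp (-t)) (-(Real.exp (-0) * -1)) 0 :=
    ((hasDerivAt_neg (0 : ℝ)).exp).const_sub 1
  rw [expQuotient, dslope_same, hderiv.deriv]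
  simp

lemma expQuotient_mem_Icc {t : ℝ} (ht : 0 ≤ t) : expQuotient t ∈ Set.Icc 0 1 := by
  rcases ht.eq_or_lt with rfl | hpos
  · simp [expQuotient_zero]
  · rw [eq_div_of_mul_eq hpos.ne' ((mul_comm _ _).trans (mul_expQuotient t))]
    exact ⟨div_nonneg (one_sub_exp_neg_nonneg ht) ht, (div_le_one hpos).2 (one_sub_exp_neg_le t)⟩

end Inequalities

/-! ### The limiting exponent of the level transform -/

section LevelExponent

variable {g : ℝ≥0 → ℝ} {K : ℝ≥0}

lemma integrable_one_sub_exp_neg (hg : Measurable g) (hg_nonneg : ∀ u, 0 ≤ g u)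
    (hK : ∀ u, K < u → g u = 0) :
    Integrable (fun u => 1 - Real.exp (-g u)) halfLineLebesgue :=
  integrable_halfLineLebesgue_of_bounded (C := 1) (K := K) (by fun_prop)
    (fun u => (abs_of_nonneg (one_sub_exp_neg_nonneg (hg_nonneg u))).trans_le
      (one_sub_exp_neg_le_one _))
    (fun u hu => by simp [hK u hu])

lemma integral_one_sub_exp_neg_le (hg : Measurable g) (hg_nonneg : ∀ u, 0 ≤ g u)
    (hK : ∀ u, K < u → g u = 0) : ∫ u, (1 - Real.exp (-g u)) ∂halfLineLebesgue ≤ K := by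
  have hfinite : halfLineLebesgue (Set.Iic K) ≠ ∞ := by
    rw [halfLineLebesgue_Iic]
    exact ENNReal.coe_ne_top
  rw [← setIntegral_eq_integral_of_forall_compl_eq_zero (s := Set.Iic K)
    fun u hu => by simp [hK u (not_le.1 hu)]]
  refine (setIntegral_mono (integrable_one_sub_exp_neg hg hg_nonneg hK).integrableOn
    (integrableOn_const hfinite) fun u => one_sub_exp_neg_le_one _).trans_eq ?_
  simp [measureReal_def, halfLineLebesgue_Iic]

lemma setIntegral_Iic_exp_neg (hg : Measurable g) (hg_nonneg : ∀ u, 0 ≤ g u)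
    (hK : ∀ u, K < u → g u = 0) {r : ℝ≥0} (hKr : K ≤ r) :
    ∫ u in Set.Iic r, Real.exp (-g u) ∂halfLineLebesgue =
      r - ∫ u, (1 - Real.exp (-g u)) ∂halfLineLebesgue := by
  have hfinite : halfLineLebesgue (Set.Iic r) ≠ ∞ := by
    rw [halfLineLebesgue_Iic]
    exact ENNReal.coe_ne_top
  have hconst : ∫ _ in Set.Iic r, (1 : ℝ) ∂halfLineLebesgue = r := by
    simp [measureReal_def, halfLineLebesgue_Iic]
  have hrestrict : ∫ u in Set.Iic r, (1 - Real.exp (-g u)) ∂halfLineLebesgue =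
      ∫ u, (1 - Real.exp (-g u)) ∂halfLineLebesgue :=
    setIntegral_eq_integral_of_forall_compl_eq_zero
      fun u hu => by simp [hK u (hKr.trans_lt (not_le.1 hu))]
  have hint : IntegrableOn (fun _ => (1 : ℝ)) (Set.Iic r) halfLineLebesgue :=
    integrableOn_const hfinite
  rw [← hrestrict, ← hconst,
    ← integral_sub hint (integrable_one_sub_exp_neg hg hg_nonneg hK).integrableOn]
  simp only [sub_sub_cancel]

variable {S : Type*}

/-- The function `x ↦ ∫_0^∞ (1 - exp (-f(x, u))) du`, the limit of `levelTransform r f` as `r`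
tends to infinity. -/
noncomputable def levelExponent (f : S × ℝ≥0 → ℝ) (x : S) : ℝ≥0∞ :=
  ∫⁻ u, ENNReal.ofReal (1 - Real.exp (-f (x, u))) ∂halfLineLebesgue

variable [MeasurableSpace S] {f : S × ℝ≥0 → ℝ}

lemma measurable_levelExponent (hf : Measurable f) : Measurable (levelExponent f) :=
  Measurable.lintegral_prod_right' (f := fun z => ENNReal.ofReal (1 - Real.exp (-f z)))
    (by fun_prop)

lemma levelExponent_eq_ofReal_integral (hf : Measurable f) (hf_nonneg : ∀ z, 0 ≤ f z)
    (hK : ∀ x u, K < u → f (x, u) = 0) (x : S) :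
    levelExponent f x = ENNReal.ofReal (∫ u, (1 - Real.exp (-f (x, u))) ∂halfLineLebesgue) :=
  (ofReal_integral_eq_lintegral_ofReal
    (integrable_one_sub_exp_neg (hf.comp measurable_prodMk_left) (fun _ => hf_nonneg _) (hK x))
    (.of_forall fun _ => one_sub_exp_neg_nonneg (hf_nonneg _))).symm

lemma levelTransform_eq (hf : Measurable f) (hf_nonneg : ∀ z, 0 ≤ f z)
    (hK : ∀ x u, K < u → f (x, u) = 0) {r : ℝ≥0} (hr : 0 < r) (hKr : K ≤ r) (x : S) :
    levelTransform r f x =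
      r * -Real.log (1 - (∫ u, (1 - Real.exp (-f (x, u))) ∂halfLineLebesgue) / r) := by
  rw [levelTransform, setIntegral_Iic_exp_neg (g := fun u => f (x, u))
    (hf.comp measurable_prodMk_left) (fun _ => hf_nonneg _) (hK x) hKr, mul_sub,
    inv_mul_cancel₀ (NNReal.coe_ne_zero.2 hr.ne'), inv_mul_eq_div, neg_mul, mul_neg]

lemma levelExponent_le_levelTransform_and_le (hf : Measurable f) (hf_nonneg : ∀ z, 0 ≤ f z)
    (hK : ∀ x u, K < u → f (x, u) = 0) {r : ℝ≥0} (hr : 0 < r) (hKr : 2 * K ≤ r) (x : S) :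
    levelExponent f x ≤ ENNReal.ofReal (levelTransform r f x) ∧
      ENNReal.ofReal (levelTransform r f x) ≤
        ENNReal.ofReal (1 + 2 * K / r) * levelExponent f x := by
  have hKr' : K ≤ r := (le_mul_of_one_le_left' one_le_two).trans hKr
  have hr_real : (0 : ℝ) < r := hr
  rw [levelExponent_eq_ofReal_integral hf hf_nonneg hK,
    levelTransform_eq hf hf_nonneg hK hr hKr', ← ENNReal.ofReal_mul (by positivity)]
  have hG_le : ∫ u, (1 - Real.exp (-f (x, u))) ∂halfLineLebesgue ≤ K :=
    integral_one_sub_exp_neg_le (hf.comp measurable_prodMk_left) (fun _ => hf_nonneg _) (hK x)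
  have hG_nonneg : 0 ≤ ∫ u, (1 - Real.exp (-f (x, u))) ∂halfLineLebesgue :=
    integral_nonneg fun _ => one_sub_exp_neg_nonneg (hf_nonneg _)
  generalize ∫ u, (1 - Real.exp (-f (x, u))) ∂halfLineLebesgue = G at hG_le hG_nonneg
  have hGr_nonneg : 0 ≤ G / r := by positivity
  have hGr_le : G / r ≤ 1 / 2 := by
    rw [div_le_iff₀ hr_real]
    linarith [(by exact_mod_cast hKr : 2 * (K : ℝ) ≤ r)]
  have hG : r * (G / r) = G := mul_div_cancel₀ _ hr_real.ne'
  refine ⟨ENNReal.ofReal_le_ofReal ?_, ENNReal.ofReal_le_ofReal ?_⟩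
  · calc G = r * (G / r) := hG.symm
      _ ≤ r * -Real.log (1 - G / r) :=
        mul_le_mul_of_nonneg_left (le_neg_log_one_sub (by linarith)) hr_real.le
  · calc r * -Real.log (1 - G / r) ≤ r * ((1 + 2 * (G / r)) * (G / r)) :=
        mul_le_mul_of_nonneg_left (neg_log_one_sub_le hGr_nonneg hGr_le) hr_real.le
      _ = (1 + 2 * G / r) * (r * (G / r)) := by ring
      _ = (1 + 2 * G / r) * G := by rw [hG]
      _ ≤ (1 + 2 * K / r) * G := by gcongr

end LevelExponent

/-! ### Integrating out the level -/

section LevelIntegral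

lemma integrable_mul_levelCutoff (f : ℝ≥0 →ᵇ ℝ) (K : ℕ) :
    Integrable (fun u => f u * levelCutoff K u) halfLineLebesgue :=
  integrable_halfLineLebesgue_of_bounded (K := K + 1)
    (f * levelCutoff K).continuous.measurable ((f * levelCutoff K).norm_coe_le_norm)
    fun u hu => by rw [levelCutoff_of_lt hu, mul_zero]

variable {S : Type*} [TopologicalSpace S]

lemma continuous_integral_mul_levelCutoff [FirstCountableTopology S] (f : (S × ℝ≥0) →ᵇ ℝ) (K : ℕ) :
    Continuous fun x => ∫ u, f (x, u) * levelCutoff K u ∂halfLineLebesgue := by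
  have hbound : ∀ x u, ‖f (x, u) * levelCutoff K u‖ ≤ ‖f‖ * levelCutoff K u := fun x u => by
    rw [norm_mul, Real.norm_of_nonneg (levelCutoff_nonneg K u)]
    exact mul_le_mul_of_nonneg_right (f.norm_coe_le_norm _) (levelCutoff_nonneg K u)
  refine continuous_of_dominated (fun x => ?_) (fun x => .of_forall (hbound x))
    (integrable_mul_levelCutoff (.const _ ‖f‖) K) (.of_forall fun u => by fun_prop)
  exact Continuous.aestronglyMeasurable (by fun_prop)

/-- The function `x ↦ ∫ f(x, u) levelCutoff K u du`. It keeps the test class on `S × [0, ∞)` inside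
the test class on `S` when levels are integrated out. -/
noncomputable def levelIntegral [FirstCountableTopology S] (f : (S × ℝ≥0) →ᵇ ℝ) (K : ℕ) : S →ᵇ ℝ :=
  .ofNormedAddCommGroup _ (continuous_integral_mul_levelCutoff f K)
    (∫ u, ‖f‖ * levelCutoff K u ∂halfLineLebesgue) fun x => by
      refine norm_integral_le_of_norm_le (integrable_mul_levelCutoff (.const _ ‖f‖) K)
        (.of_forall fun u => ?_)
      rw [norm_mul, Real.norm_of_nonneg (levelCutoff_nonneg K u)]
      exact mul_le_mul_of_nonneg_right (f.norm_coe_le_norm _) (levelCutoff_nonneg K u)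

lemma exists_level_bound_of_mem_testClass {h : ℕ → S →ᵇ ℝ} {F : S × ℝ≥0 → ℝ}
    (hF : F ∈ testClass (levelWeights h)) : ∃ K : ℝ≥0, ∀ x u, K < u → F (x, u) = 0 := by
  induction hF using AddSubmonoid.closure_induction with
  | mem F hF =>
    obtain ⟨f, j, -, rfl⟩ := hF
    refine ⟨(j.unpair.2 : ℝ≥0) + 1, fun x u hu => ?_⟩
    simp [levelWeights_apply, levelCutoff_of_lt hu]
  | zero => exact ⟨0, fun _ _ _ => rfl⟩
  | add F G _ _ hF hG =>
    obtain ⟨K, hK⟩ := hF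
    obtain ⟨L, hL⟩ := hG
    refine ⟨max K L, fun x u hu => ?_⟩
    simp [hK x u ((le_max_left _ _).trans_lt hu), hL x u ((le_max_right _ _).trans_lt hu)]

variable [FirstCountableTopology S]

lemma levelIntegral_nonneg {f : (S × ℝ≥0) →ᵇ ℝ} (hf : ∀ z, 0 ≤ f z) (K : ℕ) (x : S) :
    0 ≤ levelIntegral f K x :=
  integral_nonneg fun _ => mul_nonneg (hf _) (levelCutoff_nonneg K _)

lemma ofReal_levelIntegral {f : (S × ℝ≥0) →ᵇ ℝ} (hf : ∀ z, 0 ≤ f z) (K : ℕ) (x : S) :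
    ENNReal.ofReal (levelIntegral f K x) =
      ∫⁻ u, ENNReal.ofReal (f (x, u) * levelCutoff K u) ∂halfLineLebesgue :=
  ofReal_integral_eq_lintegral_ofReal
    (integrable_mul_levelCutoff (f.compContinuous ⟨fun u => (x, u), by fun_prop⟩) K)
    (.of_forall fun _ => mul_nonneg (hf _) (levelCutoff_nonneg K _))

variable {h : ℕ → S →ᵇ ℝ}

lemma lintegral_mul_levelWeights {f : (S × ℝ≥0) →ᵇ ℝ} (hf : ∀ z, 0 ≤ f z) (j : ℕ) (x : S) :
    ∫⁻ u, ENNReal.ofReal (f (x, u) * levelWeights h j (x, u)) ∂halfLineLebesgue =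
      ENNReal.ofReal (levelIntegral f j.unpair.2 x * h j.unpair.1 x) := by
  rw [ENNReal.ofReal_mul (levelIntegral_nonneg hf _ x), ofReal_levelIntegral hf,
    ← lintegral_mul_const _ (Measurable.ennreal_ofReal (Continuous.measurable (by fun_prop)))]
  refine lintegral_congr fun u => ?_
  rw [← ENNReal.ofReal_mul (mul_nonneg (hf _) (levelCutoff_nonneg _ _)), levelWeights_apply,
    mul_assoc, mul_comm (h _ x)]

lemma exists_testClass_lintegral_level (h_nonneg : ∀ k x, 0 ≤ h k x) {F : S × ℝ≥0 → ℝ}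
    (hF : F ∈ testClass (levelWeights h)) : ∃ G ∈ testClass h, ∀ x,
      ∫⁻ u, ENNReal.ofReal (F (x, u)) ∂halfLineLebesgue = ENNReal.ofReal (G x) := by
  induction hF using AddSubmonoid.closure_induction with
  | mem F hF =>
    obtain ⟨f, j, hf, rfl⟩ := hF
    exact ⟨_, mul_mem_testClass (levelIntegral_nonneg hf _) _, lintegral_mul_levelWeights hf j⟩
  | zero => exact ⟨0, (testClass h).zero_mem, fun x => by simp⟩
  | add F F' hF hF' ihF ihF' =>
    obtain ⟨G, hG, hFG⟩ := ihF
    obtain ⟨G', hG', hFG'⟩ := ihF'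
    refine ⟨G + G', (testClass h).add_mem hG hG', fun x => ?_⟩
    have hF_meas : Measurable fun u => F (x, u) :=
      ((continuous_of_mem_testClass hF).comp (by fun_prop)).measurable
    have hw := levelWeights_nonneg h_nonneg
    rw [Pi.add_apply, ENNReal.ofReal_add (nonneg_of_mem_testClass h_nonneg hG x)
      (nonneg_of_mem_testClass h_nonneg hG' x), ← hFG, ← hFG',
      ← lintegral_add_left hF_meas.ennreal_ofReal]
    exact lintegral_congr fun u => ENNReal.ofReal_add (nonneg_of_mem_testClass hw hF _)
      (nonneg_of_mem_testClass hw hF' _)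

lemma exists_testClass_levelExponent (h_nonneg : ∀ k x, 0 ≤ h k x) {F : S × ℝ≥0 → ℝ}
    (hF : F ∈ testClass (levelWeights h)) :
    ∃ G ∈ testClass h, ∀ x, levelExponent F x = ENNReal.ofReal (G x) := by
  have hq : ∀ z, expQuotient (F z) ∈ Set.Icc 0 1 := fun z =>
    expQuotient_mem_Icc (nonneg_of_mem_testClass (levelWeights_nonneg h_nonneg) hF z)
  let q : (S × ℝ≥0) →ᵇ ℝ := .ofNormedAddCommGroup (fun z => expQuotient (F z))
    (continuous_expQuotient.comp (continuous_of_mem_testClass hF)) 1 fun z =>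
      (Real.norm_of_nonneg (hq z).1).trans_le (hq z).2
  obtain ⟨G, hG, hFG⟩ := exists_testClass_lintegral_level h_nonneg
    (mul_mem_testClass_of_mem hF (g := q) fun z => (hq z).1)
  refine ⟨G, hG, fun x => (lintegral_congr fun u => ?_).trans (hFG x)⟩
  rw [← mul_expQuotient, mul_comm]
  rfl

end LevelIntegral

/-! ### Spreading test functions over the levels -/

section TriangleDensity

variable {S : Type*} {G : S → ℝ}

lemma mul_triangleDensity_mem_testClass [TopologicalSpace S] {h : ℕ → S →ᵇ ℝ}
    (hG : G ∈ testClass h) (K : ℕ) :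
    (fun z : S × ℝ≥0 => G z.1 * triangleDensity K z.2) ∈ testClass (levelWeights h) := by
  induction hG using AddSubmonoid.closure_induction with
  | mem G hG =>
    obtain ⟨f, k, hf, rfl⟩ := hG
    let g : (S × ℝ≥0) →ᵇ ℝ := f.compContinuous ⟨Prod.fst, continuous_fst⟩ *
      .ofNormedAddCommGroup (fun z => (triangleDensity K z.2 : ℝ))
        (NNReal.continuous_coe.comp ((continuous_triangleDensity K).comp continuous_snd))
        ((2 / (K + 1) : ℝ≥0) : ℝ)
        fun z => (NNReal.norm_eq _).trans_le (NNReal.coe_le_coe.2 (triangleDensity_le K z.2))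
    have hg : ∀ z, g z = f z.1 * triangleDensity K z.2 := fun z => rfl
    convert mul_mem_testClass (w := levelWeights h) (f := g)
      (fun z => mul_nonneg (hf _) (NNReal.coe_nonneg _)) (Nat.pair k (K + 1)) using 2 with z
    rcases le_or_gt z.2 ((K + 1 : ℕ) : ℝ≥0) with hz | hz
    · rw [levelWeights_pair hz, hg]
      ring
    · simp [hg, triangleDensity_of_lt (by simpa using hz)]
  | zero =>
    simp only [Pi.zero_apply, zero_mul]
    exact (testClass _).zero_mem
  | add G G' _ _ hG hG' =>
    simp only [Pi.add_apply, add_mul]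
    exact (testClass _).add_mem hG hG'

lemma lintegral_mul_triangleDensity {c : ℝ} (hc : 0 ≤ c) (K : ℕ) :
    ∫⁻ u, ENNReal.ofReal (c * triangleDensity K u) ∂halfLineLebesgue = ENNReal.ofReal c := by
  simp only [ENNReal.ofReal_mul hc, ENNReal.ofReal_coe_nnreal]
  rw [lintegral_const_mul _ (continuous_triangleDensity K).measurable.coe_nnreal_ennreal,
    lintegral_triangleDensity, mul_one]

lemma levelExponent_mul_triangleDensity_le (hG : ∀ x, 0 ≤ G x) (K : ℕ) (x : S) :
    levelExponent (fun z : S × ℝ≥0 => G z.1 * triangleDensity K z.2) x ≤ ENNReal.ofReal (G x) := by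
  rw [← lintegral_mul_triangleDensity (hG x) K]
  exact lintegral_mono fun u => ENNReal.ofReal_le_ofReal (one_sub_exp_neg_le _)

lemma le_levelExponent_mul_triangleDensity (hG : ∀ x, 0 ≤ G x) {C : ℝ} (hGC : ∀ x, G x ≤ C) (K : ℕ)
    (x : S) : ENNReal.ofReal (G x) ≤ ENNReal.ofReal (1 + C * (2 / (K + 1))) *
      levelExponent (fun z : S × ℝ≥0 => G z.1 * triangleDensity K z.2) x := by
  have hC : 0 ≤ C := (hG x).trans (hGC x)
  have hmeas : Measurable fun u => ENNReal.ofReal (1 - Real.exp (-(G x * triangleDensity K u))) :=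
    (((continuous_triangleDensity K).measurable.coe_nnreal_real.const_mul _).neg.exp.const_sub
      1).ennreal_ofReal
  simp only [levelExponent]
  rw [← lintegral_mul_triangleDensity (hG x) K, ← lintegral_const_mul _ hmeas]
  refine lintegral_mono fun u => ?_
  rw [← ENNReal.ofReal_mul (by positivity)]
  refine ENNReal.ofReal_le_ofReal (le_one_add_mul_one_sub_exp_neg
    (mul_nonneg (hG x) (NNReal.coe_nonneg _)) ?_)
  exact mul_le_mul (hGC x) (by exact_mod_cast triangleDensity_le K u) (NNReal.coe_nonneg _) hC

lemma le_levelExponent_two_mul (hG : ∀ x, 0 ≤ G x) (hG_le : ∀ x, G x ≤ 1) (x : S) :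
    ENNReal.ofReal (G x) ≤
      levelExponent (fun z : S × ℝ≥0 => 2 * G z.1 * triangleDensity 3 z.2) x := by
  rw [← lintegral_mul_triangleDensity (hG x) 3]
  refine lintegral_mono fun u => ENNReal.ofReal_le_ofReal ?_
  have hdensity : (triangleDensity 3 u : ℝ) ≤ 1 / 2 :=
    (NNReal.coe_le_coe.2 (triangleDensity_le 3 u)).trans (by norm_num)
  have hle : 2 * G x * triangleDensity 3 u ≤ 1 := by
    have := mul_le_mul (hG_le x) hdensity (NNReal.coe_nonneg _) zero_le_one
    linarith
  have hnonneg : 0 ≤ 2 * G x * triangleDensity 3 u :=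
    mul_nonneg (mul_nonneg zero_le_two (hG x)) (NNReal.coe_nonneg _)
  linarith [le_one_add_mul_one_sub_exp_neg hnonneg hle]

end TriangleDensity

/-! ### Counting measures -/

section Counting

variable {E : Type*} [MeasurableSpace E]

lemma exists_enat_eq_tsum {a : ℕ → ℝ≥0∞} (ha : ∀ i, ∃ m : ℕ∞, a i = m) :
    ∃ m : ℕ∞, ∑' i, a i = m := by
  choose m hm using ha
  have hclosed : IsClosed (Set.range ENat.toENNReal) :=
    ENat.isClosedEmbedding_toENNReal.isClosed_range
  obtain ⟨k, hk⟩ : ∑' i, a i ∈ Set.range ENat.toENNReal := by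
    refine hclosed.mem_of_tendsto (ENNReal.tendsto_nat_tsum a) (.of_forall fun n => ?_)
    induction n with
    | zero => exact ⟨0, by simp⟩
    | succ n ih =>
      obtain ⟨k, hk⟩ := ih
      exact ⟨k + m n, by rw [Finset.sum_range_succ, ← hk, hm n, ENat.toENNReal_add]⟩
  exact ⟨k, hk.symm⟩

lemma isCountingMeasure_zero : IsCountingMeasure (0 : Measure E) := fun _ _ => ⟨0, by simp⟩

lemma isCountingMeasure_dirac (x : E) : IsCountingMeasure (Measure.dirac x) := by
  intro A hA
  rw [Measure.dirac_apply' _ hA]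
  by_cases hx : x ∈ A
  · exact ⟨1, by simp [hx]⟩
  · exact ⟨0, by simp [hx]⟩

lemma IsCountingMeasure.sum {μ : ℕ → Measure E} (hμ : ∀ i, IsCountingMeasure (μ i)) :
    IsCountingMeasure (Measure.sum μ) := by
  intro A hA
  rw [Measure.sum_apply _ hA]
  exact exists_enat_eq_tsum fun i => hμ i A hA

lemma IsCountingMeasure.add {μ ν : Measure E} (hμ : IsCountingMeasure μ)
    (hν : IsCountingMeasure ν) : IsCountingMeasure (μ + ν) := by
  intro A hA
  obtain ⟨a, ha⟩ := hμ A hA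
  obtain ⟨b, hb⟩ := hν A hA
  exact ⟨a + b, by rw [Measure.add_apply, ha, hb, ENat.toENNReal_add]⟩

lemma exists_enat_measure_inter_of_generateFrom {μ : Measure E} {𝒜 : Set (Set E)}
    (h𝒜 : IsSetAlgebra 𝒜) (hgen : ‹MeasurableSpace E› = MeasurableSpace.generateFrom 𝒜) {D : Set E}
    (hD : MeasurableSet D) (hD_finite : μ D < ∞) (hμ : ∀ A ∈ 𝒜, ∃ m : ℕ∞, μ (A ∩ D) = m)
    {A : Set E} (hA : MeasurableSet A) : ∃ m : ℕ∞, μ (A ∩ D) = m := by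
  have hpi : IsPiSystem 𝒜 := fun s hs t ht _ => h𝒜.inter_mem hs ht
  induction A, hA using MeasurableSpace.induction_on_inter hgen hpi with
  | empty => exact ⟨0, by simp⟩
  | basic A hA => exact hμ A hA
  | compl A hA ih =>
    obtain ⟨a, ha⟩ := ih
    obtain ⟨b, hb⟩ := hμ Set.univ (by simpa using h𝒜.compl_mem h𝒜.empty_mem)
    rw [Set.univ_inter] at hb
    refine ⟨b - a, ?_⟩
    rw [← Set.sdiff_eq_compl_inter, ← Set.sdiff_inter_self_eq_sdiff,
      measure_sdiff Set.inter_subset_right (hA.inter hD).nullMeasurableSet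
        (ne_top_of_le_ne_top hD_finite.ne (measure_mono Set.inter_subset_right)), ha, hb,
      ENat.toENNReal_sub]
  | iUnion A hdisj hA ih =>
    rw [Set.iUnion_inter, measure_iUnion
      (fun i j hij => (hdisj hij).mono Set.inter_subset_left Set.inter_subset_left)
      (fun i => (hA i).inter hD)]
    exact exists_enat_eq_tsum ih

lemma isCountingMeasure_of_generateFrom {μ : Measure E} {𝒜 : Set (Set E)}
    (h𝒜 : IsSetAlgebra 𝒜) (hgen : ‹MeasurableSpace E› = MeasurableSpace.generateFrom 𝒜)
    {D : ℕ → Set E} (hD : ∀ n, MeasurableSet (D n)) (hD_disj : Pairwise (Function.onFun Disjoint D))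
    (hD_cover : ⋃ n, D n = Set.univ) (hD_finite : ∀ n, μ (D n) < ∞)
    (hμ : ∀ n, ∀ A ∈ 𝒜, ∃ m : ℕ∞, μ (A ∩ D n) = m) : IsCountingMeasure μ := by
  intro A hA
  have hsum : μ A = ∑' n, μ (A ∩ D n) := by
    rw [← measure_iUnion (fun i j hij => (hD_disj hij).mono Set.inter_subset_right
      Set.inter_subset_right) (fun n => hA.inter (hD n)), ← Set.inter_iUnion, hD_cover,
      Set.inter_univ]
  rw [hsum]
  exact exists_enat_eq_tsum fun n =>
    exists_enat_measure_inter_of_generateFrom h𝒜 hgen (hD n) (hD_finite n) (hμ n) hA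

lemma measurableSet_isCountingMeasure [MeasurableSpace.CountablyGenerated E] {M : Type*}
    [MeasurableSpace M] {X : M → Measure E} (hX : Measurable X)
    {D : ℕ → Set E} (hD : ∀ n, MeasurableSet (D n)) (hD_disj : Pairwise (Function.onFun Disjoint D))
    (hD_cover : ⋃ n, D n = Set.univ) (hD_finite : ∀ ω n, X ω (D n) < ∞) :
    MeasurableSet {ω | IsCountingMeasure (X ω)} := by
  let 𝒜 := generateSetAlgebra (MeasurableSpace.countableGeneratingSet E)
  have h𝒜 : IsSetAlgebra 𝒜 := isSetAlgebra_generateSetAlgebra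
  have hcount : 𝒜.Countable :=
    countable_generateSetAlgebra MeasurableSpace.countable_countableGeneratingSet
  have hgen : ‹MeasurableSpace E› = MeasurableSpace.generateFrom 𝒜 := by
    rw [generateFrom_generateSetAlgebra_eq, MeasurableSpace.generateFrom_countableGeneratingSet]
  have h𝒜_meas : ∀ A ∈ 𝒜, MeasurableSet A := fun A hA => by
    rw [hgen]
    exact MeasurableSpace.measurableSet_generateFrom hA
  have hiff : ∀ ω, IsCountingMeasure (X ω) ↔
      ∀ n, ∀ A ∈ 𝒜, X ω (A ∩ D n) ∈ Set.range ENat.toENNReal := by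
    simp only [Set.mem_range, eq_comm (b := X _ _)]
    exact fun ω => ⟨fun hω n A hA => hω _ ((h𝒜_meas A hA).inter (hD n)),
      isCountingMeasure_of_generateFrom h𝒜 hgen hD hD_disj hD_cover (hD_finite ω)⟩
  simp only [hiff, Set.ofPred_forall]
  exact MeasurableSet.iInter fun n => MeasurableSet.biInter hcount fun A hA =>
    (Measure.measurable_coe ((h𝒜_meas A hA).inter (hD n))).comp hX
      (Set.countable_range _).measurableSet

end Counting

/-! ### Construction of Poisson random measures -/

section PoissonConstruction

lemma integral_pow_poissonMeasure (c : ℝ≥0) (a : ℝ) :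
    ∫ j, a ^ j ∂(poissonMeasure c) = Real.exp (-(c * (1 - a))) := by
  have hterm : ∀ n : ℕ, (Real.exp (-c) * (c : ℝ) ^ n / n.factorial) • a ^ n =
      Real.exp (-c) * ((c * a) ^ n / n.factorial) := fun n => by
    rw [smul_eq_mul, mul_pow]
    ring
  have hexp : ∑' n : ℕ, ((c : ℝ) * a) ^ n / n.factorial = Real.exp (c * a) := by
    rw [Real.exp_eq_exp_ℝ, NormedSpace.exp_eq_tsum_div]
  rw [integral_poissonMeasure, tsum_congr hterm, tsum_mul_left, hexp, ← Real.exp_add]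
  ring_nf

lemma expNeg_mul_nat (c : ℝ≥0∞) (j : ℕ) : expNeg (c * j) = expNeg c ^ j := by
  induction j with
  | zero => simp [expNeg_zero]
  | succ j ih => rw [Nat.cast_succ, mul_add, mul_one, expNeg_add, ih, pow_succ]

variable {E : Type*} [MeasurableSpace E]

/-- The Laplace exponent `∫ (1 - exp (-f)) dm` of a Poisson random measure with mean `m`. -/
noncomputable def poissonExponent (m : Measure E) (f : E → ℝ≥0∞) : ℝ≥0∞ :=
  ∫⁻ x, ENNReal.ofReal (1 - expNeg (f x)) ∂m

/-- The counting measure of the first `n` points of a sequence. With a Poisson number of independent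
points it is a Poisson random measure. -/
noncomputable def pointSum (p : ℕ × (ℕ → E)) : Measure E :=
  ∑ i ∈ Finset.range p.1, Measure.dirac (p.2 i)

lemma isCountingMeasure_pointSum (p : ℕ × (ℕ → E)) : IsCountingMeasure (pointSum p) := by
  unfold pointSum
  induction p.1 with
  | zero => simpa using isCountingMeasure_zero
  | succ n ih =>
    rw [Finset.sum_range_succ]
    exact ih.add (isCountingMeasure_dirac _)

lemma lintegral_pointSum (p : ℕ × (ℕ → E)) {f : E → ℝ≥0∞} (hf : Measurable f) :
    ∫⁻ x, f x ∂(pointSum p) = ∑ i ∈ Finset.range p.1, f (p.2 i) := by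
  rw [pointSum, lintegral_finsetSum_measure]
  exact Finset.sum_congr rfl fun i _ => lintegral_dirac' _ hf

lemma measurable_pointSum : Measurable (pointSum : ℕ × (ℕ → E) → Measure E) := by
  refine Measure.measurable_of_measurable_coe _ fun A hA => ?_
  have happly : ∀ p : ℕ × (ℕ → E), pointSum p A =
      ∑ i ∈ Finset.range p.1, A.indicator (1 : E → ℝ≥0∞) (p.2 i) := fun p => by
    rw [← lintegral_pointSum p (measurable_one.indicator hA), lintegral_indicator_one hA]
  simp only [happly]
  refine measurable_from_prod_countable_right fun n => ?_
  change Measurable fun x : ℕ → E => ∑ i ∈ Finset.range n, A.indicator (1 : E → ℝ≥0∞) (x i)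
  refine Finset.measurable_fun_sum _ fun i _ => ?_
  exact (Measurable.indicator (f := (1 : E → ℝ≥0∞)) measurable_one hA).comp (measurable_pi_apply i)

lemma measurable_expNeg_lintegral {Ω : Type*} [MeasurableSpace Ω] {X : Ω → Measure E}
    (hX : Measurable X) {f : E → ℝ≥0∞} (hf : Measurable f) :
    Measurable fun ω => expNeg (∫⁻ x, f x ∂(X ω)) :=
  measurable_expNeg.comp ((Measure.measurable_lintegral hf).comp hX)

lemma integral_prod_infinitePi {Ω : ℕ → Type*} [∀ i, MeasurableSpace (Ω i)]
    (P : ∀ i, Measure (Ω i)) [∀ i, IsProbabilityMeasure (P i)] {g : ∀ i, Ω i → ℝ}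
    (hg : ∀ i, Measurable (g i)) (n : ℕ) :
    ∫ ω, ∏ i ∈ Finset.range n, g i (ω i) ∂(Measure.infinitePi P) =
      ∏ i ∈ Finset.range n, ∫ x, g i x ∂(P i) := by
  have hindep : iIndepFun (fun (i : Fin n) (ω : ∀ i, Ω i) => g i (ω i)) (Measure.infinitePi P) :=
    (iIndepFun_infinitePi (P := P) hg).precomp Fin.val_injective
  simp only [Finset.prod_range]
  rw [hindep.integral_fun_prod_eq_prod_integral fun i =>
    ((hg i).comp (measurable_pi_apply _)).aestronglyMeasurable]
  refine Finset.prod_congr rfl fun i _ => ?_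
  rw [← Measure.infinitePi_map_eval P i,
    integral_map (measurable_pi_apply _).aemeasurable (hg _).aestronglyMeasurable]

lemma integral_expNeg_lintegral_pointSum (m : Measure E) [IsProbabilityMeasure m] {f : E → ℝ≥0∞}
    (hf : Measurable f) (n : ℕ) :
    ∫ x, expNeg (∫⁻ z, f z ∂(pointSum (n, x))) ∂(Measure.infinitePi fun _ : ℕ => m) =
      (∫ x, expNeg (f x) ∂m) ^ n := by
  simp only [lintegral_pointSum _ hf, expNeg_sum]
  rw [integral_prod_infinitePi (fun _ : ℕ => m) (g := fun _ x => expNeg (f x))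
    fun _ => measurable_expNeg.comp hf]
  simp

lemma poissonExponent_smul (c : ℝ≥0) (m : Measure E) [IsProbabilityMeasure m] {f : E → ℝ≥0∞}
    (hf : Measurable f) :
    poissonExponent (c • m) f = ENNReal.ofReal (c * (1 - ∫ x, expNeg (f x) ∂m)) := by
  have hint : Integrable (fun x => expNeg (f x)) m := integrable_expNeg hf.aemeasurable
  have hint_sub : Integrable (fun x => 1 - expNeg (f x)) m := (integrable_const 1).sub hint
  have hsub : ∫ x, (1 - expNeg (f x)) ∂m = 1 - ∫ x, expNeg (f x) ∂m := by
    rw [integral_sub (integrable_const 1) hint]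
    simp
  rw [poissonExponent, lintegral_smul_measure, ENNReal.ofReal_mul (NNReal.coe_nonneg c),
    ENNReal.ofReal_coe_nnreal, ← hsub, ofReal_integral_eq_lintegral_ofReal
      hint_sub (.of_forall fun x => sub_nonneg.2 (expNeg_le_one _))]
  rfl

lemma laplaceFunctional_pointSum (c : ℝ≥0) (m : Measure E) [IsProbabilityMeasure m] {f : E → ℝ≥0∞}
    (hf : Measurable f) :
    laplaceFunctional ((poissonMeasure c).prod (Measure.infinitePi fun _ : ℕ => m)) pointSum f =
      expNeg (poissonExponent (c • m) f) := by
  have hle : ∫ x, expNeg (f x) ∂m ≤ 1 := by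
    simpa using integral_mono (integrable_expNeg hf.aemeasurable) (integrable_const (μ := m) 1)
      fun x => expNeg_le_one (f x)
  have hint : Integrable (fun p => expNeg (∫⁻ x, f x ∂(pointSum p)))
      ((poissonMeasure c).prod (Measure.infinitePi fun _ : ℕ => m)) :=
    integrable_expNeg_lintegral measurable_pointSum hf
  rw [laplaceFunctional, integral_prod _ hint]
  simp only [integral_expNeg_lintegral_pointSum m hf]
  rw [integral_pow_poissonMeasure, poissonExponent_smul c m hf,
    expNeg_ofReal (mul_nonneg (NNReal.coe_nonneg _) (sub_nonneg.2 hle))]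

lemma exists_laplaceFunctional_pointSum [Nonempty E] (m : Measure E) [IsFiniteMeasure m] :
    ∃ P : Measure (ℕ × (ℕ → E)), IsProbabilityMeasure P ∧ ∀ f : E → ℝ≥0∞, Measurable f →
      laplaceFunctional P pointSum f = expNeg (poissonExponent m f) := by
  let M : FiniteMeasure E := ⟨m, inferInstance⟩
  have hm : m = M.mass • (M.normalize : Measure E) :=
    congrArg Subtype.val M.self_eq_mass_smul_normalize
  refine ⟨(poissonMeasure M.mass).prod (Measure.infinitePi fun _ => M.normalize), inferInstance,
    fun f hf => ?_⟩
  rw [laplaceFunctional_pointSum _ _ hf, ← hm]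

lemma tendsto_prod_laplaceFunctional_infinitePi {Ω : ℕ → Type*} [∀ i, MeasurableSpace (Ω i)]
    (P : ∀ i, Measure (Ω i)) [∀ i, IsProbabilityMeasure (P i)] {X : ∀ i, Ω i → Measure E}
    (hX : ∀ i, Measurable (X i)) {f : E → ℝ≥0∞} (hf : Measurable f) :
    Tendsto (fun n => ∏ i ∈ Finset.range n, laplaceFunctional (P i) (X i) f) atTop
      (𝓝 (laplaceFunctional (Measure.infinitePi P) (fun ω => .sum fun i => X i (ω i)) f)) := by
  have hmeas := fun i => measurable_expNeg_lintegral (hX i) hf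
  simp only [laplaceFunctional, ← integral_prod_infinitePi P hmeas, lintegral_sum_measure]
  refine tendsto_integral_of_dominated_convergence (fun _ => 1) (fun n => ?_)
    (integrable_const _) (fun n => .of_forall fun ω => ?_) (.of_forall fun ω => ?_)
  · exact (Finset.measurable_fun_prod _ fun i _ =>
      (hmeas i).comp (measurable_pi_apply i)).aestronglyMeasurable
  · rw [← expNeg_sum]
    exact norm_expNeg_le_one _
  · simp only [← expNeg_sum]
    exact (continuous_expNeg.tendsto _).comp (ENNReal.tendsto_nat_tsum _)

/-- The superposition of countably many finite counting measures; it realizes Poisson random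
measures whose mean measure is an infinite sum of finite measures. -/
noncomputable def pointSuperposition (ω : ℕ → ℕ × (ℕ → E)) : Measure E :=
  Measure.sum fun i => pointSum (ω i)

lemma measurable_pointSuperposition :
    Measurable (pointSuperposition : (ℕ → ℕ × (ℕ → E)) → Measure E) := by
  refine Measure.measurable_of_measurable_coe _ fun A hA => ?_
  simp only [pointSuperposition, Measure.sum_apply _ hA]
  exact Measurable.tsum fun i =>
    (Measure.measurable_coe hA).comp (measurable_pointSum.comp (measurable_pi_apply i))

lemma isCountingMeasure_pointSuperposition (ω : ℕ → ℕ × (ℕ → E)) :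
    IsCountingMeasure (pointSuperposition ω) :=
  IsCountingMeasure.sum fun i => isCountingMeasure_pointSum (ω i)

lemma exists_laplaceFunctional_pointSuperposition [Nonempty E] (m : Measure E) [SFinite m] :
    ∃ P : Measure (ℕ → ℕ × (ℕ → E)), IsProbabilityMeasure P ∧ ∀ f : E → ℝ≥0∞, Measurable f →
      laplaceFunctional P pointSuperposition f = expNeg (poissonExponent m f) := by
  choose P hP hPf using fun i => exists_laplaceFunctional_pointSum (sfiniteSeq m i)
  refine ⟨Measure.infinitePi P, inferInstance, fun f hf => ?_⟩
  have hlim := tendsto_prod_laplaceFunctional_infinitePi P (fun _ => measurable_pointSum) hf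
  have hexponent : poissonExponent m f = ∑' i, poissonExponent (sfiniteSeq m i) f := by
    unfold poissonExponent
    rw [← lintegral_sum_measure, sum_sfiniteSeq]
  simp only [hPf _ f hf, ← expNeg_sum] at hlim
  refine tendsto_nhds_unique hlim ?_
  rw [hexponent]
  exact (continuous_expNeg.tendsto _).comp (ENNReal.tendsto_nat_tsum _)

end PoissonConstruction

/-! ### Laplace functionals of Poisson laws -/

section PoissonLaplace

lemma measure_ennreal_ext_of_integral_expNeg {P Q : Measure ℝ≥0∞} [IsProbabilityMeasure P]
    [IsProbabilityMeasure Q]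
    (h : ∀ n : ℕ, ∫ x, expNeg (n * x) ∂P = ∫ x, expNeg (n * x) ∂Q) : P = Q := by
  refine measure_ext_of_isInducing (y := fun x (_ : Unit) => x)
    (Homeomorph.funUnique Unit ℝ≥0∞).symm.isInducing dense_span_expMonomial ?_
  rintro _ ⟨l, rfl⟩
  have hlength : ∀ x, expMonomial l (fun _ : Unit => x) = expNeg (l.length * x) := fun x => by
    simp [expMonomial_apply]
  simpa only [hlength] using h l.length

lemma expMonomial_eq_prod (l : List ℕ) (x : ℕ → ℝ≥0∞) :
    expMonomial l x =
      ∏ i ∈ Finset.range (l.toFinset.sup id + 1), expNeg ((l.count i : ℝ≥0∞) * x i) := by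
  rw [expMonomial_apply, Finset.sum_list_map_count, ← expNeg_sum]
  simp only [nsmul_eq_mul]
  refine congrArg expNeg (Finset.sum_subset (fun i hi => ?_) fun i _ hi => ?_)
  · exact Finset.mem_range_succ_iff.2 (Finset.le_sup (f := id) hi)
  · rw [List.count_eq_zero_of_not_mem (by simpa using hi), Nat.cast_zero, zero_mul]

lemma measurable_expNeg_const_mul (c : ℝ≥0∞) : Measurable fun x : ℝ≥0∞ => expNeg (c * x) :=
  measurable_expNeg.comp (measurable_id.const_mul c)

lemma integral_expNeg_mul_map_poissonMeasure {a : ℝ≥0∞} (ha : a ≠ ∞) (c : ℝ≥0∞) :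
    ∫ x, expNeg (c * x) ∂((poissonMeasure a.toNNReal).map fun j : ℕ => (j : ℝ≥0∞)) =
      expNeg (ENNReal.ofReal (1 - expNeg c) * a) := by
  have hnonneg : 0 ≤ 1 - expNeg c := sub_nonneg.2 (expNeg_le_one _)
  have hmul : ENNReal.ofReal (1 - expNeg c) * a =
      ENNReal.ofReal (a.toNNReal * (1 - expNeg c)) := by
    rw [ENNReal.ofReal_mul (NNReal.coe_nonneg _), ENNReal.ofReal_coe_nnreal,
      ENNReal.coe_toNNReal ha, mul_comm]
  rw [integral_map measurable_from_nat.aemeasurable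
    (measurable_expNeg_const_mul c).aestronglyMeasurable]
  simp only [expNeg_mul_nat]
  rw [integral_pow_poissonMeasure, hmul, expNeg_ofReal (mul_nonneg (NNReal.coe_nonneg _) hnonneg)]

section DisjointSum

variable {E ι : Type*} (s : Finset ι) {A : ι → Set E} (c : ι → ℝ≥0∞)

lemma one_sub_expNeg_sum_indicator (hA_disj : Pairwise (Function.onFun Disjoint A)) (x : E) :
    ENNReal.ofReal (1 - expNeg (∑ i ∈ s, (A i).indicator (fun _ => c i) x)) =
      ∑ i ∈ s, (A i).indicator (fun _ => ENNReal.ofReal (1 - expNeg (c i))) x := by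
  by_cases hx : ∃ i ∈ s, x ∈ A i
  · obtain ⟨i, hi, hxi⟩ := hx
    have hne : ∀ j, j ≠ i → x ∉ A j := fun j hj hxj =>
      Set.disjoint_left.1 (hA_disj hj) hxj hxi
    rw [Finset.sum_eq_single_of_mem i hi fun j _ hj => Set.indicator_of_notMem (hne j hj) _,
      Finset.sum_eq_single_of_mem i hi fun j _ hj => Set.indicator_of_notMem (hne j hj) _,
      Set.indicator_of_mem hxi, Set.indicator_of_mem hxi]
  · push Not at hx
    rw [Finset.sum_eq_zero fun i hi => Set.indicator_of_notMem (hx i hi) _,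
      Finset.sum_eq_zero fun i hi => Set.indicator_of_notMem (hx i hi) _]
    simp [expNeg_zero]

variable [MeasurableSpace E]

lemma lintegral_sum_indicator (hA : ∀ i, MeasurableSet (A i)) (μ : Measure E) :
    ∫⁻ x, ∑ i ∈ s, (A i).indicator (fun _ => c i) x ∂μ = ∑ i ∈ s, c i * μ (A i) := by
  rw [lintegral_finsetSum _ fun i _ => measurable_const.indicator (hA i)]
  exact Finset.sum_congr rfl fun i _ => lintegral_indicator_const (hA i) (c i)

lemma poissonExponent_sum_indicator (hA : ∀ i, MeasurableSet (A i))
    (hA_disj : Pairwise (Function.onFun Disjoint A)) (m : Measure E) :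
    poissonExponent m (fun x => ∑ i ∈ s, (A i).indicator (fun _ => c i) x) =
      ∑ i ∈ s, ENNReal.ofReal (1 - expNeg (c i)) * m (A i) := by
  simp only [poissonExponent, one_sub_expNeg_sum_indicator s c hA_disj]
  exact lintegral_sum_indicator s _ hA m

lemma laplaceFunctional_sum_indicator {Ω : Type*} [MeasurableSpace Ω] (P : Measure Ω)
    (X : Ω → Measure E) (hA : ∀ i, MeasurableSet (A i)) :
    laplaceFunctional P X (fun x => ∑ i ∈ s, (A i).indicator (fun _ => c i) x) =
      ∫ ω, ∏ i ∈ s, expNeg (c i * X ω (A i)) ∂P := by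
  simp only [laplaceFunctional, lintegral_sum_indicator s c hA, expNeg_sum]

end DisjointSum

variable {E : Type*} [MeasurableSpace E]

section Monotone

variable {f : E → ℝ≥0∞} {g : ℕ → E → ℝ≥0∞}

lemma tendsto_poissonExponent_of_monotone (m : Measure E) (hg : ∀ n, Measurable (g n))
    (hg_mono : ∀ x, Monotone fun n => g n x)
    (hg_lim : ∀ x, Tendsto (fun n => g n x) atTop (𝓝 (f x))) :
    Tendsto (fun n => poissonExponent m (g n)) atTop (𝓝 (poissonExponent m f)) := by
  refine lintegral_tendsto_of_tendsto_of_monotone (fun n => ?_) (.of_forall fun x i j hij => ?_)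
    (.of_forall fun x => ?_)
  · exact (measurable_const.sub (measurable_expNeg.comp (hg n))).ennreal_ofReal.aemeasurable
  · exact ENNReal.ofReal_le_ofReal (sub_le_sub_left (expNeg_antitone (hg_mono x hij)) _)
  · exact (ENNReal.continuous_ofReal.tendsto _).comp
      (((continuous_expNeg.tendsto _).comp (hg_lim x)).const_sub 1)

variable {Ω : Type*} [MeasurableSpace Ω] {X : Ω → Measure E}

lemma tendsto_laplaceFunctional_of_monotone (P : Measure Ω) [IsFiniteMeasure P] (hX : Measurable X)
    (hg : ∀ n, Measurable (g n)) (hg_mono : ∀ x, Monotone fun n => g n x)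
    (hg_lim : ∀ x, Tendsto (fun n => g n x) atTop (𝓝 (f x))) :
    Tendsto (fun n => laplaceFunctional P X (g n)) atTop (𝓝 (laplaceFunctional P X f)) := by
  refine tendsto_integral_of_dominated_convergence (fun _ => 1) (fun n => ?_)
    (integrable_const _) (fun n => .of_forall fun _ => norm_expNeg_le_one _)
    (.of_forall fun ω => ?_)
  · exact (measurable_expNeg_lintegral hX (hg n)).aestronglyMeasurable
  · exact (continuous_expNeg.tendsto _).comp (lintegral_tendsto_of_tendsto_of_monotone
      (fun n => (hg n).aemeasurable) (.of_forall hg_mono) (.of_forall hg_lim))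

end Monotone

lemma exists_monotone_finMeasSupp_tendsto (m : Measure E) [SigmaFinite m] {f : E → ℝ≥0∞}
    (hf : Measurable f) : ∃ g : ℕ → SimpleFunc E ℝ≥0∞, (∀ n, (g n).FinMeasSupp m) ∧
      (∀ x, Monotone fun n => g n x) ∧ ∀ x, Tendsto (fun n => g n x) atTop (𝓝 (f x)) := by
  let B := spanningSets m
  let g : ℕ → SimpleFunc E ℝ≥0∞ := fun n => (SimpleFunc.eapprox f n).restrict (B n)
  have hg_apply : ∀ n x, g n x = (B n).indicator (SimpleFunc.eapprox f n) x := fun n x =>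
    SimpleFunc.restrict_apply _ (measurableSet_spanningSets m n) x
  refine ⟨g, fun n => SimpleFunc.finMeasSupp_iff.2 fun c hc => ?_, fun x i j hij => ?_, fun x => ?_⟩
  · refine (measure_mono fun x hx => ?_).trans_lt (measure_spanningSets_lt_top m n)
    by_contra hxB
    exact hc (((hg_apply n x).trans (Set.indicator_of_notMem hxB _)).symm.trans hx).symm
  · simp only [hg_apply]
    by_cases hx : x ∈ B i
    · rw [Set.indicator_of_mem hx, Set.indicator_of_mem (monotone_spanningSets m hij hx)]
      exact SimpleFunc.monotone_eapprox f hij x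
    · rw [Set.indicator_of_notMem hx]
      exact zero_le
  · refine (SimpleFunc.tendsto_eapprox hf x).congr' ?_
    filter_upwards [eventually_ge_atTop (spanningSetsIndex m x)] with n hn
    rw [hg_apply, Set.indicator_of_mem (mem_spanningSets_of_index_le m x hn)]

variable {Ω : Type*} [MeasurableSpace Ω] {P : Measure Ω} {X : Ω → Measure E} {m : Measure E}

lemma iIndepFun_apply_of_countable
    (hX_indep : ∀ A : ℕ → Set E, (∀ i, MeasurableSet (A i)) →
      Pairwise (fun i j => Disjoint (A i) (A j)) → iIndepFun (fun i ω => X ω (A i)) P)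
    {ι : Type*} [Countable ι] {A : ι → Set E} (hA : ∀ i, MeasurableSet (A i))
    (hA_disj : Pairwise (Function.onFun Disjoint A)) : iIndepFun (fun i ω => X ω (A i)) P := by
  obtain ⟨e, he⟩ := exists_injective_nat ι
  let B : ℕ → Set E := fun j => ⋃ (i) (_ : e i = j), A i
  have hB : ∀ i, B (e i) = A i := fun i => by simp [B, he.eq_iff]
  have hB_disj : Pairwise fun j k => Disjoint (B j) (B k) := fun j k hjk => by
    simp only [B, Set.disjoint_iUnion_left, Set.disjoint_iUnion_right]
    rintro i rfl i' rfl
    exact hA_disj fun hi => hjk (congrArg e hi)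
  simpa only [hB] using (hX_indep B (fun j => .iUnion fun i => .iUnion fun _ => hA i)
    hB_disj).precomp he

section OfPoisson

variable [IsProbabilityMeasure P] (hX : Measurable X)
  (hX_poisson : ∀ A, MeasurableSet A → m A < ∞ →
    P.map (fun ω => X ω A) = (poissonMeasure (m A).toNNReal).map fun j : ℕ => (j : ℝ≥0∞))
  (hX_indep : ∀ A : ℕ → Set E, (∀ i, MeasurableSet (A i)) →
    Pairwise (fun i j => Disjoint (A i) (A j)) → iIndepFun (fun i ω => X ω (A i)) P)

include hX hX_poisson in
lemma integral_expNeg_mul_apply_of_poisson {A : Set E} (hA : MeasurableSet A) {c : ℝ≥0∞}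
    (hc : c ≠ 0 → m A < ∞) :
    ∫ ω, expNeg (c * X ω A) ∂P = expNeg (ENNReal.ofReal (1 - expNeg c) * m A) := by
  rcases eq_or_ne c 0 with rfl | hc_ne
  · simp [expNeg_zero]
  · have hXA : Measurable fun ω => X ω A := (Measure.measurable_coe hA).comp hX
    rw [← integral_expNeg_mul_map_poissonMeasure (hc hc_ne).ne c, ← hX_poisson A hA (hc hc_ne),
      integral_map hXA.aemeasurable (measurable_expNeg_const_mul c).aestronglyMeasurable]

include hX hX_poisson hX_indep

lemma laplaceFunctional_simpleFunc_of_poisson {g : SimpleFunc E ℝ≥0∞} (hg : g.FinMeasSupp m) :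
    laplaceFunctional P X g = expNeg (poissonExponent m g) := by
  let A : g.range → Set E := fun c => g ⁻¹' {(c : ℝ≥0∞)}
  have hA : ∀ c, MeasurableSet (A c) := fun c => g.measurableSet_fiber c
  have hA_disj : Pairwise (Function.onFun Disjoint A) := fun c d hcd =>
    Disjoint.preimage g (Set.disjoint_singleton.2 (Subtype.coe_ne_coe.2 hcd))
  have hg_sum : (g : E → ℝ≥0∞) =
      fun x => ∑ c : g.range, (A c).indicator (fun _ => (c : ℝ≥0∞)) x := by
    funext x
    let d : g.range := ⟨g x, g.mem_range_self x⟩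
    have hmem : x ∈ A d := rfl
    have hnotMem : ∀ c, c ≠ d → x ∉ A c := fun c hc hx => hc (Subtype.ext hx.symm)
    rw [Finset.sum_eq_single_of_mem d (Finset.mem_univ _)
      fun c _ hc => Set.indicator_of_notMem (hnotMem c hc) _, Set.indicator_of_mem hmem]
  have hindep : iIndepFun (fun (c : g.range) ω => expNeg (c * X ω (A c))) P :=
    (iIndepFun_apply_of_countable hX_indep hA hA_disj).comp (fun c x => expNeg (c * x))
      fun c => measurable_expNeg_const_mul c
  rw [hg_sum,
    laplaceFunctional_sum_indicator Finset.univ (fun c : g.range => (c : ℝ≥0∞)) P X hA,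
    poissonExponent_sum_indicator Finset.univ (fun c : g.range => (c : ℝ≥0∞)) hA hA_disj,
    expNeg_sum, hindep.integral_fun_prod_eq_prod_integral fun c =>
      ((measurable_expNeg_const_mul _).comp
        ((Measure.measurable_coe (hA c)).comp hX)).aestronglyMeasurable]
  exact Finset.prod_congr rfl fun c _ => integral_expNeg_mul_apply_of_poisson hX hX_poisson (hA c)
    fun hc => SimpleFunc.finMeasSupp_iff.1 hg _ hc

lemma laplaceFunctional_of_poisson [SigmaFinite m] {f : E → ℝ≥0∞} (hf : Measurable f) :
    laplaceFunctional P X f = expNeg (poissonExponent m f) := by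
  obtain ⟨g, hg, hg_mono, hg_lim⟩ := exists_monotone_finMeasSupp_tendsto m hf
  have hlim := tendsto_laplaceFunctional_of_monotone P hX (fun n => (g n).measurable) hg_mono hg_lim
  simp only [fun n => laplaceFunctional_simpleFunc_of_poisson hX hX_poisson hX_indep (hg n)] at hlim
  exact tendsto_nhds_unique hlim ((continuous_expNeg.tendsto _).comp
    (tendsto_poissonExponent_of_monotone m (fun n => (g n).measurable) hg_mono hg_lim))

end OfPoisson

section OfLaplace

variable (hX : Measurable X)
  (hX_laplace : ∀ f : E → ℝ≥0∞, Measurable f →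
    laplaceFunctional P X f = expNeg (poissonExponent m f))

include hX_laplace

lemma integral_prod_expNeg_mul_apply_of_laplace {ι : Type*} (s : Finset ι) {A : ι → Set E}
    (hA : ∀ i, MeasurableSet (A i)) (hA_disj : Pairwise (Function.onFun Disjoint A))
    (c : ι → ℝ≥0∞) :
    ∫ ω, ∏ i ∈ s, expNeg (c i * X ω (A i)) ∂P =
      ∏ i ∈ s, expNeg (ENNReal.ofReal (1 - expNeg (c i)) * m (A i)) := by
  rw [← laplaceFunctional_sum_indicator s c P X hA, hX_laplace _
    (Finset.measurable_fun_sum _ fun i _ => measurable_const.indicator (hA i)),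
    poissonExponent_sum_indicator s c hA hA_disj, expNeg_sum]

lemma integral_expNeg_mul_apply_of_laplace {A : Set E} (hA : MeasurableSet A) (c : ℝ≥0∞) :
    ∫ ω, expNeg (c * X ω A) ∂P = expNeg (ENNReal.ofReal (1 - expNeg c) * m A) := by
  simpa using integral_prod_expNeg_mul_apply_of_laplace hX_laplace {()} (fun _ => hA)
    Subsingleton.pairwise fun _ => c

include hX

variable [IsProbabilityMeasure P]

lemma map_apply_eq_poisson_of_laplace {A : Set E} (hA : MeasurableSet A) (hA_lt_top : m A < ∞) :
    P.map (fun ω => X ω A) = (poissonMeasure (m A).toNNReal).map fun j : ℕ => (j : ℝ≥0∞) := by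
  have hXA : Measurable fun ω => X ω A := (Measure.measurable_coe hA).comp hX
  have := Measure.isProbabilityMeasure_map (μ := P) hXA.aemeasurable
  have := Measure.isProbabilityMeasure_map (μ := poissonMeasure (m A).toNNReal)
    (measurable_from_nat (f := fun j : ℕ => (j : ℝ≥0∞))).aemeasurable
  refine measure_ennreal_ext_of_integral_expNeg fun n => ?_
  rw [integral_map hXA.aemeasurable (measurable_expNeg_const_mul _).aestronglyMeasurable,
    integral_expNeg_mul_apply_of_laplace hX_laplace hA,
    integral_expNeg_mul_map_poissonMeasure hA_lt_top.ne]

lemma iIndepFun_apply_of_laplace {A : ℕ → Set E} (hA : ∀ i, MeasurableSet (A i))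
    (hA_disj : Pairwise (Function.onFun Disjoint A)) : iIndepFun (fun i ω => X ω (A i)) P := by
  have hXA : ∀ i, Measurable fun ω => X ω (A i) := fun i => (Measure.measurable_coe (hA i)).comp hX
  have hXA_pi : Measurable fun ω i => X ω (A i) := measurable_pi_lambda _ hXA
  have := Measure.isProbabilityMeasure_map (μ := P) hXA_pi.aemeasurable
  have := fun i => Measure.isProbabilityMeasure_map (μ := P) (hXA i).aemeasurable
  rw [iIndepFun_iff_map_fun_eq_infinitePi_map hXA]
  refine measure_ext_of_isInducing .id dense_span_expMonomial ?_
  rintro _ ⟨l, rfl⟩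
  simp only [id_eq]
  rw [integral_map hXA_pi.aemeasurable (expMonomial l).continuous.measurable.aestronglyMeasurable]
  simp only [expMonomial_eq_prod]
  rw [integral_prod_expNeg_mul_apply_of_laplace hX_laplace _ hA hA_disj,
    integral_prod_infinitePi (fun i => P.map fun ω => X ω (A i))
      fun i => measurable_expNeg_const_mul _]
  refine Finset.prod_congr rfl fun i _ => ?_
  rw [integral_map (hXA i).aemeasurable (measurable_expNeg_const_mul _).aestronglyMeasurable,
    integral_expNeg_mul_apply_of_laplace hX_laplace (hA i)]

end OfLaplace

section LevelMeasures

variable {S : Type*} [TopologicalSpace S] [MeasurableSpace S] [BorelSpace S]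
  [TopologicalSpace.MetrizableSpace S] {h : ℕ → S →ᵇ ℝ}
  {ρ : Measure (LevelMeasures h)} {m : Measure (S × ℝ≥0)}

lemma IsPoissonLaw.laplaceFunctional_eq (h_nonneg : ∀ k x, 0 ≤ h k x)
    (h_cover : ∀ x, ∃ k, 0 < h k x) [SigmaFinite m] (hρ : IsPoissonLaw ρ m)
    {f : S × ℝ≥0 → ℝ≥0∞} (hf : Measurable f) :
    laplaceFunctional ρ (fun μ => μ.1) f = expNeg (poissonExponent m f) :=
  have := hρ.isProbabilityMeasure
  laplaceFunctional_of_poisson (LevelMeasures.measurable_val h_nonneg h_cover) hρ.poisson hρ.indep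
    hf

lemma isPoissonLaw_of_laplace (h_nonneg : ∀ k x, 0 ≤ h k x)
    (h_cover : ∀ x, ∃ k, 0 < h k x) [IsProbabilityMeasure ρ]
    (hρ_count : ∀ᵐ μ ∂ρ, IsCountingMeasure μ.1)
    (hρ_laplace : ∀ f : S × ℝ≥0 → ℝ≥0∞, Measurable f →
      laplaceFunctional ρ (fun μ => μ.1) f = expNeg (poissonExponent m f)) :
    IsPoissonLaw ρ m :=
  have hmeas := LevelMeasures.measurable_val h_nonneg h_cover
  ⟨inferInstance, hρ_count,
    fun _ hA hA_lt_top => map_apply_eq_poisson_of_laplace hmeas hρ_laplace hA hA_lt_top,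
    fun _ hA hA_disj => iIndepFun_apply_of_laplace hmeas hρ_laplace hA hA_disj⟩

end LevelMeasures

end PoissonLaplace

/-! ### Existence of Poisson laws and of the Cox kernel -/

section PoissonKernel

lemma ofReal_one_sub_expNeg_le (a : ℝ≥0∞) : ENNReal.ofReal (1 - expNeg a) ≤ a := by
  rcases eq_or_ne a ∞ with rfl | ha
  · exact le_top
  · rw [expNeg_of_ne_top ha]
    exact (ENNReal.ofReal_le_ofReal (one_sub_exp_neg_le _)).trans (ENNReal.ofReal_toReal ha).le

section FiniteIntegral

variable {E Ω : Type*} [MeasurableSpace E] [MeasurableSpace Ω] {P : Measure Ω}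
  {X : Ω → Measure E} {f : E → ℝ≥0∞}

lemma poissonExponent_le_lintegral (m : Measure E) (f : E → ℝ≥0∞) :
    poissonExponent m f ≤ ∫⁻ x, f x ∂m :=
  lintegral_mono fun x => ofReal_one_sub_expNeg_le (f x)

lemma laplaceFunctional_const_mul_le_measureReal [IsFiniteMeasure P] (hX : Measurable X)
    (hf : Measurable f) {t : ℝ≥0∞} (ht : t ≠ 0) :
    laplaceFunctional P X (fun x => t * f x) ≤ P.real {ω | ∫⁻ x, f x ∂(X ω) < ∞} := by
  have hfinite : MeasurableSet {ω | ∫⁻ x, f x ∂(X ω) < ∞} :=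
    measurableSet_lt ((Measure.measurable_lintegral hf).comp hX) measurable_const
  rw [laplaceFunctional, ← integral_indicator_one hfinite]
  refine integral_mono (integrable_expNeg_lintegral hX (hf.const_mul t))
    ((integrable_const 1).indicator hfinite) fun ω => ?_
  by_cases hω : ω ∈ {ω | ∫⁻ x, f x ∂(X ω) < ∞}
  · rw [Set.indicator_of_mem hω]
    exact expNeg_le_one _
  · have htop : ∫⁻ x, f x ∂(X ω) = ∞ := not_lt_top_iff.1 hω
    rw [Set.indicator_of_notMem hω, lintegral_const_mul t hf, htop, ENNReal.mul_top ht, expNeg_top]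

lemma tendsto_expNeg_inv_mul {a : ℝ≥0∞} (ha : a ≠ ∞) :
    Tendsto (fun n : ℕ => expNeg ((n : ℝ≥0∞)⁻¹ * a)) atTop (𝓝 1) := by
  rw [← expNeg_zero]
  refine (continuous_expNeg.tendsto _).comp ?_
  simpa using ENNReal.Tendsto.mul_const ENNReal.tendsto_inv_nat_nhds_zero (.inr ha)

lemma ae_lintegral_lt_top_of_laplace [IsProbabilityMeasure P] (hX : Measurable X) {m : Measure E}
    (hX_laplace : ∀ f : E → ℝ≥0∞, Measurable f →
      laplaceFunctional P X f = expNeg (poissonExponent m f))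
    (hf : Measurable f) (hf_lt_top : ∫⁻ x, f x ∂m < ∞) : ∀ᵐ ω ∂P, ∫⁻ x, f x ∂(X ω) < ∞ := by
  have hbound : ∀ n : ℕ, expNeg ((n : ℝ≥0∞)⁻¹ * ∫⁻ x, f x ∂m) ≤
      P.real {ω | ∫⁻ x, f x ∂(X ω) < ∞} := fun n => by
    refine le_trans ?_ (laplaceFunctional_const_mul_le_measureReal hX hf
      (ENNReal.inv_ne_zero.2 (ENNReal.natCast_ne_top n)))
    rw [hX_laplace _ (hf.const_mul _), ← lintegral_const_mul _ hf]
    exact expNeg_antitone (poissonExponent_le_lintegral m _)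
  have hone : P.real {ω | ∫⁻ x, f x ∂(X ω) < ∞} = 1 :=
    le_antisymm measureReal_le_one (le_of_tendsto' (tendsto_expNeg_inv_mul hf_lt_top.ne) hbound)
  have hfinite : MeasurableSet {ω | ∫⁻ x, f x ∂(X ω) < ∞} :=
    measurableSet_lt ((Measure.measurable_lintegral hf).comp hX) measurable_const
  exact (prob_compl_eq_zero_iff hfinite).2 ((ENNReal.toReal_eq_one_iff _).1 hone)

end FiniteIntegral

universe v in
lemma exists_poissonRandomMeasure {E : Type v} [MeasurableSpace E] (m : Measure E) [SFinite m] :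
    ∃ (Ω : Type v) (_ : MeasurableSpace Ω) (P : Measure Ω) (X : Ω → Measure E),
      IsProbabilityMeasure P ∧ Measurable X ∧ (∀ ω, IsCountingMeasure (X ω)) ∧
        ∀ f : E → ℝ≥0∞, Measurable f → laplaceFunctional P X f = expNeg (poissonExponent m f) := by
  rcases isEmpty_or_nonempty E with _ | _
  · refine ⟨PUnit, inferInstance, .dirac PUnit.unit, fun _ => 0, inferInstance, measurable_const,
      fun _ => isCountingMeasure_zero, fun f _ => ?_⟩
    simp [laplaceFunctional, poissonExponent, Measure.eq_zero_of_isEmpty m]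
  · obtain ⟨P, hP, hP_laplace⟩ := exists_laplaceFunctional_pointSuperposition m
    exact ⟨_, _, P, pointSuperposition, hP, measurable_pointSuperposition,
      isCountingMeasure_pointSuperposition, hP_laplace⟩

variable {S : Type*} [TopologicalSpace S] [MeasurableSpace S] {h : ℕ → S →ᵇ ℝ}

section OpensMeasurable

variable [OpensMeasurableSpace S]

lemma measurable_setLIntegral_weight (h : ℕ → S →ᵇ ℝ) (k : ℕ) (K : ℝ≥0) :
    Measurable fun μ : Measure (S × ℝ≥0) =>
      ∫⁻ z in {z : S × ℝ≥0 | z.2 ≤ K}, ENNReal.ofReal (h k z.1) ∂μ := by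
  have hlevel : MeasurableSet {z : S × ℝ≥0 | z.2 ≤ K} :=
    measurableSet_le measurable_snd measurable_const
  simp only [← lintegral_indicator hlevel]
  exact Measure.measurable_lintegral
    (((measurable_weight h k).comp measurable_fst).indicator hlevel)

lemma lintegral_prod_halfLine_lt_top (ν : LocationMeasures h) [SFinite ν.1] (k : ℕ) (K : ℝ≥0) :
    ∫⁻ z in {z : S × ℝ≥0 | z.2 ≤ K}, ENNReal.ofReal (h k z.1)
      ∂(ν.1.prod halfLineLebesgue) < ∞ := by
  have hlevel : {z : S × ℝ≥0 | z.2 ≤ K} = Set.univ ×ˢ Set.Iic K := by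
    ext z
    simp
  have hweight : Measurable fun z : S × ℝ≥0 => ENNReal.ofReal (h k z.1) :=
    (measurable_weight h k).comp measurable_fst
  rw [hlevel, ← Measure.prod_restrict, Measure.restrict_univ, lintegral_prod _ hweight.aemeasurable]
  simp only [lintegral_const, Measure.restrict_apply MeasurableSet.univ, Set.univ_inter,
    halfLineLebesgue_Iic]
  rw [lintegral_mul_const _ (measurable_weight h k)]
  exact ENNReal.mul_lt_top (ν.2 k) ENNReal.coe_lt_top

end OpensMeasurable

lemma poissonExponent_prod_halfLine {E : Type*} [MeasurableSpace E] (ν : Measure E)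
    {f : E × ℝ≥0 → ℝ} (hf : Measurable f) (hf_nonneg : ∀ z, 0 ≤ f z) :
    poissonExponent (ν.prod halfLineLebesgue) (fun z => ENNReal.ofReal (f z)) =
      ∫⁻ x, levelExponent f x ∂ν := by
  simp only [poissonExponent, levelExponent, expNeg_ofReal (hf_nonneg _)]
  rw [lintegral_prod _ (by fun_prop)]

variable [BorelSpace S] [TopologicalSpace.MetrizableSpace S]

namespace LevelMeasures

lemma measurableSet_isCountingMeasure [SecondCountableTopology S] (h_nonneg : ∀ k x, 0 ≤ h k x)
    (h_cover : ∀ x, ∃ k, 0 < h k x) :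
    MeasurableSet {μ : LevelMeasures h | IsCountingMeasure μ.1} := by
  obtain ⟨D, hD, hD_disj, hD_cover, hD_finite⟩ :=
    exists_measurable_partition_finite (levelWeights_cover h_cover)
  exact _root_.measurableSet_isCountingMeasure (measurable_val h_nonneg h_cover)
    hD hD_disj hD_cover fun μ n => hD_finite (μ.toWeighted h_nonneg) n

lemma exists_measurable_ae_eq [SecondCountableTopology S] (h_nonneg : ∀ k x, 0 ≤ h k x) {Ω : Type*}
    [MeasurableSpace Ω] {P : Measure Ω} {X : Ω → Measure (S × ℝ≥0)} (hX : Measurable X)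
    (hX_finite : ∀ (k : ℕ) (K : ℝ≥0), ∀ᵐ ω ∂P,
      ∫⁻ z in {z : S × ℝ≥0 | z.2 ≤ K}, ENNReal.ofReal (h k z.1) ∂(X ω) < ∞) :
    ∃ Z : Ω → LevelMeasures h, Measurable Z ∧ (∀ ω, (Z ω).1 = X ω ∨ (Z ω).1 = 0) ∧
      ∀ᵐ ω ∂P, (Z ω).1 = X ω := by
  classical
  let I : ℕ → ℝ≥0 → Ω → ℝ≥0∞ := fun k K ω =>
    ∫⁻ z in {z : S × ℝ≥0 | z.2 ≤ K}, ENNReal.ofReal (h k z.1) ∂(X ω)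
  let G : Set Ω := ⋂ (k : ℕ) (K : ℕ), {ω | I k K ω < ∞}
  have hG : MeasurableSet G := .iInter fun k => .iInter fun K =>
    measurableSet_lt ((measurable_setLIntegral_weight h k K).comp hX) measurable_const
  have hG_finite : ∀ ω ∈ G, ∀ k K, I k K ω < ∞ := fun ω hω k K => by
    obtain ⟨N, hN⟩ := exists_nat_ge K
    exact (lintegral_mono_set fun z hz => le_trans hz hN).trans_lt (Set.mem_iInter₂.1 hω k N)
  let Z : Ω → LevelMeasures h := fun ω =>
    if hω : ω ∈ G then ⟨X ω, hG_finite ω hω⟩ else ⟨0, by simp⟩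
  have hZ_val : ∀ ω, (Z ω).1 = if ω ∈ G then X ω else 0 := fun ω => by
    by_cases hω : ω ∈ G
    · have hZω : Z ω = ⟨X ω, hG_finite ω hω⟩ := dif_pos hω
      rw [hZω, if_pos hω]
    · have hZω : Z ω = ⟨0, by simp⟩ := dif_neg hω
      rw [hZω, if_neg hω]
  refine ⟨Z, (isTestInduced h_nonneg).measurable ?_, fun ω => ?_, ?_⟩
  · simp only [hZ_val]
    exact Measurable.ite hG hX measurable_const
  · rw [hZ_val]
    split_ifs <;> simp
  · filter_upwards [ae_all_iff.2 fun k => ae_all_iff.2 fun K : ℕ => hX_finite k K] with ω hω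
    rw [hZ_val, if_pos (Set.mem_iInter₂.2 hω)]

end LevelMeasures

lemma laplaceFunctional_bind {A B E : Type*} [MeasurableSpace A] [MeasurableSpace B]
    [MeasurableSpace E] (P : Measure A) [IsProbabilityMeasure P] (κ : Kernel A B)
    [IsMarkovKernel κ] {X : B → Measure E} (hX : Measurable X) {f : E → ℝ≥0∞} (hf : Measurable f) :
    laplaceFunctional (P.bind κ) X f = ∫ a, laplaceFunctional (κ a) X f ∂P := by
  have hX_expNeg := measurable_expNeg_lintegral hX hf
  rw [laplaceFunctional, ← Measure.snd_compProd, Measure.snd,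
    integral_map measurable_snd.aemeasurable hX_expNeg.aestronglyMeasurable]
  exact Measure.integral_compProd (.of_bound (hX_expNeg.comp measurable_snd).aestronglyMeasurable 1
    (.of_forall fun _ => norm_expNeg_le_one _))

lemma IsConditionallyPoisson.laplaceFunctional_eq (h_nonneg : ∀ k x, 0 ≤ h k x)
    (h_cover : ∀ x, ∃ k, 0 < h k x) {Q : Measure (LevelMeasures h)}
    {P : Measure (LocationMeasures h)} [IsProbabilityMeasure P] (hQ : IsConditionallyPoisson Q P)
    {f : S × ℝ≥0 → ℝ} (hf : Measurable f) (hf_nonneg : ∀ z, 0 ≤ f z) :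
    laplaceFunctional Q (fun μ => μ.1) (fun z => ENNReal.ofReal (f z)) =
      laplaceFunctional P (fun ν => ν.1) (levelExponent f) := by
  obtain ⟨κ, hκ, hκ_poisson, rfl⟩ := hQ
  rw [laplaceFunctional_bind P κ (LevelMeasures.measurable_val h_nonneg h_cover) hf.ennreal_ofReal]
  refine integral_congr_ae ?_
  filter_upwards [hκ_poisson] with ν hν
  have := LocationMeasures.sigmaFinite h_cover ν
  rw [hν.laplaceFunctional_eq h_nonneg h_cover hf.ennreal_ofReal,
    poissonExponent_prod_halfLine ν.1 hf hf_nonneg]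

variable [SecondCountableTopology S]

lemma exists_isPoissonLaw (h_nonneg : ∀ k x, 0 ≤ h k x) (h_cover : ∀ x, ∃ k, 0 < h k x)
    (m : Measure (S × ℝ≥0)) [SFinite m] (hm : ∀ (k : ℕ) (K : ℝ≥0),
      ∫⁻ z in {z : S × ℝ≥0 | z.2 ≤ K}, ENNReal.ofReal (h k z.1) ∂m < ∞) :
    ∃ ρ : Measure (LevelMeasures h), IsPoissonLaw ρ m := by
  obtain ⟨Ω, _, P, X, hP, hX, hX_count, hX_laplace⟩ := exists_poissonRandomMeasure m
  obtain ⟨Z, hZ, hZ_val, hZ_ae⟩ := LevelMeasures.exists_measurable_ae_eq h_nonneg (P := P) hX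
    fun k K => by
      have hlevel : MeasurableSet {z : S × ℝ≥0 | z.2 ≤ K} :=
        measurableSet_le measurable_snd measurable_const
      simp only [← lintegral_indicator hlevel]
      refine ae_lintegral_lt_top_of_laplace hX hX_laplace
        (((measurable_weight h k).comp measurable_fst).indicator hlevel) ?_
      rw [lintegral_indicator hlevel]
      exact hm k K
  have := Measure.isProbabilityMeasure_map (μ := P) hZ.aemeasurable
  refine ⟨P.map Z, isPoissonLaw_of_laplace h_nonneg h_cover ?_ fun f hf => ?_⟩
  · rw [ae_map_iff hZ.aemeasurable
      (LevelMeasures.measurableSet_isCountingMeasure h_nonneg h_cover)]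
    refine .of_forall fun ω => ?_
    rcases hZ_val ω with hω | hω <;> rw [hω]
    exacts [hX_count ω, isCountingMeasure_zero]
  · rw [← hX_laplace f hf, laplaceFunctional, integral_map hZ.aemeasurable
      (measurable_expNeg_lintegral (LevelMeasures.measurable_val h_nonneg h_cover)
        hf).aestronglyMeasurable]
    refine integral_congr_ae ?_
    filter_upwards [hZ_ae] with ω hω
    rw [hω]

lemma exists_poissonKernel (h_nonneg : ∀ k x, 0 ≤ h k x) (h_cover : ∀ x, ∃ k, 0 < h k x) :
    ∃ κ : Kernel (LocationMeasures h) (LevelMeasures h), IsMarkovKernel κ ∧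
      ∀ ν, IsPoissonLaw (κ ν) (ν.1.prod halfLineLebesgue) := by
  have : ∀ ν : LocationMeasures h, SigmaFinite ν.1 := LocationMeasures.sigmaFinite h_cover
  choose ρ hρ using fun ν : LocationMeasures h => exists_isPoissonLaw h_nonneg h_cover
    (ν.1.prod halfLineLebesgue) (lintegral_prod_halfLine_lt_top ν)
  have hρ_prob : ∀ ν, IsProbabilityMeasure (ρ ν) := fun ν => (hρ ν).isProbabilityMeasure
  have hρ_meas : Measurable ρ := by
    refine (LevelMeasures.isTestInduced h_nonneg).measurable_kernel
      (levelWeights_nonneg h_nonneg) fun F hF => ?_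
    have hF_meas := (continuous_of_mem_testClass hF).measurable
    have hF_nonneg := nonneg_of_mem_testClass (levelWeights_nonneg h_nonneg) hF
    simp only [fun ν => (hρ ν).laplaceFunctional_eq h_nonneg h_cover hF_meas.ennreal_ofReal,
      fun ν : LocationMeasures h => poissonExponent_prod_halfLine ν.1 hF_meas hF_nonneg]
    exact measurable_expNeg_lintegral (LocationMeasures.measurable_val h_nonneg h_cover)
      (measurable_levelExponent hF_meas)
  exact ⟨⟨ρ, hρ_meas⟩, ⟨hρ_prob⟩, hρ⟩

end PoissonKernel

/-! ### Compactness and tightness in the space of location measures -/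

namespace LocationMeasures

variable {E : Type*} [TopologicalSpace E] [MeasurableSpace E] [BorelSpace E] {w : ℕ → E →ᵇ ℝ}

lemma mem_range_toFiniteMeasures_iff (w_cover : ∀ x, ∃ k, 0 < w k x) {μ : ℕ → FiniteMeasure E} :
    μ ∈ Set.range (toFiniteMeasures (w := w)) ↔
      ∀ j k, (μ k : Measure E).withDensity (fun x => ENNReal.ofReal (w j x)) =
        (μ j : Measure E).withDensity fun x => ENNReal.ofReal (w k x) := by
  constructor
  · rintro ⟨ν, rfl⟩ j k
    simp only [toFiniteMeasures, FiniteMeasure.toMeasure_mk]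
    rw [← withDensity_mul _ (measurable_weight w k) (measurable_weight w j), mul_comm,
      withDensity_mul _ (measurable_weight w j) (measurable_weight w k)]
  · intro hμ
    have hglue := withDensity_glueMeasure w_cover hμ
    refine ⟨⟨glueMeasure w fun k => (μ k : Measure E), fun k => ?_⟩, funext fun k =>
      Subtype.ext (hglue k)⟩
    rw [← setLIntegral_univ, ← withDensity_apply _ MeasurableSet.univ, hglue k]
    exact measure_lt_top _ _

variable [TopologicalSpace.MetrizableSpace E]

lemma range_toFiniteMeasures (w_nonneg : ∀ k x, 0 ≤ w k x) (w_cover : ∀ x, ∃ k, 0 < w k x) :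
    Set.range (toFiniteMeasures (w := w)) =
      ⋂ (j : ℕ) (k : ℕ) (f : E →ᵇ ℝ), {μ : ℕ → FiniteMeasure E |
        ∫ x, (f * w j) x ∂(μ k : Measure E) = ∫ x, (f * w k) x ∂(μ j : Measure E)} := by
  have hfinite : ∀ (μ : FiniteMeasure E) (j : ℕ),
      IsFiniteMeasure ((μ : Measure E).withDensity fun x => ENNReal.ofReal (w j x)) := fun μ j =>
    isFiniteMeasure_withDensity_ofReal ((w j).integrable _).2
  ext μ
  simp only [mem_range_toFiniteMeasures_iff w_cover, Set.mem_iInter, Set.mem_ofPred_eq,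
    BoundedContinuousFunction.coe_mul, Pi.mul_apply]
  refine forall_congr' fun j => forall_congr' fun k => ⟨fun hjk f => ?_, fun hjk => ?_⟩
  · simpa only [integral_withDensity_weight w_nonneg] using
      congrArg (fun m : Measure E => ∫ x, f x ∂m) hjk
  · refine ext_of_forall_integral_eq_of_IsFiniteMeasure fun f => ?_
    simpa only [integral_withDensity_weight w_nonneg] using hjk f

lemma isClosedEmbedding_toFiniteMeasures (w_nonneg : ∀ k x, 0 ≤ w k x)
    (w_cover : ∀ x, ∃ k, 0 < w k x) : IsClosedEmbedding (toFiniteMeasures (w := w)) := by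
  refine ⟨⟨isInducing_toFiniteMeasures w_nonneg, injective_toFiniteMeasures w_cover⟩, ?_⟩
  rw [range_toFiniteMeasures w_nonneg w_cover]
  have hcontinuous : ∀ (g : E →ᵇ ℝ) (k : ℕ),
      Continuous fun μ : ℕ → FiniteMeasure E => ∫ x, g x ∂(μ k : Measure E) := fun g k =>
    (FiniteMeasure.continuous_integral_boundedContinuousFunction g).comp (continuous_apply k)
  exact isClosed_iInter fun j => isClosed_iInter fun k => isClosed_iInter fun f =>
    isClosed_eq (hcontinuous _ k) (hcontinuous _ j)

lemma t2Space (w_nonneg : ∀ k x, 0 ≤ w k x) (w_cover : ∀ x, ∃ k, 0 < w k x) :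
    T2Space (LocationMeasures w) :=
  (isClosedEmbedding_toFiniteMeasures w_nonneg w_cover).isEmbedding.t2Space

lemma isCompact_setOf_lintegral_le (w_nonneg : ∀ k x, 0 ≤ w k x)
    (w_cover : ∀ x, ∃ k, 0 < w k x) (c : ℕ → ℝ≥0) {u : ℕ → ℝ≥0} (hu : Tendsto u atTop (𝓝 0))
    {C : ℕ → ℕ → Set E} (hC : ∀ k n, IsCompact (C k n)) :
    IsCompact {ν : LocationMeasures w | ∀ k, ∫⁻ x, ENNReal.ofReal (w k x) ∂ν.1 ≤ c k ∧
      ∀ n, ∫⁻ x in (C k n)ᶜ, ENNReal.ofReal (w k x) ∂ν.1 ≤ u n} := by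
  have hproduct := isCompact_univ_pi fun k =>
    isCompact_setOfPred_finiteMeasure_mass_le_compl_isCompact_le (E := E) (c k) hu (hC k)
      (Or.inl inferInstance)
  convert (isClosedEmbedding_toFiniteMeasures w_nonneg w_cover).isCompact_preimage hproduct using 1
  ext ν
  simp only [Set.mem_preimage, Set.mem_univ_pi, Set.mem_ofPred_eq]
  refine forall_congr' fun k => and_congr ?_ (forall_congr' fun n => ?_)
  · rw [← ENNReal.coe_le_coe, FiniteMeasure.ennreal_mass]
    simp [toFiniteMeasures, withDensity_apply]
  · rw [← ENNReal.coe_le_coe, FiniteMeasure.ennreal_coeFn_eq_coeFn_toMeasure]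
    simp [toFiniteMeasures, withDensity_apply _ (hC k n).isClosed.measurableSet.compl]

end LocationMeasures

section OneSubExpNeg

/-- The bounded increasing function `1 - exp (-x)` on `[0, ∞]`, whose expectation controls the tail
of a random variable. -/
noncomputable def oneSubExpNeg (x : ℝ≥0∞) : ℝ≥0∞ := ENNReal.ofReal (1 - expNeg x)

lemma oneSubExpNeg_zero : oneSubExpNeg 0 = 0 := by simp [oneSubExpNeg, expNeg_zero]

lemma monotone_oneSubExpNeg : Monotone oneSubExpNeg := fun _ _ hxy =>
  ENNReal.ofReal_le_ofReal (sub_le_sub_left (expNeg_antitone hxy) 1)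

lemma oneSubExpNeg_le_one (x : ℝ≥0∞) : oneSubExpNeg x ≤ 1 :=
  ENNReal.ofReal_le_one.2 (sub_le_self 1 (expNeg_nonneg x))

lemma oneSubExpNeg_pos {x : ℝ≥0∞} (hx : 0 < x) : 0 < oneSubExpNeg x :=
  ENNReal.ofReal_pos.2 (sub_pos.2 ((expNeg_le_one x).lt_of_ne fun hone =>
    hx.ne' (expNeg_injective (hone.trans expNeg_zero.symm))))

lemma continuous_oneSubExpNeg : Continuous oneSubExpNeg :=
  ENNReal.continuous_ofReal.comp (continuous_const.sub continuous_expNeg)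

variable {Ω : Type*} [MeasurableSpace Ω] {P : Measure Ω}

lemma lintegral_oneSubExpNeg [IsProbabilityMeasure P] {X : Ω → ℝ≥0∞} (hX : Measurable X) :
    ∫⁻ ω, oneSubExpNeg (X ω) ∂P = ENNReal.ofReal (1 - ∫ ω, expNeg (X ω) ∂P) := by
  have hX_int : Integrable (fun ω => expNeg (X ω)) P := integrable_expNeg hX.aemeasurable
  have hX_int' : Integrable (fun ω => 1 - expNeg (X ω)) P := (integrable_const _).sub hX_int
  simp only [oneSubExpNeg]
  rw [← ofReal_integral_eq_lintegral_ofReal hX_int'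
    (.of_forall fun ω => sub_nonneg.2 (expNeg_le_one _)), integral_sub (integrable_const _) hX_int]
  simp

lemma measure_lt_le_of_lintegral_oneSubExpNeg_le {X : Ω → ℝ≥0∞} (hX : Measurable X)
    {δ ε : ℝ≥0∞} (hδ : 0 < δ) (hXδ : ∫⁻ ω, oneSubExpNeg (X ω) ∂P ≤ oneSubExpNeg δ * ε) :
    P {ω | δ < X ω} ≤ ε := by
  have hmarkov : oneSubExpNeg δ * P {ω | oneSubExpNeg δ ≤ oneSubExpNeg (X ω)} ≤
      oneSubExpNeg δ * ε :=
    (mul_meas_ge_le_lintegral (continuous_oneSubExpNeg.measurable.comp hX) _).trans hXδ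
  refine (measure_mono fun ω hω => ?_).trans
    ((ENNReal.mul_le_mul_iff_right (oneSubExpNeg_pos hδ).ne' ENNReal.ofReal_ne_top).1 hmarkov)
  exact monotone_oneSubExpNeg (le_of_lt hω)

variable [IsFiniteMeasure P]

lemma tendsto_lintegral_oneSubExpNeg {X : ℕ → Ω → ℝ≥0∞} {Y : Ω → ℝ≥0∞}
    (hX : ∀ n, Measurable (X n)) (hXY : ∀ ω, Tendsto (fun n => X n ω) atTop (𝓝 (Y ω))) :
    Tendsto (fun n => ∫⁻ ω, oneSubExpNeg (X n ω) ∂P) atTop (𝓝 (∫⁻ ω, oneSubExpNeg (Y ω) ∂P)) :=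
  tendsto_lintegral_of_dominated_convergence (fun _ => 1)
    (fun n => continuous_oneSubExpNeg.measurable.comp (hX n))
    (fun n => .of_forall fun ω => oneSubExpNeg_le_one _) (by simp)
    (.of_forall fun ω => (continuous_oneSubExpNeg.tendsto _).comp (hXY ω))

lemma exists_lintegral_oneSubExpNeg_const_mul_le {X : Ω → ℝ≥0∞} (hX : Measurable X)
    (hX_ne_top : ∀ ω, X ω ≠ ∞) {η : ℝ≥0∞} (hη : 0 < η) :
    ∃ t : ℝ, 0 < t ∧ t ≤ 1 ∧ ∫⁻ ω, oneSubExpNeg (ENNReal.ofReal t * X ω) ∂P ≤ η := by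
  have hzero : Tendsto (fun n : ℕ => ENNReal.ofReal (1 / ((n : ℝ) + 1))) atTop (𝓝 0) := by
    simpa using ENNReal.tendsto_ofReal tendsto_one_div_add_atTop_nhds_zero_nat
  have hlim : Tendsto (fun n : ℕ => ∫⁻ ω,
      oneSubExpNeg (ENNReal.ofReal (1 / ((n : ℝ) + 1)) * X ω) ∂P) atTop (𝓝 0) := by
    convert tendsto_lintegral_oneSubExpNeg (P := P) (Y := fun _ => 0)
      (fun n => hX.const_mul (ENNReal.ofReal (1 / ((n : ℝ) + 1)))) fun ω => ?_ using 2
    · simp [oneSubExpNeg_zero]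
    · simpa using ENNReal.Tendsto.mul_const hzero (.inr (hX_ne_top ω))
  obtain ⟨n, hn⟩ := (hlim.eventually (gt_mem_nhds hη)).exists
  exact ⟨1 / (n + 1), Nat.one_div_pos_of_nat, (div_le_one (by positivity)).2 (by simp), hn.le⟩

lemma tendsto_measure_natCast_lt {X : Ω → ℝ≥0∞} (hX : Measurable X) (hX_ne_top : ∀ ω, X ω ≠ ∞) :
    Tendsto (fun n : ℕ => P {ω | (n : ℝ≥0∞) < X ω}) atTop (𝓝 0) := by
  have hanti : Antitone fun n : ℕ => {ω | (n : ℝ≥0∞) < X ω} := fun m n hmn ω hω =>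
    show (m : ℝ≥0∞) < X ω from lt_of_le_of_lt (Nat.cast_le.2 hmn) hω
  have hempty : ⋂ n : ℕ, {ω | (n : ℝ≥0∞) < X ω} = ∅ := by
    refine Set.eq_empty_of_forall_notMem fun ω hω => ?_
    obtain ⟨n, hn⟩ := ENNReal.exists_nat_gt (hX_ne_top ω)
    exact lt_asymm hn (Set.mem_iInter.1 hω n)
  rw [← measure_empty (μ := P), ← hempty]
  exact tendsto_measure_iInter_atTop
    (fun n => (measurableSet_lt measurable_const hX).nullMeasurableSet) hanti
    ⟨0, measure_ne_top _ _⟩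

end OneSubExpNeg

section Tightness

variable {E : Type*} [TopologicalSpace E] [MeasurableSpace E] {w : ℕ → E →ᵇ ℝ}

/-- The law `P₀` of a random location measure dominates the law `P` in the Laplace transform
order, up to a factor two in the test function; only test functions bounded by one are compared. -/
def LaplaceDominated (P P₀ : Measure (LocationMeasures w)) : Prop :=
  ∀ G ∈ testClass w, (∀ x, G x ≤ 1) →
    laplaceFunctional P₀ (fun ν => ν.1) (fun x => ENNReal.ofReal (2 * G x)) ≤
      laplaceFunctional P (fun ν => ν.1) fun x => ENNReal.ofReal (G x)

omit [MeasurableSpace E] in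
lemma exists_seq_tendsto_indicator_compl [HasOuterApproxClosed E] {C : Set E} (hC : IsClosed C) :
    ∃ g : ℕ → E →ᵇ ℝ, (∀ n x, 0 ≤ g n x) ∧ (∀ n x, g n x ≤ 1) ∧
      ∀ x, Tendsto (fun n => g n x) atTop (𝓝 (Cᶜ.indicator 1 x)) := by
  have happr_le : ∀ n x, (hC.apprSeq n x : ℝ) ≤ 1 := fun n x =>
    HasOuterApproxClosed.apprSeq_apply_le_one hC n x
  have happr_nonneg : ∀ n x, (0 : ℝ) ≤ hC.apprSeq n x := fun n x => NNReal.coe_nonneg _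
  refine ⟨fun n => .ofNormedAddCommGroup (fun x => 1 - (hC.apprSeq n x : ℝ)) (by fun_prop) 1
    fun x => ?_, fun n x => sub_nonneg.2 (happr_le n x),
    fun n x => sub_le_self 1 (happr_nonneg n x), fun x => ?_⟩
  · rw [Real.norm_of_nonneg (sub_nonneg.2 (happr_le n x))]
    exact sub_le_self 1 (happr_nonneg n x)
  · have happr := (NNReal.continuous_coe.tendsto _).comp
      (tendsto_pi_nhds.1 (HasOuterApproxClosed.tendsto_apprSeq hC) x)
    have hx_compl : Cᶜ.indicator 1 x =
        1 - ((C.indicator (fun _ => 1) x : ℝ≥0) : ℝ) := by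
      by_cases hx : x ∈ C <;> simp [hx]
    rw [hx_compl]
    exact tendsto_const_nhds.sub happr

section OpensMeasurable

variable [OpensMeasurableSpace E]

lemma tendsto_lintegral_mul_weight_indicator (w_nonneg : ∀ k x, 0 ≤ w k x)
    {g : ℕ → E →ᵇ ℝ} (hg_le : ∀ n x, g n x ≤ 1) {A : Set E} (hA : MeasurableSet A)
    (hg : ∀ x, Tendsto (fun n => g n x) atTop (𝓝 (A.indicator 1 x))) (ν : LocationMeasures w)
    (k : ℕ) :
    Tendsto (fun n => ∫⁻ x, ENNReal.ofReal (g n x * w k x) ∂ν.1) atTop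
      (𝓝 (∫⁻ x in A, ENNReal.ofReal (w k x) ∂ν.1)) := by
  rw [← lintegral_indicator hA]
  refine tendsto_lintegral_of_dominated_convergence (fun x => ENNReal.ofReal (w k x))
    (fun n => ((g n).continuous.mul (w k).continuous).measurable.ennreal_ofReal)
    (fun n => .of_forall fun x => ENNReal.ofReal_le_ofReal
      (mul_le_of_le_one_left (w_nonneg k x) (hg_le n x))) (ν.2 k).ne (.of_forall fun x => ?_)
  convert ENNReal.tendsto_ofReal ((hg x).mul_const (w k x)) using 2
  by_cases hx : x ∈ A <;> simp [hx]

end OpensMeasurable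

variable [BorelSpace E]

namespace LocationMeasures

variable [HasOuterApproxClosed E]

lemma measurable_lintegral (w_nonneg : ∀ k x, 0 ≤ w k x) (w_cover : ∀ x, ∃ k, 0 < w k x)
    {f : E → ℝ≥0∞} (hf : Measurable f) :
    Measurable fun ν : LocationMeasures w => ∫⁻ x, f x ∂ν.1 :=
  (Measure.measurable_lintegral hf).comp (measurable_val w_nonneg w_cover)

lemma measurable_setLIntegral (w_nonneg : ∀ k x, 0 ≤ w k x) (w_cover : ∀ x, ∃ k, 0 < w k x)
    {f : E → ℝ≥0∞} (hf : Measurable f) {A : Set E} (hA : MeasurableSet A) :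
    Measurable fun ν : LocationMeasures w => ∫⁻ x in A, f x ∂ν.1 := by
  simp only [← lintegral_indicator hA]
  exact measurable_lintegral w_nonneg w_cover (hf.indicator hA)

end LocationMeasures

namespace LaplaceDominated

variable [HasOuterApproxClosed E] {P P₀ : Measure (LocationMeasures w)} [IsProbabilityMeasure P]
  [IsProbabilityMeasure P₀]

lemma lintegral_le (hP : LaplaceDominated P P₀) (w_nonneg : ∀ k x, 0 ≤ w k x)
    (w_cover : ∀ x, ∃ k, 0 < w k x) {G : E → ℝ} (hG : G ∈ testClass w) (hG_le : ∀ x, G x ≤ 1) :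
    ∫⁻ ν, oneSubExpNeg (∫⁻ x, ENNReal.ofReal (G x) ∂ν.1) ∂P ≤
      ∫⁻ ν, oneSubExpNeg (2 * ∫⁻ x, ENNReal.ofReal (G x) ∂ν.1) ∂P₀ := by
  have hG_meas := (continuous_of_mem_testClass hG).measurable.ennreal_ofReal
  have hG_int := LocationMeasures.measurable_lintegral w_nonneg w_cover hG_meas
  rw [lintegral_oneSubExpNeg hG_int, lintegral_oneSubExpNeg (hG_int.const_mul 2)]
  refine ENNReal.ofReal_le_ofReal (sub_le_sub_left ?_ 1)
  simpa only [laplaceFunctional, ENNReal.ofReal_mul zero_le_two, ENNReal.ofReal_ofNat,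
    lintegral_const_mul _ hG_meas] using hP G hG hG_le

lemma setLIntegral_compl_le (hP : LaplaceDominated P P₀) (w_nonneg : ∀ k x, 0 ≤ w k x)
    (w_le_one : ∀ k x, w k x ≤ 1) (w_cover : ∀ x, ∃ k, 0 < w k x) (k : ℕ) {C : Set E}
    (hC : IsClosed C) :
    ∫⁻ ν, oneSubExpNeg (∫⁻ x in Cᶜ, ENNReal.ofReal (w k x) ∂ν.1) ∂P ≤
      ∫⁻ ν, oneSubExpNeg (2 * ∫⁻ x in Cᶜ, ENNReal.ofReal (w k x) ∂ν.1) ∂P₀ := by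
  obtain ⟨g, hg_nonneg, hg_le, hg⟩ := exists_seq_tendsto_indicator_compl hC
  have hg_mem : ∀ n, (fun x => g n x * w k x) ∈ testClass w := fun n =>
    mul_mem_testClass (hg_nonneg n) k
  have hg_meas : ∀ n, Measurable fun ν : LocationMeasures w =>
      ∫⁻ x, ENNReal.ofReal (g n x * w k x) ∂ν.1 := fun n =>
    LocationMeasures.measurable_lintegral w_nonneg w_cover
      (continuous_of_mem_testClass (hg_mem n)).measurable.ennreal_ofReal
  have hlim := fun ν : LocationMeasures w =>
    tendsto_lintegral_mul_weight_indicator w_nonneg hg_le hC.measurableSet.compl hg ν k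
  refine le_of_tendsto_of_tendsto' (tendsto_lintegral_oneSubExpNeg hg_meas hlim)
    (tendsto_lintegral_oneSubExpNeg (fun n => (hg_meas n).const_mul 2) fun ν =>
      ENNReal.Tendsto.const_mul (hlim ν) (.inr ENNReal.ofNat_ne_top)) fun n => ?_
  exact hP.lintegral_le w_nonneg w_cover (hg_mem n) fun x =>
    mul_le_one₀ (hg_le n x) (w_nonneg k x) (w_le_one k x)

end LaplaceDominated

lemma exists_measure_lintegral_weight_le [HasOuterApproxClosed E] (w_nonneg : ∀ k x, 0 ≤ w k x)
    (w_le_one : ∀ k x, w k x ≤ 1) (w_cover : ∀ x, ∃ k, 0 < w k x)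
    (P₀ : Measure (LocationMeasures w)) [IsProbabilityMeasure P₀] (k : ℕ) {ε : ℝ≥0∞} (hε : 0 < ε) :
    ∃ c : ℝ≥0, ∀ P : Measure (LocationMeasures w), IsProbabilityMeasure P →
      LaplaceDominated P P₀ → P {ν | c < ∫⁻ x, ENNReal.ofReal (w k x) ∂ν.1} ≤ ε := by
  have hw := LocationMeasures.measurable_lintegral w_nonneg w_cover (measurable_weight w k)
  obtain ⟨t, ht, ht_le, ht_small⟩ := exists_lintegral_oneSubExpNeg_const_mul_le (P := P₀)
    (hw.const_mul 2) (fun ν => ENNReal.mul_ne_top ENNReal.ofNat_ne_top (ν.2 k).ne)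
    (ENNReal.mul_pos (oneSubExpNeg_pos one_pos).ne' hε.ne')
  refine ⟨t⁻¹.toNNReal, fun P hP hdom => ?_⟩
  have hbound := hdom.lintegral_le w_nonneg w_cover
    (const_mul_mem_testClass (weight_mem_testClass k) ht.le) fun x =>
      mul_le_one₀ ht_le (w_nonneg k x) (w_le_one k x)
  simp only [ENNReal.ofReal_mul ht.le, lintegral_const_mul _ (measurable_weight w k),
    mul_left_comm] at hbound ht_small
  refine (measure_mono fun ν hν => ?_).trans (measure_lt_le_of_lintegral_oneSubExpNeg_le
    (hw.const_mul _) one_pos (hbound.trans ht_small))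
  have hinv : ENNReal.ofReal t * ENNReal.ofReal t⁻¹ = 1 := by
    rw [← ENNReal.ofReal_mul ht.le, mul_inv_cancel₀ ht.ne', ENNReal.ofReal_one]
  exact hinv.symm.trans_lt
    (ENNReal.mul_lt_mul_right (ENNReal.ofReal_pos.2 ht).ne' ENNReal.ofReal_ne_top hν)

variable [PolishSpace E]

lemma exists_isCompact_setLIntegral_compl_le (w_nonneg : ∀ k x, 0 ≤ w k x)
    (w_cover : ∀ x, ∃ k, 0 < w k x) (P : Measure (LocationMeasures w)) [IsFiniteMeasure P] (k : ℕ)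
    {B : Set (LocationMeasures w)} {c : ℝ≥0∞} (hc : c ≠ ∞)
    (hB : ∀ ν ∈ B, ∫⁻ x, ENNReal.ofReal (w k x) ∂ν.1 ≤ c) {η : ℝ≥0∞} (hη : 0 < η) :
    ∃ C : Set E, IsCompact C ∧ ∫⁻ ν in B, ∫⁻ x in Cᶜ, ENNReal.ofReal (w k x) ∂ν.1 ∂P ≤ η := by
  let m : Measure E := (P.restrict B).bind fun ν => ν.1.withDensity fun x => ENNReal.ofReal (w k x)
  have hm : ∀ A, MeasurableSet A →
      m A = ∫⁻ ν in B, ∫⁻ x in A, ENNReal.ofReal (w k x) ∂ν.1 ∂P := fun A hA => by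
    rw [Measure.bind_apply hA (measurable_withDensity
      (LocationMeasures.measurable_val w_nonneg w_cover) (measurable_weight w k)).aemeasurable]
    simp only [withDensity_apply _ hA]
  have hm_finite : IsFiniteMeasure m := by
    refine ⟨?_⟩
    rw [hm _ MeasurableSet.univ]
    simp only [Measure.restrict_univ]
    refine (setLIntegral_mono measurable_const hB).trans_lt ?_
    rw [setLIntegral_const]
    exact ENNReal.mul_lt_top hc.lt_top (measure_lt_top _ _)
  obtain ⟨C, hC, hmC⟩ := isTightMeasureSet_iff_exists_isCompact_measure_compl_le.1
    (isTightMeasureSet_singleton (μ := m)) η hη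
  exact ⟨C, hC, (hm _ hC.isClosed.measurableSet.compl).symm.trans_le (hmC m rfl)⟩

lemma exists_isCompact_lintegral_oneSubExpNeg_le (w_nonneg : ∀ k x, 0 ≤ w k x)
    (w_cover : ∀ x, ∃ k, 0 < w k x) (P : Measure (LocationMeasures w)) [IsFiniteMeasure P] (k : ℕ)
    {η : ℝ≥0∞} (hη : 0 < η) :
    ∃ C : Set E, IsCompact C ∧
      ∫⁻ ν, oneSubExpNeg (2 * ∫⁻ x in Cᶜ, ENNReal.ofReal (w k x) ∂ν.1) ∂P ≤ η := by
  have hw := LocationMeasures.measurable_lintegral w_nonneg w_cover (measurable_weight w k)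
  obtain ⟨c, hc⟩ := ((tendsto_measure_natCast_lt (P := P) hw fun ν => (ν.2 k).ne).eventually
    (gt_mem_nhds (ENNReal.half_pos hη.ne'))).exists
  have hB : MeasurableSet {ν : LocationMeasures w |
      (c : ℝ≥0∞) < ∫⁻ x, ENNReal.ofReal (w k x) ∂ν.1} := measurableSet_lt measurable_const hw
  obtain ⟨C, hC, hC_le⟩ := exists_isCompact_setLIntegral_compl_le w_nonneg w_cover P k
    (B := {ν | (c : ℝ≥0∞) < ∫⁻ x, ENNReal.ofReal (w k x) ∂ν.1}ᶜ)
    (ENNReal.natCast_ne_top c) (fun _ hν => not_lt.1 hν)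
    (ENNReal.half_pos (ENNReal.half_pos hη.ne').ne')
  refine ⟨C, hC, ?_⟩
  have hC_meas := LocationMeasures.measurable_setLIntegral w_nonneg w_cover
    (measurable_weight w k) hC.isClosed.measurableSet.compl
  rw [← lintegral_add_compl _ hB]
  calc _ ≤ ∫⁻ _ in {ν | (c : ℝ≥0∞) < ∫⁻ x, ENNReal.ofReal (w k x) ∂ν.1}, 1 ∂P +
        ∫⁻ ν in {ν | (c : ℝ≥0∞) < ∫⁻ x, ENNReal.ofReal (w k x) ∂ν.1}ᶜ,
          2 * ∫⁻ x in Cᶜ, ENNReal.ofReal (w k x) ∂ν.1 ∂P := by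
        gcongr
        · exact oneSubExpNeg_le_one _
        · exact ofReal_one_sub_expNeg_le _
    _ ≤ η / 2 + 2 * (η / 2 / 2) := by
        rw [setLIntegral_one, lintegral_const_mul _ hC_meas]
        gcongr
    _ = η := by
        rw [ENNReal.mul_div_cancel two_ne_zero ENNReal.ofNat_ne_top, ENNReal.add_halves]

lemma exists_isCompact_measure_setLIntegral_compl_le (w_nonneg : ∀ k x, 0 ≤ w k x)
    (w_le_one : ∀ k x, w k x ≤ 1) (w_cover : ∀ x, ∃ k, 0 < w k x)
    (P₀ : Measure (LocationMeasures w)) [IsProbabilityMeasure P₀] (k : ℕ) {δ ε : ℝ≥0∞}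
    (hδ : 0 < δ) (hε : 0 < ε) :
    ∃ C : Set E, IsCompact C ∧ ∀ P : Measure (LocationMeasures w), IsProbabilityMeasure P →
      LaplaceDominated P P₀ → P {ν | δ < ∫⁻ x in Cᶜ, ENNReal.ofReal (w k x) ∂ν.1} ≤ ε := by
  obtain ⟨C, hC, hC_le⟩ := exists_isCompact_lintegral_oneSubExpNeg_le w_nonneg w_cover P₀ k
    (ENNReal.mul_pos (oneSubExpNeg_pos hδ).ne' hε.ne')
  exact ⟨C, hC, fun P hP hdom => measure_lt_le_of_lintegral_oneSubExpNeg_le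
    (LocationMeasures.measurable_setLIntegral w_nonneg w_cover (measurable_weight w k)
      hC.isClosed.measurableSet.compl) hδ
    ((hdom.setLIntegral_compl_le w_nonneg w_le_one w_cover k hC.isClosed).trans hC_le)⟩

lemma isTightMeasureSet_of_laplaceDominated (w_nonneg : ∀ k x, 0 ≤ w k x)
    (w_le_one : ∀ k x, w k x ≤ 1) (w_cover : ∀ x, ∃ k, 0 < w k x)
    {P₀ : Measure (LocationMeasures w)} [IsProbabilityMeasure P₀]
    {Γ : Set (Measure (LocationMeasures w))}
    (hΓ : ∀ P ∈ Γ, IsProbabilityMeasure P ∧ LaplaceDominated P P₀) : IsTightMeasureSet Γ := by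
  rw [isTightMeasureSet_iff_exists_isCompact_measure_compl_le]
  intro ε hε
  obtain ⟨e, he_pos, he_sum⟩ := ENNReal.exists_pos_sum_of_countable' hε.ne' (ℕ ⊕ ℕ × ℕ)
  choose c hc using fun k =>
    exists_measure_lintegral_weight_le w_nonneg w_le_one w_cover P₀ k (he_pos (.inl k))
  have hu_pos : ∀ n : ℕ, 0 < ((n : ℝ≥0) + 1)⁻¹ := fun n => by positivity
  have hu : Tendsto (fun n : ℕ => ((n : ℝ≥0) + 1)⁻¹) atTop (𝓝 0) := by
    rw [← NNReal.tendsto_coe]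
    simpa using tendsto_one_div_add_atTop_nhds_zero_nat (𝕜 := ℝ)
  choose C hC hC_le using fun k n => exists_isCompact_measure_setLIntegral_compl_le w_nonneg
    w_le_one w_cover P₀ k (ENNReal.coe_pos.2 (hu_pos n)) (he_pos (.inr (k, n)))
  refine ⟨_, LocationMeasures.isCompact_setOf_lintegral_le w_nonneg w_cover c hu hC,
    fun P hP => ?_⟩
  obtain ⟨hP_prob, hP_dom⟩ := hΓ P hP
  let B : ℕ ⊕ ℕ × ℕ → Set (LocationMeasures w) := Sum.elim
    (fun k => {ν | c k < ∫⁻ x, ENNReal.ofReal (w k x) ∂ν.1})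
    (fun p => {ν | (((p.2 : ℝ≥0) + 1)⁻¹ : ℝ≥0) <
      ∫⁻ x in (C p.1 p.2)ᶜ, ENNReal.ofReal (w p.1 x) ∂ν.1})
  calc P _ ≤ P (⋃ i, B i) := by
        refine measure_mono fun ν hν => ?_
        simp only [Set.mem_compl_iff, Set.mem_ofPred_eq, not_forall, not_and_or, not_le] at hν
        obtain ⟨k, hk | ⟨n, hn⟩⟩ := hν
        · exact Set.mem_iUnion.2 ⟨.inl k, hk⟩
        · exact Set.mem_iUnion.2 ⟨.inr (k, n), hn⟩
    _ ≤ ∑' i, P (B i) := measure_iUnion_le _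
    _ ≤ ∑' i, e i := by
        refine ENNReal.tsum_le_tsum fun i => ?_
        rcases i with k | ⟨k, n⟩
        · exact hc k P hP_prob hP_dom
        · exact hC_le k n P hP_prob hP_dom
    _ ≤ ε := he_sum.le

end Tightness

/-! ### Convergence of Laplace functionals -/

section LaplaceConvergence

section

variable {Ω E : Type*} [MeasurableSpace Ω] [MeasurableSpace E] {P : Measure Ω} {X : Ω → Measure E}
  {f g : E → ℝ≥0∞}

lemma laplaceFunctional_anti [IsFiniteMeasure P] (hX : Measurable X) (hf : Measurable f)
    (hg : Measurable g) (hfg : ∀ x, f x ≤ g x) :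
    laplaceFunctional P X g ≤ laplaceFunctional P X f :=
  integral_mono (integrable_expNeg_lintegral hX hg) (integrable_expNeg_lintegral hX hf)
    fun _ => expNeg_antitone (lintegral_mono hfg)

lemma abs_laplaceFunctional_sub_le [IsProbabilityMeasure P] (hX : Measurable X)
    (hf : Measurable f) (hg : Measurable g) {ε : ℝ} (hε : 0 ≤ ε) (hfg : ∀ x, f x ≤ g x)
    (hgf : ∀ x, g x ≤ ENNReal.ofReal (1 + ε) * f x) :
    |laplaceFunctional P X f - laplaceFunctional P X g| ≤ ε := by
  rw [laplaceFunctional, laplaceFunctional,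
    ← integral_sub (integrable_expNeg_lintegral hX hf) (integrable_expNeg_lintegral hX hg),
    ← Real.norm_eq_abs]
  refine (norm_integral_le_of_norm_le_const (C := ε) (.of_forall fun ω => ?_)).trans_eq (by simp)
  refine abs_expNeg_sub_expNeg_le hε (lintegral_mono hfg) ?_
  rw [← lintegral_const_mul _ hf]
  exact lintegral_mono hgf

lemma laplaceFunctional_map {M : Type*} [MeasurableSpace M] {Y : Ω → M} (hY : AEMeasurable Y P)
    {toMeas : M → Measure E} (hf : Measurable fun μ => ∫⁻ x, f x ∂(toMeas μ)) :
    laplaceFunctional (P.map Y) toMeas f = laplaceFunctional P (fun ω => toMeas (Y ω)) f :=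
  integral_map hY (measurable_expNeg.comp hf).aestronglyMeasurable

end

variable {M E : Type*} [TopologicalSpace M] [MeasurableSpace M] [BorelSpace M] [MeasurableSpace E]
  {toMeas : M → Measure E}

lemma tendsto_laplaceFunctional {α : Type*} {L : Filter α} {P : α → ProbabilityMeasure M}
    {P₀ : ProbabilityMeasure M} (hP : Tendsto P L (𝓝 P₀)) {f : E → ℝ≥0∞}
    (hf : Continuous fun μ => ∫⁻ x, f x ∂(toMeas μ)) :
    Tendsto (fun a => laplaceFunctional (P a : Measure M) toMeas f) L
      (𝓝 (laplaceFunctional (P₀ : Measure M) toMeas f)) :=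
  ProbabilityMeasure.tendsto_iff_forall_integral_tendsto.1 hP
    (.ofNormedAddCommGroup _ (continuous_expNeg.comp hf) 1 fun _ => norm_expNeg_le_one _)

variable {Ω : ℕ → Type*} [∀ n, MeasurableSpace (Ω n)] {prob : ∀ n, Measure (Ω n)}
  [∀ n, IsProbabilityMeasure (prob n)] {X : ∀ n, Ω n → M} {Q : ProbabilityMeasure M}

lemma tendsto_laplaceFunctional_of_tendstoInDistribution
    (hX : TendstoInDistribution X atTop id prob (Q : Measure M)) {f : E → ℝ≥0∞}
    (hf : Continuous fun μ => ∫⁻ x, f x ∂(toMeas μ)) :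
    Tendsto (fun n => laplaceFunctional (prob n) (fun ω => toMeas (X n ω)) f) atTop
      (𝓝 (laplaceFunctional (Q : Measure M) toMeas f)) := by
  have hlim := tendsto_laplaceFunctional hX.tendsto hf
  simp only [ProbabilityMeasure.coe_mk, Measure.map_id] at hlim
  exact hlim.congr fun n => laplaceFunctional_map (hX.forall_aemeasurable n) hf.measurable

lemma IsTestInduced.tendstoInDistribution [TopologicalSpace E] [OpensMeasurableSpace E]
    {w : ℕ → E →ᵇ ℝ} (hM : IsTestInduced w toMeas) (w_nonneg : ∀ k x, 0 ≤ w k x)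
    (hcont : ∀ F ∈ testClass w, Continuous fun μ => ∫⁻ x, ENNReal.ofReal (F x) ∂(toMeas μ))
    (hX : ∀ n, Measurable (X n))
    (hlim : ∀ F ∈ testClass w, Tendsto (fun n => laplaceFunctional (prob n)
      (fun ω => toMeas (X n ω)) fun x => ENNReal.ofReal (F x)) atTop
      (𝓝 (laplaceFunctional (Q : Measure M) toMeas fun x => ENNReal.ofReal (F x)))) :
    TendstoInDistribution X atTop id prob (Q : Measure M) := by
  refine ⟨fun n => (hX n).aemeasurable, measurable_id.aemeasurable,
    hM.tendsto w_nonneg fun F hF => ?_⟩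
  simp only [ProbabilityMeasure.coe_mk, Measure.map_id]
  exact (hlim F hF).congr fun n =>
    (laplaceFunctional_map (hX n).aemeasurable (hcont F hF).measurable).symm

end LaplaceConvergence

/-! ### Uniform levels -/

section UniformLevels

variable {S : Type*} [MeasurableSpace S]

lemma measurable_levelTransform (r : ℝ≥0) {f : S × ℝ≥0 → ℝ} (hf : Measurable f) :
    Measurable (levelTransform r f) := by
  have hint : Measurable fun x => ∫ u in Set.Iic r, Real.exp (-f (x, u)) ∂halfLineLebesgue :=
    (StronglyMeasurable.integral_prod_right' (f := fun z => Real.exp (-f z))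
      hf.neg.exp.stronglyMeasurable).measurable
  exact (hint.const_mul _).log.const_mul _

variable [TopologicalSpace S] [PolishSpace S] [BorelSpace S] {h : ℕ → S →ᵇ ℝ}

lemma LevelMeasures.measurable_normalizedMarginal (h_nonneg : ∀ k x, 0 ≤ h k x)
    (h_cover : ∀ x, ∃ k, 0 < h k x) (r : ℝ≥0) :
    Measurable (LevelMeasures.normalizedMarginal (h := h) r) := by
  refine (LocationMeasures.isTestInduced h_nonneg).measurable
    (Measure.measurable_of_measurable_coe _ fun A hA => ?_)
  have hlevel : MeasurableSet {z : S × ℝ≥0 | z.2 ≤ r} :=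
    measurableSet_le measurable_snd measurable_const
  have hmarginal (μ : LevelMeasures h) : (μ.normalizedMarginal r).1 A =
      r⁻¹ • μ.1 (Prod.fst ⁻¹' A ∩ {z | z.2 ≤ r}) := by
    rw [LevelMeasures.normalizedMarginal, Measure.smul_apply, Measure.map_apply measurable_fst hA,
      Measure.restrict_apply (measurable_fst hA)]
  simp only [hmarginal]
  exact ((Measure.measurable_coe ((measurable_fst hA).inter hlevel)).comp
    (LevelMeasures.measurable_val h_nonneg h_cover)).const_smul _

/-- The levels of the points of `ξ` are independent, uniform on `[0, r]` and independent of their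
locations, expressed by the Laplace functional of `ξ`. -/
def HasUniformLevels {Ω : Type*} [MeasurableSpace Ω] (r : ℝ≥0) (P : Measure Ω)
    (ξ : Ω → LevelMeasures h) : Prop :=
  ∀ f : S × ℝ≥0 → ℝ, Measurable f → (∀ z, 0 ≤ f z) →
    laplaceFunctional P (fun ω => (ξ ω).1) (fun z => ENNReal.ofReal (f z)) =
      laplaceFunctional P (fun ω => ((ξ ω).normalizedMarginal r).1)
        fun x => ENNReal.ofReal (levelTransform r f x)

lemma HasUniformLevels.abs_laplaceFunctional_sub_levelExponent_le {Ω : Type*}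
    [MeasurableSpace Ω] {r : ℝ≥0} {P : Measure Ω} [IsProbabilityMeasure P] {ξ : Ω → LevelMeasures h}
    (hξ : HasUniformLevels r P ξ) (h_nonneg : ∀ k x, 0 ≤ h k x) (h_cover : ∀ x, ∃ k, 0 < h k x)
    (ξ_meas : Measurable ξ) {f : S × ℝ≥0 → ℝ} (hf : Measurable f) (hf_nonneg : ∀ z, 0 ≤ f z)
    {K : ℝ≥0} (hK : ∀ x u, K < u → f (x, u) = 0) (hr : 0 < r) (hKr : 2 * K ≤ r) :
    |laplaceFunctional P (fun ω => (ξ ω).1) (fun z => ENNReal.ofReal (f z)) -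
      laplaceFunctional P (fun ω => ((ξ ω).normalizedMarginal r).1) (levelExponent f)| ≤
      2 * K / r := by
  rw [hξ f hf hf_nonneg, abs_sub_comm]
  have hbound := levelExponent_le_levelTransform_and_le hf hf_nonneg hK hr hKr
  exact abs_laplaceFunctional_sub_le ((LocationMeasures.measurable_val h_nonneg h_cover).comp
      ((LevelMeasures.measurable_normalizedMarginal h_nonneg h_cover r).comp ξ_meas))
    (measurable_levelExponent hf) (measurable_levelTransform r hf).ennreal_ofReal (by positivity)
    (fun x => (hbound x).1) fun x => (hbound x).2

end UniformLevels

section TriangleAverage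

lemma lintegral_map_fst_withDensity_triangleDensity {S : Type*} [MeasurableSpace S] (K : ℕ)
    (m : Measure (S × ℝ≥0)) {F : S → ℝ≥0∞} (hF : Measurable F) :
    ∫⁻ x, F x ∂(m.withDensity fun z => (triangleDensity K z.2 : ℝ≥0∞)).map Prod.fst =
      ∫⁻ z, triangleDensity K z.2 * F z.1 ∂m := by
  have hdensity : Measurable fun z : S × ℝ≥0 => (triangleDensity K z.2 : ℝ≥0∞) :=
    ((continuous_triangleDensity K).measurable.comp measurable_snd).coe_nnreal_ennreal
  rw [lintegral_map hF measurable_fst]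
  exact lintegral_withDensity_eq_lintegral_mul _ hdensity (hF.comp measurable_fst)

lemma abs_laplaceFunctional_levelExponent_sub_le {S Ω : Type*} [MeasurableSpace S]
    [MeasurableSpace Ω] {P : Measure Ω} [IsProbabilityMeasure P] {X : Ω → Measure S}
    (hX : Measurable X) {G : S → ℝ} (hG : Measurable G) (hG_nonneg : ∀ x, 0 ≤ G x) {C : ℝ}
    (hC : 0 ≤ C) (hGC : ∀ x, G x ≤ C) (K : ℕ) :
    |laplaceFunctional P X (levelExponent fun z => G z.1 * triangleDensity K z.2) -
      laplaceFunctional P X fun x => ENNReal.ofReal (G x)| ≤ C * (2 / (K + 1)) :=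
  abs_laplaceFunctional_sub_le hX
    (measurable_levelExponent ((hG.comp measurable_fst).mul
      ((continuous_triangleDensity K).measurable.comp measurable_snd).coe_nnreal_real))
    hG.ennreal_ofReal (by positivity) (levelExponent_mul_triangleDensity_le hG_nonneg K)
    (le_levelExponent_mul_triangleDensity hG_nonneg hGC K)

variable {S : Type*} [TopologicalSpace S] [MeasurableSpace S] [BorelSpace S] {h : ℕ → S →ᵇ ℝ}

namespace LevelMeasures

lemma lintegral_weight_mul_triangleDensity_lt_top (μ : LevelMeasures h) (k K : ℕ) :
    ∫⁻ z, triangleDensity K z.2 * ENNReal.ofReal (h k z.1) ∂μ.1 < ∞ := by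
  have hweight : Measurable fun z : S × ℝ≥0 => ENNReal.ofReal (h k z.1) :=
    (measurable_weight h k).comp measurable_fst
  have hlevel : MeasurableSet {z : S × ℝ≥0 | z.2 ≤ K + 1} :=
    measurableSet_le measurable_snd measurable_const
  calc ∫⁻ z, triangleDensity K z.2 * ENNReal.ofReal (h k z.1) ∂μ.1
      ≤ ∫⁻ z, (2 / (K + 1) : ℝ≥0) * {z : S × ℝ≥0 | z.2 ≤ K + 1}.indicator
          (fun z => ENNReal.ofReal (h k z.1)) z ∂μ.1 := by
        refine lintegral_mono fun z => ?_
        by_cases hz : z.2 ≤ (K : ℝ≥0) + 1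
        · rw [Set.indicator_of_mem (by exact hz)]
          gcongr
          exact triangleDensity_le K z.2
        · simp [triangleDensity_of_lt (not_le.1 hz)]
    _ = (2 / (K + 1) : ℝ≥0) * ∫⁻ z in {z : S × ℝ≥0 | z.2 ≤ K + 1},
          ENNReal.ofReal (h k z.1) ∂μ.1 := by
        rw [lintegral_const_mul _ (hweight.indicator hlevel), lintegral_indicator hlevel]
    _ < ∞ := ENNReal.mul_lt_top ENNReal.coe_lt_top (μ.2 k _)

/-- The measure `∫ φ_K(u) μ(dx × du)` on `S`, where `φ_K` is the triangular density of width
`K + 1`. It approximates the locations of a point process with uniform levels. -/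
noncomputable def triangleAverage (K : ℕ) (μ : LevelMeasures h) : LocationMeasures h :=
  ⟨(μ.1.withDensity fun z => (triangleDensity K z.2 : ℝ≥0∞)).map Prod.fst, fun k => by
    rw [lintegral_map_fst_withDensity_triangleDensity K μ.1 (measurable_weight h k)]
    exact μ.lintegral_weight_mul_triangleDensity_lt_top k K⟩

lemma lintegral_triangleAverage (K : ℕ) (μ : LevelMeasures h) {G : S → ℝ} (hG : Measurable G)
    (hG_nonneg : ∀ x, 0 ≤ G x) :
    ∫⁻ x, ENNReal.ofReal (G x) ∂(μ.triangleAverage K).1 =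
      ∫⁻ z, ENNReal.ofReal (G z.1 * triangleDensity K z.2) ∂μ.1 := by
  rw [triangleAverage, lintegral_map_fst_withDensity_triangleDensity K μ.1 hG.ennreal_ofReal]
  refine lintegral_congr fun z => ?_
  rw [ENNReal.ofReal_mul (hG_nonneg _), ENNReal.ofReal_coe_nnreal, mul_comm]

variable [PolishSpace S]

lemma measurable_triangleAverage (h_nonneg : ∀ k x, 0 ≤ h k x) (h_cover : ∀ x, ∃ k, 0 < h k x)
    (K : ℕ) : Measurable (triangleAverage (h := h) K) :=
  (LocationMeasures.isTestInduced h_nonneg).measurable <|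
    (Measure.measurable_map _ measurable_fst).comp
      (measurable_withDensity (measurable_val h_nonneg h_cover)
        ((continuous_triangleDensity K).measurable.comp measurable_snd).coe_nnreal_ennreal)

lemma laplaceFunctional_map_triangleAverage (h_nonneg : ∀ k x, 0 ≤ h k x)
    (h_cover : ∀ x, ∃ k, 0 < h k x) (Q : Measure (LevelMeasures h)) (K : ℕ) {G : S → ℝ}
    (hG : Measurable G) (hG_nonneg : ∀ x, 0 ≤ G x) :
    laplaceFunctional (Q.map (triangleAverage K)) (fun ν => ν.1) (fun x => ENNReal.ofReal (G x)) =
      laplaceFunctional Q (fun μ => μ.1)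
        fun z => ENNReal.ofReal (G z.1 * triangleDensity K z.2) := by
  rw [laplaceFunctional_map (measurable_triangleAverage h_nonneg h_cover K).aemeasurable
    (LocationMeasures.measurable_lintegral h_nonneg h_cover hG.ennreal_ofReal)]
  simp only [laplaceFunctional, lintegral_triangleAverage K _ hG hG_nonneg]

end LevelMeasures

end TriangleAverage

/-! ### Limits of points with uniform levels -/

section Limit

lemma tendstoUniformly_laplaceFunctional_levelExponent {S ι : Type*} [MeasurableSpace S]
    {Ω : ι → Type*} [∀ i, MeasurableSpace (Ω i)] {P : ∀ i, Measure (Ω i)}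
    [∀ i, IsProbabilityMeasure (P i)] {X : ∀ i, Ω i → Measure S} (hX : ∀ i, Measurable (X i))
    {G : S → ℝ} (hG : Measurable G) (hG_nonneg : ∀ x, 0 ≤ G x) {C : ℝ} (hC : 0 ≤ C)
    (hGC : ∀ x, G x ≤ C) :
    TendstoUniformly (fun (K : ℕ) i =>
        laplaceFunctional (P i) (X i) (levelExponent fun z => G z.1 * triangleDensity K z.2))
      (fun i => laplaceFunctional (P i) (X i) fun x => ENNReal.ofReal (G x)) atTop := by
  have herror : Tendsto (fun K : ℕ => C * (2 / ((K : ℝ) + 1))) atTop (𝓝 0) := by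
    simpa [div_eq_mul_inv, mul_assoc] using
      (tendsto_one_div_add_atTop_nhds_zero_nat (𝕜 := ℝ)).const_mul (C * 2)
  refine Metric.tendstoUniformly_iff.2 fun ε hε => ?_
  filter_upwards [herror.eventually (gt_mem_nhds hε)] with K hK i
  rw [dist_comm, Real.dist_eq]
  exact (abs_laplaceFunctional_levelExponent_sub_le (hX i) hG hG_nonneg hC hGC K).trans_lt hK

variable {S : Type*} [TopologicalSpace S] [PolishSpace S] [MeasurableSpace S] [BorelSpace S]
  {h : ℕ → S →ᵇ ℝ} (h_nonneg : ∀ k x, 0 ≤ h k x) (h_cover : ∀ x, ∃ k, 0 < h k x)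

include h_nonneg h_cover

lemma exists_isConditionallyPoisson (P : ProbabilityMeasure (LocationMeasures h)) :
    ∃ Q : ProbabilityMeasure (LevelMeasures h),
      IsConditionallyPoisson (Q : Measure (LevelMeasures h)) P := by
  obtain ⟨κ, hκ, hκ_poisson⟩ := exists_poissonKernel h_nonneg h_cover
  exact ⟨⟨(P : Measure (LocationMeasures h)).bind κ, inferInstance⟩, κ, hκ,
    .of_forall hκ_poisson, rfl⟩

variable {Ω : ℕ → Type*} [∀ n, MeasurableSpace (Ω n)] {prob : ∀ n, Measure (Ω n)}
  [∀ n, IsProbabilityMeasure (prob n)] {ξ : ∀ n, Ω n → LevelMeasures h}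
  {Q : ProbabilityMeasure (LevelMeasures h)} {P : ProbabilityMeasure (LocationMeasures h)}

omit h_cover in
lemma LevelMeasures.eq_of_tendstoInDistribution {Q' : ProbabilityMeasure (LevelMeasures h)}
    (hQ : TendstoInDistribution ξ atTop id prob (Q : Measure (LevelMeasures h)))
    (hQ' : TendstoInDistribution ξ atTop id prob (Q' : Measure (LevelMeasures h))) : Q = Q' := by
  have hmeasure : (Q : Measure (LevelMeasures h)) = Q' :=
    (LevelMeasures.isTestInduced h_nonneg).measure_ext (levelWeights_nonneg h_nonneg)
      fun _ hF => tendsto_nhds_unique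
        (tendsto_laplaceFunctional_of_tendstoInDistribution hQ
          (LevelMeasures.continuous_lintegral h_nonneg hF))
        (tendsto_laplaceFunctional_of_tendstoInDistribution hQ'
          (LevelMeasures.continuous_lintegral h_nonneg hF))
  exact Subtype.ext hmeasure

variable {r : ℕ → ℝ≥0} (r_tendsto : Tendsto r atTop atTop) (ξ_meas : ∀ n, Measurable (ξ n))
  (hξ : ∀ n, HasUniformLevels (r n) (prob n) (ξ n))

include ξ_meas

omit [∀ n, IsProbabilityMeasure (prob n)] in
lemma measurable_normalizedMarginal_comp (n : ℕ) :
    Measurable fun ω => ((ξ n ω).normalizedMarginal (r n)).1 :=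
  (LocationMeasures.measurable_val h_nonneg h_cover).comp
    ((LevelMeasures.measurable_normalizedMarginal h_nonneg h_cover (r n)).comp (ξ_meas n))

include r_tendsto hξ

lemma tendsto_laplaceFunctional_sub_levelExponent {F : S × ℝ≥0 → ℝ}
    (hF : F ∈ testClass (levelWeights h)) :
    Tendsto (fun n =>
      laplaceFunctional (prob n) (fun ω => (ξ n ω).1) (fun z => ENNReal.ofReal (F z)) -
        laplaceFunctional (prob n) (fun ω => ((ξ n ω).normalizedMarginal (r n)).1)
          (levelExponent F)) atTop (𝓝 0) := by
  obtain ⟨K, hK⟩ := exists_level_bound_of_mem_testClass hF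
  have herror : Tendsto (fun n => 2 * (K : ℝ) / r n) atTop (𝓝 0) :=
    tendsto_const_nhds.div_atTop (NNReal.tendsto_coe_atTop.2 r_tendsto)
  refine squeeze_zero_norm' ?_ herror
  filter_upwards [r_tendsto.eventually_ge_atTop (2 * K), r_tendsto.eventually_gt_atTop 0]
    with n hKr hr
  exact (hξ n).abs_laplaceFunctional_sub_levelExponent_le h_nonneg h_cover (ξ_meas n)
    (continuous_of_mem_testClass hF).measurable
    (nonneg_of_mem_testClass (levelWeights_nonneg h_nonneg) hF) hK hr hKr

lemma tendsto_laplaceFunctional_levelExponent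
    (hQ : TendstoInDistribution ξ atTop id prob (Q : Measure (LevelMeasures h)))
    {F : S × ℝ≥0 → ℝ} (hF : F ∈ testClass (levelWeights h)) :
    Tendsto (fun n => laplaceFunctional (prob n)
        (fun ω => ((ξ n ω).normalizedMarginal (r n)).1) (levelExponent F)) atTop
      (𝓝 (laplaceFunctional (Q : Measure (LevelMeasures h)) (fun μ => μ.1)
        fun z => ENNReal.ofReal (F z))) := by
  simpa only [sub_sub_cancel, sub_zero] using
    (tendsto_laplaceFunctional_of_tendstoInDistribution hQ
      (LevelMeasures.continuous_lintegral h_nonneg hF)).sub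
    (tendsto_laplaceFunctional_sub_levelExponent h_nonneg h_cover r_tendsto ξ_meas hξ hF)

lemma tendstoInDistribution_of_normalizedMarginal
    (hQP : IsConditionallyPoisson (Q : Measure (LevelMeasures h)) P)
    (hP : TendstoInDistribution (fun n ω => (ξ n ω).normalizedMarginal (r n)) atTop id prob
      (P : Measure (LocationMeasures h))) :
    TendstoInDistribution ξ atTop id prob (Q : Measure (LevelMeasures h)) := by
  refine (LevelMeasures.isTestInduced h_nonneg).tendstoInDistribution
    (levelWeights_nonneg h_nonneg) (fun F hF => LevelMeasures.continuous_lintegral h_nonneg hF)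
    ξ_meas fun F hF => ?_
  obtain ⟨G, hG, hFG⟩ := exists_testClass_levelExponent h_nonneg hF
  have hexponent : levelExponent F = fun x => ENNReal.ofReal (G x) := funext hFG
  have hsub := tendsto_laplaceFunctional_sub_levelExponent h_nonneg h_cover r_tendsto ξ_meas hξ hF
  rw [hQP.laplaceFunctional_eq h_nonneg h_cover (continuous_of_mem_testClass hF).measurable
    (nonneg_of_mem_testClass (levelWeights_nonneg h_nonneg) hF)]
  rw [hexponent] at hsub ⊢
  simpa only [sub_add_cancel, zero_add] using
    hsub.add (tendsto_laplaceFunctional_of_tendstoInDistribution hP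
      (continuous_lintegral_of_mem_testClass h_nonneg hG))

lemma tendstoInDistribution_normalizedMarginal
    (hQ : TendstoInDistribution ξ atTop id prob (Q : Measure (LevelMeasures h)))
    {L : Filter ℕ} [L.NeBot] (hL : L ≤ atTop)
    (hP : ∀ G ∈ testClass h, Tendsto (fun K : ℕ =>
        laplaceFunctional (Q : Measure (LevelMeasures h)) (fun μ => μ.1)
          fun z => ENNReal.ofReal (G z.1 * triangleDensity K z.2)) L
      (𝓝 (laplaceFunctional (P : Measure (LocationMeasures h)) (fun ν => ν.1)
        fun x => ENNReal.ofReal (G x)))) :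
    TendstoInDistribution (fun n ω => (ξ n ω).normalizedMarginal (r n)) atTop id prob
      (P : Measure (LocationMeasures h)) := by
  refine (LocationMeasures.isTestInduced h_nonneg).tendstoInDistribution h_nonneg
    (fun G hG => continuous_lintegral_of_mem_testClass h_nonneg hG)
    (fun n => (LevelMeasures.measurable_normalizedMarginal h_nonneg h_cover (r n)).comp (ξ_meas n))
    fun G hG => ?_
  obtain ⟨C, hC, hGC⟩ := exists_bound_of_mem_testClass h_nonneg hG
  have huniform := tendstoUniformly_laplaceFunctional_levelExponent (P := prob)
    (measurable_normalizedMarginal_comp (r := r) h_nonneg h_cover ξ_meas)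
    (continuous_of_mem_testClass hG).measurable (fun x => (hGC x).1) hC fun x => (hGC x).2
  exact ((huniform.tendstoUniformlyOnFilter.mono_left hL).mono_right
    le_top).tendsto_of_eventually_tendsto (.of_forall fun K =>
      tendsto_laplaceFunctional_levelExponent h_nonneg h_cover r_tendsto ξ_meas hξ hQ
        (mul_triangleDensity_mem_testClass hG K)) (hP G hG)

lemma tendstoInDistribution_normalizedMarginal_of_isConditionallyPoisson
    (hQP : IsConditionallyPoisson (Q : Measure (LevelMeasures h)) P)
    (hQ : TendstoInDistribution ξ atTop id prob (Q : Measure (LevelMeasures h))) :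
    TendstoInDistribution (fun n ω => (ξ n ω).normalizedMarginal (r n)) atTop id prob
      (P : Measure (LocationMeasures h)) := by
  refine tendstoInDistribution_normalizedMarginal h_nonneg h_cover r_tendsto ξ_meas hξ hQ
    le_rfl fun G hG => ?_
  obtain ⟨C, hC, hGC⟩ := exists_bound_of_mem_testClass h_nonneg hG
  have huniform := tendstoUniformly_laplaceFunctional_levelExponent
    (P := fun _ : Unit => (P : Measure (LocationMeasures h)))
    (fun _ => LocationMeasures.measurable_val h_nonneg h_cover)
    (continuous_of_mem_testClass hG).measurable (fun x => (hGC x).1) hC fun x => (hGC x).2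
  refine (huniform.tendsto_at ()).congr fun K => ?_
  have hmem := mul_triangleDensity_mem_testClass hG K
  exact (hQP.laplaceFunctional_eq h_nonneg h_cover (continuous_of_mem_testClass hmem).measurable
    (nonneg_of_mem_testClass (levelWeights_nonneg h_nonneg) hmem)).symm

lemma laplaceFunctional_le_of_levelExponent_le
    (hQ : TendstoInDistribution ξ atTop id prob (Q : Measure (LevelMeasures h)))
    {F F' : S × ℝ≥0 → ℝ} (hF : F ∈ testClass (levelWeights h))
    (hF' : F' ∈ testClass (levelWeights h)) (hle : ∀ x, levelExponent F x ≤ levelExponent F' x) :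
    laplaceFunctional (Q : Measure (LevelMeasures h)) (fun μ => μ.1)
        (fun z => ENNReal.ofReal (F' z)) ≤
      laplaceFunctional (Q : Measure (LevelMeasures h)) (fun μ => μ.1)
        fun z => ENNReal.ofReal (F z) :=
  le_of_tendsto_of_tendsto'
    (tendsto_laplaceFunctional_levelExponent h_nonneg h_cover r_tendsto ξ_meas hξ hQ hF')
    (tendsto_laplaceFunctional_levelExponent h_nonneg h_cover r_tendsto ξ_meas hξ hQ hF) fun n =>
      laplaceFunctional_anti (measurable_normalizedMarginal_comp h_nonneg h_cover ξ_meas n)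
        (measurable_levelExponent (continuous_of_mem_testClass hF).measurable)
        (measurable_levelExponent (continuous_of_mem_testClass hF').measurable) hle

lemma laplaceDominated_map_triangleAverage
    (hQ : TendstoInDistribution ξ atTop id prob (Q : Measure (LevelMeasures h))) (K : ℕ) :
    LaplaceDominated ((Q : Measure (LevelMeasures h)).map (LevelMeasures.triangleAverage K))
      ((Q : Measure (LevelMeasures h)).map (LevelMeasures.triangleAverage 3)) := by
  intro G hG hG_le
  have hG_nonneg := nonneg_of_mem_testClass h_nonneg hG
  have hG_meas := (continuous_of_mem_testClass hG).measurable
  rw [LevelMeasures.laplaceFunctional_map_triangleAverage h_nonneg h_cover Q 3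
      (hG_meas.const_mul 2) fun x => mul_nonneg zero_le_two (hG_nonneg x),
    LevelMeasures.laplaceFunctional_map_triangleAverage h_nonneg h_cover Q K hG_meas hG_nonneg]
  exact laplaceFunctional_le_of_levelExponent_le h_nonneg h_cover r_tendsto ξ_meas hξ hQ
    (mul_triangleDensity_mem_testClass hG K)
    (mul_triangleDensity_mem_testClass (const_mul_mem_testClass hG zero_le_two) 3) fun x =>
      (levelExponent_mul_triangleDensity_le hG_nonneg K x).trans
        (le_levelExponent_two_mul hG_nonneg hG_le x)

lemma exists_tendsto_map_triangleAverage (h_le_one : ∀ k x, h k x ≤ 1)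
    (hQ : TendstoInDistribution ξ atTop id prob (Q : Measure (LevelMeasures h))) :
    ∃ P, Tendsto (fun K => Q.map
      (LevelMeasures.measurable_triangleAverage h_nonneg h_cover K).aemeasurable)
      (hyperfilter ℕ) (𝓝 P) := by
  have := LocationMeasures.t2Space h_nonneg h_cover
  let PK : ℕ → ProbabilityMeasure (LocationMeasures h) := fun K =>
    Q.map (LevelMeasures.measurable_triangleAverage h_nonneg h_cover K).aemeasurable
  have htight : IsTightMeasureSet {((μ : ProbabilityMeasure (LocationMeasures h)) :
      Measure (LocationMeasures h)) | μ ∈ Set.range PK} := by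
    refine isTightMeasureSet_of_laplaceDominated (P₀ := PK 3) h_nonneg h_le_one h_cover ?_
    rintro _ ⟨_, ⟨K, rfl⟩, rfl⟩
    exact ⟨inferInstance,
      laplaceDominated_map_triangleAverage h_nonneg h_cover r_tendsto ξ_meas hξ hQ K⟩
  obtain ⟨P, -, hP⟩ := (isCompact_closure_of_isTightMeasureSet htight).ultrafilter_le_nhds
    ((hyperfilter ℕ).map PK) (le_principal_iff.2
      (mem_of_superset range_mem_map subset_closure))
  exact ⟨P, hP⟩

lemma exists_tendstoInDistribution_normalizedMarginal (h_le_one : ∀ k x, h k x ≤ 1)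
    (hQ : TendstoInDistribution ξ atTop id prob (Q : Measure (LevelMeasures h))) :
    ∃ P : ProbabilityMeasure (LocationMeasures h),
      TendstoInDistribution (fun n ω => (ξ n ω).normalizedMarginal (r n)) atTop id prob
        (P : Measure (LocationMeasures h)) := by
  obtain ⟨P, hP⟩ :=
    exists_tendsto_map_triangleAverage h_nonneg h_cover r_tendsto ξ_meas hξ h_le_one hQ
  refine ⟨P, tendstoInDistribution_normalizedMarginal h_nonneg h_cover r_tendsto ξ_meas hξ hQ
    Nat.hyperfilter_le_atTop fun G hG => ?_⟩
  refine (tendsto_laplaceFunctional hP (continuous_lintegral_of_mem_testClass h_nonneg hG)).congr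
    fun K => ?_
  exact LevelMeasures.laplaceFunctional_map_triangleAverage h_nonneg h_cover Q K
    (continuous_of_mem_testClass hG).measurable (nonneg_of_mem_testClass h_nonneg hG)

end Limit

theorem mainTheorem6 {S : Type*} [TopologicalSpace S] [PolishSpace S] [MeasurableSpace S]
    [BorelSpace S]
    (h : ℕ → S →ᵇ ℝ) (h_nonneg : ∀ k x, 0 ≤ h k x) (h_le_one : ∀ k x, h k x ≤ 1)
    (h_cover : ∀ x, ∃ k, 0 < h k x)
    (r : ℕ → ℝ≥0) (r_pos : ∀ n, 0 < r n) (r_tendsto : Tendsto r atTop atTop)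
    {Ω : ℕ → Type*} [∀ n, MeasurableSpace (Ω n)] (prob : ∀ n, Measure (Ω n))
    [∀ n, IsProbabilityMeasure (prob n)]
    -- `ξ n` is a point process on `S × [0, r n]`
    (ξ : ∀ n, Ω n → LevelMeasures h) (ξ_meas : ∀ n, Measurable (ξ n))
    (ξ_counting : ∀ n, ∀ᵐ ω ∂(prob n), IsCountingMeasure (ξ n ω).1)
    (ξ_supp : ∀ n, ∀ᵐ ω ∂(prob n), (ξ n ω).1 {z | r n < z.2} = 0)
    (Ξ : ∀ n, Ω n → LocationMeasures h)
    (Ξ_def : ∀ n ω, Ξ n ω = (ξ n ω).normalizedMarginal (r n))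
    (laplace : ∀ n, ∀ f : S × ℝ≥0 → ℝ, Measurable f → (∀ z, 0 ≤ f z) →
      ∫ ω, expNeg (∫⁻ z, ENNReal.ofReal (f z) ∂(ξ n ω).1) ∂(prob n) =
        ∫ ω, expNeg (∫⁻ x, ENNReal.ofReal (levelTransform (r n) f x) ∂(Ξ n ω).1) ∂(prob n)) :
    -- `ξ n` converges in distribution if and only if `Ξ n` does
    ((∃ Q : ProbabilityMeasure (LevelMeasures h), TendstoInDistribution ξ atTop id prob Q) ↔
      ∃ P : ProbabilityMeasure (LocationMeasures h), TendstoInDistribution Ξ atTop id prob P) ∧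
    -- the limits are related by the conditionally Poisson property
    (∀ (Q : ProbabilityMeasure (LevelMeasures h)) (P : ProbabilityMeasure (LocationMeasures h)),
      TendstoInDistribution ξ atTop id prob Q → TendstoInDistribution Ξ atTop id prob P →
        IsConditionallyPoisson (Q : Measure (LevelMeasures h)) P) ∧
    -- for limits so related, the two convergences are equivalent
    (∀ (Q : ProbabilityMeasure (LevelMeasures h)) (P : ProbabilityMeasure (LocationMeasures h)),
      IsConditionallyPoisson (Q : Measure (LevelMeasures h)) P →
        (TendstoInDistribution ξ atTop id prob Q ↔ TendstoInDistribution Ξ atTop id prob P)) := by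
  obtain rfl : Ξ = fun n ω => (ξ n ω).normalizedMarginal (r n) := funext₂ Ξ_def
  have hξ : ∀ n, HasUniformLevels (r n) (prob n) (ξ n) := laplace
  have poisson_limit (Q : ProbabilityMeasure (LevelMeasures h))
      (P : ProbabilityMeasure (LocationMeasures h))
      (hQP : IsConditionallyPoisson (Q : Measure (LevelMeasures h)) P) :=
    tendstoInDistribution_of_normalizedMarginal h_nonneg h_cover r_tendsto ξ_meas hξ hQP
  refine ⟨⟨fun ⟨Q, hQ⟩ => ?_, fun ⟨P, hP⟩ => ?_⟩, fun Q P hQ hP => ?_, fun Q P hQP =>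
    ⟨fun hQ => ?_, poisson_limit Q P hQP⟩⟩
  · exact exists_tendstoInDistribution_normalizedMarginal h_nonneg h_cover r_tendsto ξ_meas hξ
      h_le_one hQ
  · obtain ⟨Q, hQP⟩ := exists_isConditionallyPoisson h_nonneg h_cover P
    exact ⟨Q, poisson_limit Q P hQP hP⟩
  · obtain ⟨Q', hQP⟩ := exists_isConditionallyPoisson h_nonneg h_cover P
    rwa [LevelMeasures.eq_of_tendstoInDistribution h_nonneg hQ (poisson_limit Q' P hQP hP)]
  · exact tendstoInDistribution_normalizedMarginal_of_isConditionallyPoisson h_nonneg h_cover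
      r_tendsto ξ_meas hξ hQP hQ
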